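/- **Setting.** Let $d\in\{2,3\}$ and let $\Omega\subset\mathbb R^d$ be a polygonal ($d=2$) or polyhedral ($d=3$) domain, not necessarily Lipschitz (slits are allowed). Let $\mathcal T_0$ be a conforming triangulation of $\Omega$ into simplices, where conforming means that two simplices which meet inside $\Omega$ meet in a common face. *Bisection.* Each simplex is tagged: it carries an ordering $(x_0,\dots,x_d)$ of its vertices and a type $t\in\{0,\dots,d-1\}$. Its refinement edge is $x_0x_d$. Newest-vertex bisection splits it at the midpoint $x'$ of $x_0x_d$ into $(x_0,x',x_1,\dots,x_{d-1})$ and $(x_d,x',x_1,\dots,x_t,x_{d-1},\dots,x_{t+1})$, both of type $(t+1)\bmod d$. *Flagging.* $\mathcal T_0$ is assumed to be properly flagged. For $d=2$ this means that whenever an interior edge is the refinement edge of one adjacent triangle, it is the refinement edge of both. For general $d$ it means the following. All simplices have the same type. If $T,T'\in\mathcal T_0$ share a $(d-1)$-dimensional face not contained in $\partial\Omega$, and this face contains the refinement edge of $T$ or of $T'$, then $T$ and $T'$ are reflected neighbours; otherwise their children that contain this face are reflected neighbours. Here $T=(x_0,\dots,x_d)_t$ and $T'$ of the same type $t$ are reflected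 neighbours if the ordered vertex list of $T$, or the list $(x_d,x_1,\dots,x_t,x_{d-1},\dots,x_{t+1},x_0)$, agrees with that of $T'$ in all positions but one. *Routines.* $\mathtt{refine}(\mathcal T,\mathcal M)$ bisects each $T\in\mathcal M\subset\mathcal T$ once, and $\mathtt{complete}(\mathcal T)$ is the coarsest conforming mesh obtained from $\mathcal T$ by bisections. *Data.* Let $p\ge1$ be an integer. Let $x_1,\dots,x_N$ ($N\ge1$) be vertices of $\mathcal T_0$ (the singular points), let $\gamma_1,\dots,\gamma_N>0$ (the singular exponents), and put $\gamma=\frac12\min_i\gamma_i$. Let $\delta>0$ satisfy $\#\mathcal T_0\le\delta^{-d}$ and let $K\in\mathbb N$ (with $0\in\mathbb N$) satisfy $$2^{-\frac{(K+1)(2\gamma+d-2)}{2p+d}}\le\delta<2^{-\frac{K(2\gamma+d-2)}{2p+d}}.$$ Write $h_T=|T|^{1/d}$ and $r_T=\min_i\operatorname{dist}(x_i,T)$. *Algorithm.* 1. First loop. Put $\mathcal T_{0,0}^c=\mathcal T_0$. For $j=0,1,2,\dots$ let $\mathcal M_{0,j}=\{T\in\mathcal T_{0,j}^c: h_T>\delta\}$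 and $\mathcal T_{0,j+1}^c=\mathtt{complete}(\mathtt{refine}(\mathcal T_{0,j}^c,\mathcal M_{0,j}))$. Stop after the first $j$ with $\mathcal M_{0,j}=\emptyset$, and put $\mathcal T_1^c=\mathcal T_{0,j+1}^c$ for this $j$. 2. Second loop. For $\ell=1,\dots,d(K+1)-1$ let $\Omega_\ell=\bigcup\{T\in\mathcal T_\ell^c: r_T\le2^{-\ell/d}\}$, $\mathcal M_\ell=\{T\in\mathcal T_\ell^c: T\subset\Omega_\ell,\ h_T>\delta\,2^{\frac{2\ell(\gamma-p-1)}{d(2p+d)}}\}$ and $\mathcal T_{\ell+1}^c=\mathtt{complete}(\mathtt{refine}(\mathcal T_\ell^c,\mathcal M_\ell))$. **Lemma (complexity).** The algorithm can be carried out and terminates, and there is a constant $C_3$, depending only on $d$, $p$, $\gamma$ and the flagged triangulation $\mathcal T_0$ of $\Omega$ (in particular not on $\delta$, $K$, or the choice of the points $x_i$ and the exponents $\gamma_i$ beyond $\gamma$), such that the mesh it produces satisfies $$\#\mathcal T_{d(K+1)}^c-\#\mathcal T_0\le C_3\,\delta^{-d}.$$ -/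

import Mathlib

open Set MeasureTheory

namespace Bisection

/-- A tagged simplex in `ℝ^d`: an ordered list of vertices `x₀, …, x_d` together with a type
(a number `< d` for the simplices that occur). The ordering and the type encode the flagging that
newest-vertex bisection uses; the refinement edge is `x₀ x_d`. -/
@[ext]
structure TaggedSimplex (d : ℕ) where
  vtx : Fin (d + 1) → EuclideanSpace ℝ (Fin d)
  type : ℕ

/-- A mesh is a finite set of tagged simplices. -/
abbrev Mesh (d : ℕ) := Finset (TaggedSimplex d)

namespace TaggedSimplex

variable {d : ℕ}

/-- The set of vertices. -/
def verts (T : TaggedSimplex d) : Set (EuclideanSpace ℝ (Fin d)) := Set.range T.vtx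

/-- The closed simplex itself. -/
def body (T : TaggedSimplex d) : Set (EuclideanSpace ℝ (Fin d)) := convexHull ℝ T.verts

/-- The end points of the refinement edge. -/
def refEdge (T : TaggedSimplex d) : Set (EuclideanSpace ℝ (Fin d)) :=
  {T.vtx 0, T.vtx (Fin.last d)}

/-- The midpoint of the refinement edge: the new vertex. -/
noncomputable def newVertex (T : TaggedSimplex d) : EuclideanSpace ℝ (Fin d) :=
  midpoint ℝ (T.vtx 0) (T.vtx (Fin.last d))

/-- First child of `(x₀, …, x_d)_t`: the simplex `(x₀, x', x₁, …, x_{d-1})` of type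
`t + 1 mod d`, where `x'` is the new vertex. -/
noncomputable def child₁ (T : TaggedSimplex d) : TaggedSimplex d where
  vtx i := if (i : ℕ) = 0 then T.vtx 0
    else if (i : ℕ) = 1 then T.newVertex
    else T.vtx (Fin.ofNat (d + 1) (i - 1))
  type := (T.type + 1) % d

/-- Second child of `(x₀, …, x_d)_t`: the simplex
`(x_d, x', x₁, …, x_t, x_{d-1}, x_{d-2}, …, x_{t+1})` of type `t + 1 mod d`, where `x'` is the new
vertex. -/
noncomputable def child₂ (T : TaggedSimplex d) : TaggedSimplex d where
  vtx i := if (i : ℕ) = 0 then T.vtx (Fin.last d)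
    else if (i : ℕ) = 1 then T.newVertex
    else if (i : ℕ) ≤ T.type + 1 then T.vtx (Fin.ofNat (d + 1) (i - 1))
    else T.vtx (Fin.ofNat (d + 1) (d + T.type + 1 - i))
  type := (T.type + 1) % d

open scoped Classical in
/-- The two simplices into which bisection splits `T`. -/
noncomputable def children (T : TaggedSimplex d) : Mesh d := {T.child₁, T.child₂}

/-- The tagging `(x_d, x₁, …, x_t, x_{d-1}, …, x_{t+1}, x₀)_t` of the same simplex; it has the same
children as `(x₀, …, x_d)_t`. -/
def reversed (T : TaggedSimplex d) : TaggedSimplex d where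
  vtx i := if (i : ℕ) = 0 then T.vtx (Fin.last d)
    else if (i : ℕ) = d then T.vtx 0
    else if (i : ℕ) ≤ T.type then T.vtx i
    else T.vtx (Fin.ofNat (d + 1) (d + T.type - i))
  type := T.type

/-- Two vertex lists coincide in all positions but one. -/
def DifferInOne (T T' : TaggedSimplex d) : Prop :=
  ∃ i, T.vtx i ≠ T'.vtx i ∧ ∀ j, j ≠ i → T.vtx j = T'.vtx j

/-- Reflected neighbours: simplices of the same type such that the vertex list of `T`, or of `T`
reversed, coincides with that of `T'` in all positions but one. -/
def ReflectedNeighbours (T T' : TaggedSimplex d) : Prop :=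
  T.type = T'.type ∧ (DifferInOne T T' ∨ DifferInOne T.reversed T')

/-- `T` and `T'` are neighbours in `Ω`: they share a `(d-1)`-dimensional face which is not
contained in the boundary of `Ω`. -/
def NeighboursIn (Ω : Set (EuclideanSpace ℝ (Fin d))) (T T' : TaggedSimplex d) : Prop :=
  (T.verts ∩ T'.verts).ncard = d ∧ (convexHull ℝ (T.verts ∩ T'.verts) ∩ Ω).Nonempty

/-- The element size `h_T = |T|^{1/d}`. -/
noncomputable def size (T : TaggedSimplex d) : ℝ :=
  (volume T.body).toReal ^ (1 / (d : ℝ))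

/-- `r_T = min_i dist (x_i, T)`. -/
noncomputable def distTo {N : ℕ} (x : Fin N → EuclideanSpace ℝ (Fin d)) (T : TaggedSimplex d) : ℝ :=
  ⨅ i, Metric.infDist (x i) T.body

end TaggedSimplex

variable {d : ℕ}

/-- No hanging nodes: simplices that meet inside `Ω` meet in a common face. Simplices that only
meet on the boundary of `Ω` (for instance from opposite sides of a slit) are not compared. -/
def Conforming (Ω : Set (EuclideanSpace ℝ (Fin d))) (𝒯 : Mesh d) : Prop :=
  ∀ T ∈ 𝒯, ∀ T' ∈ 𝒯, (T.body ∩ T'.body ∩ Ω).Nonempty →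
    T.body ∩ T'.body = convexHull ℝ (T.verts ∩ T'.verts)

/-- The flagging of `𝒯` is proper: all simplices have the same type, and for simplices
`T`, `T'` that are neighbours in `Ω`: if their common face contains the refinement edge of one of
them, then they are reflected neighbours (so that this edge is the refinement edge of both);
otherwise their children which contain the common face are reflected neighbours.

For `d = 2` the type has no effect, and the condition says precisely that an interior edge which is
the refinement edge of one adjacent triangle is the refinement edge of the other one, too. -/
structure ProperlyFlagged (Ω : Set (EuclideanSpace ℝ (Fin d))) (𝒯 : Mesh d) : Prop where
  type_lt : ∀ T ∈ 𝒯, T.type < d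
  type_eq : ∀ T ∈ 𝒯, ∀ T' ∈ 𝒯, T.type = T'.type
  refEdge_mem : ∀ T ∈ 𝒯, ∀ T' ∈ 𝒯, T.NeighboursIn Ω T' →
    (T.refEdge ⊆ T.verts ∩ T'.verts ∨ T'.refEdge ⊆ T.verts ∩ T'.verts) →
    T.ReflectedNeighbours T'
  refEdge_notMem : ∀ T ∈ 𝒯, ∀ T' ∈ 𝒯, T.NeighboursIn Ω T' →
    ¬ (T.refEdge ⊆ T.verts ∩ T'.verts ∨ T'.refEdge ⊆ T.verts ∩ T'.verts) →
    ∀ S ∈ T.children, ∀ S' ∈ T'.children,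
      T.verts ∩ T'.verts ⊆ S.verts → T.verts ∩ T'.verts ⊆ S'.verts → S.ReflectedNeighbours S'

/-- `𝒯` is a properly flagged, conforming triangulation of the polygonal or polyhedral domain `Ω`.
That `Ω` is polygonal or polyhedral is expressed by `cover` and `resolves`: its closure is the union
of the simplices, and its boundary is a union of faces of them. Slits are allowed. -/
structure IsInitialTriangulation (Ω : Set (EuclideanSpace ℝ (Fin d))) (𝒯 : Mesh d) : Prop where
  isOpen : IsOpen Ω
  isConnected : IsConnected Ω
  affineIndependent : ∀ T ∈ 𝒯, AffineIndependent ℝ T.vtx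
  cover : ⋃ T ∈ 𝒯, T.body = closure Ω
  disjoint : ∀ T ∈ 𝒯, ∀ T' ∈ 𝒯, T ≠ T' → Disjoint (interior T.body) (interior T'.body)
  resolves : ∀ T ∈ 𝒯, ∀ s ⊆ T.verts,
    intrinsicInterior ℝ (convexHull ℝ s) ⊆ Ω ∨ Disjoint (intrinsicInterior ℝ (convexHull ℝ s)) Ω
  conforming : Conforming Ω 𝒯
  properlyFlagged : ProperlyFlagged Ω 𝒯

open scoped Classical in
/-- The routine `refine`: bisect every marked element once. -/
noncomputable def refine (𝒯 ℳ : Mesh d) : Mesh d :=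
  (𝒯 \ ℳ) ∪ ℳ.biUnion TaggedSimplex.children

/-- `𝒯'` arises from `𝒯` by finitely many (possibly no) bisections of single elements. -/
def Refines (𝒯 𝒯' : Mesh d) : Prop :=
  Relation.ReflTransGen (fun 𝒮 𝒮' : Mesh d => ∃ T ∈ 𝒮, 𝒮' = refine 𝒮 {T}) 𝒯 𝒯'

/-- The routine `complete`: `𝒯'` is the coarsest conforming refinement of `𝒯`. -/
structure IsCompletion (Ω : Set (EuclideanSpace ℝ (Fin d))) (𝒯 𝒯' : Mesh d) : Prop where
  refines : Refines 𝒯 𝒯'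
  conforming : Conforming Ω 𝒯'
  least : ∀ 𝒯'' : Mesh d, Refines 𝒯 𝒯'' → Conforming Ω 𝒯'' → Refines 𝒯' 𝒯''

open scoped Classical in
/-- Marking in the first loop: `{T : h_T > δ}`. -/
noncomputable def firstMarked (δ : ℝ) (𝒯 : Mesh d) : Mesh d :=
  𝒯.filter fun T => δ < T.size

/-- The region `Ω_ℓ`, the union of the `T ∈ 𝒯` with `r_T ≤ 2^{-ℓ/d}`. -/
def nearRegion {N : ℕ} (x : Fin N → EuclideanSpace ℝ (Fin d)) (ℓ : ℕ) (𝒯 : Mesh d) :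
    Set (EuclideanSpace ℝ (Fin d)) :=
  ⋃ T ∈ {T | T ∈ 𝒯 ∧ T.distTo x ≤ (2 : ℝ) ^ (-(ℓ : ℝ) / d)}, T.body

open scoped Classical in
/-- Marking in the second loop: `{T ⊂ Ω_ℓ : h_T > δ 2^{2ℓ(γ-p-1)/(d(2p+d))}}`. -/
noncomputable def secondMarked {N : ℕ} (x : Fin N → EuclideanSpace ℝ (Fin d)) (γ : ℝ) (p : ℕ)
    (δ : ℝ) (ℓ : ℕ) (𝒯 : Mesh d) : Mesh d :=
  𝒯.filter fun T => T.body ⊆ nearRegion x ℓ 𝒯 ∧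
    δ * (2 : ℝ) ^ (2 * ℓ * (γ - p - 1) / (d * (2 * p + d))) < T.size

/-- A complete run of the algorithm. `first j` is the `j`-th completed mesh of the first loop, which
is left after `J = lastStep + 1` passes, as soon as nothing was marked in pass number `lastStep`;
`second ℓ`, for `1 ≤ ℓ ≤ d (K + 1)`, is the `ℓ`-th completed mesh of the second loop. -/
structure Run (Ω : Set (EuclideanSpace ℝ (Fin d))) (𝒯₀ : Mesh d) {N : ℕ}
    (x : Fin N → EuclideanSpace ℝ (Fin d)) (γ : ℝ) (p : ℕ) (δ : ℝ) (K : ℕ) where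
  first : ℕ → Mesh d
  lastStep : ℕ
  second : ℕ → Mesh d
  first_zero : first 0 = 𝒯₀
  first_step : ∀ j ≤ lastStep,
    IsCompletion Ω (refine (first j) (firstMarked δ (first j))) (first (j + 1))
  first_continue : ∀ j < lastStep, firstMarked δ (first j) ≠ ∅
  first_stop : firstMarked δ (first lastStep) = ∅
  second_one : second 1 = first (lastStep + 1)
  second_step : ∀ ℓ, 1 ≤ ℓ → ℓ < d * (K + 1) →
    IsCompletion Ω (refine (second ℓ) (secondMarked x γ p δ ℓ (second ℓ))) (second (ℓ + 1))

/-- The mesh that a run of the algorithm produces. -/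
def Run.output {Ω : Set (EuclideanSpace ℝ (Fin d))} {𝒯₀ : Mesh d} {N : ℕ}
    {x : Fin N → EuclideanSpace ℝ (Fin d)} {γ : ℝ} {p : ℕ} {δ : ℝ} {K : ℕ}
    (R : Run Ω 𝒯₀ x γ p δ K) : Mesh d :=
  R.second (d * (K + 1))

end Bisection

/-! The cost of all completions is controlled by comparison with one explicit conforming mesh that
depends on the data but not on the course of the algorithm; no amortised count of the simplices
created by completion is needed.

A mesh is encoded by the finite set `I` of simplices that were bisected to obtain it. This is a
parent-closed subset of the forest of all descendants, and the mesh is `leaves 𝒯₀ I`. Conformity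
survives intersection of such sets (`conforming_leaves_inter`), so a mesh with some conforming
refinement has a coarsest one, which lies below every conforming refinement. Hence, if `J` is a tree
with conforming leaves that contains everything the loops can mark in meshes below `J`, the whole
run stays below `J`: completions exist, the first loop stops because every nonempty marking enlarges
a subset of `J`, and the output has at most `#𝒯₀ + 2 #J` simplices (`nonempty_run`,
`Run.below_output`, `card_leaves_le`).

To build `J`, proper flagging and conformity are propagated to all uniform refinements
(`IsInitialTriangulation.uniform`). In a conforming, properly flagged mesh, if two simplices meet in
`Ω` and one contains the midpoint of the other's refinement edge, they have this edge in common
(`refEdge_eq_of_newVertex_mem`). So any selection rule that depends only on generation and new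
vertex, and passes to ancestors, yields a conforming mesh (`conforming_gradedTree`).

The rule is `GradedCond`. Put `b = 2^{-1/d}`; simplices of generation `g` have size at most `H b^g`.
If one is marked in pass `ℓ` of the second loop, then `δ b^{aℓ} < H b^g` for an exponent `a < 1`,
and it is within `b^ℓ` of a singular point. Eliminating `ℓ` leaves the distance bound `(H b^g /
δ)^{1/a}`. A margin `F b^g` makes the rule pass to ancestors, and using all vertices of `𝒯₀` as
centres makes the constant independent of the `x_i`.

Counting: generations with `H b^g > δ` contribute `O(δ^{-d})`. By volume packing, the `k`-th
generation after them contributes `O(δ^{-d} θ^k + 1)` with `θ < 1`, because `a < 1`. Only `L =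
d(K+1)` of these generations matter, so `#J = O(δ^{-d} + L)` (`exists_card_gradedTree_le`), and the
upper bound on `δ` gives `L = O(δ^{-d})` (`steps_le`). -/

namespace Bisection

/-! ### Extreme subsets of convex hulls -/

section ConvexGeometry

variable {E : Type*} [AddCommGroup E] [Module ℝ E]

/-- Lumping all other terms into one point of `A` exhibits the sum as a point of an open segment
that ends at `z i`. -/
theorem mem_of_sum_mem_isExtreme {A F : Set E} (hA : Convex ℝ A) (hF : IsExtreme ℝ A F)
    {ι : Type*} (s : Finset ι) (w : ι → ℝ) (z : ι → E) (hw : ∀ i ∈ s, 0 ≤ w i)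
    (hw1 : ∑ i ∈ s, w i = 1) (hz : ∀ i ∈ s, z i ∈ A) (hs : ∑ i ∈ s, w i • z i ∈ F)
    {i : ι} (hi : i ∈ s) (hpos : 0 < w i) : z i ∈ F := by
  classical
  rw [← Finset.add_sum_erase s _ hi] at hw1 hs
  have hw' : ∀ j ∈ s.erase i, 0 ≤ w j := fun j hj => hw j (Finset.mem_of_mem_erase hj)
  rcases (Finset.sum_nonneg hw').eq_or_lt with h0 | h0
  · have hz0 := (Finset.sum_eq_zero_iff_of_nonneg hw').1 h0.symm
    rw [Finset.sum_eq_zero (fun j hj => by rw [hz0 j hj, zero_smul])] at hs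
    have : w i = 1 := by linarith
    simpa [this] using hs
  · set c := ∑ j ∈ s.erase i, w j with hc
    have hy : ∑ j ∈ s.erase i, (w j / c) • z j ∈ A :=
      hA.sum_mem (fun j hj => div_nonneg (hw' j hj) h0.le)
        (by rw [← Finset.sum_div, div_self h0.ne'])
        (fun j hj => hz j (Finset.mem_of_mem_erase hj))
    refine hF.left_mem_of_mem_openSegment (hz i hi) hy hs ⟨w i, c, hpos, h0, hw1, ?_⟩
    rw [Finset.smul_sum]
    congr 1
    refine Finset.sum_congr rfl fun j _ => ?_
    rw [smul_smul, mul_div_cancel₀ _ h0.ne']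

theorem IsExtreme.inter_of_subset {A B F : Set E} (hF : IsExtreme ℝ A F) (hBA : B ⊆ A) :
    IsExtreme ℝ B (B ∩ F) :=
  ⟨inter_subset_left, fun _ hx _ hy _ hz h =>
    ⟨hx, hF.left_mem_of_mem_openSegment (hBA hx) (hBA hy) hz.2 h⟩⟩

theorem IsExtreme.eq_convexHull_inter {s F : Set E} (hF : IsExtreme ℝ (convexHull ℝ s) F)
    (hc : Convex ℝ F) : F = convexHull ℝ (s ∩ F) := by
  refine Subset.antisymm (fun x hx => ?_) (convexHull_min inter_subset_right hc)
  obtain ⟨ι, t, w, z, hw, hw1, hz, hxe⟩ :=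
    (mem_convexHull_iff_exists_fintype (R := ℝ)).1 (hF.subset hx)
  rw [← hxe] at hx ⊢
  have key : ∀ i, w i ≠ 0 → z i ∈ s ∩ F := fun i hi =>
    ⟨hz i, mem_of_sum_mem_isExtreme (convex_convexHull ℝ s) hF Finset.univ w z (fun j _ => hw j)
      hw1 (fun j _ => subset_convexHull ℝ s (hz j)) hx (Finset.mem_univ i)
      ((hw i).lt_of_ne' hi)⟩
  classical
  rw [← Finset.sum_filter_of_ne (p := fun i => w i ≠ 0) (by
    intro i _ h h0; exact h (by rw [h0, zero_smul]))]
  refine (convex_convexHull ℝ _).sum_mem (fun i _ => hw i) ?_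
    (fun i hi => subset_convexHull ℝ _ (key i (Finset.mem_filter.1 hi).2))
  rw [Finset.sum_filter_ne_zero]; exact hw1

theorem sum_coe {ι M : Type*} [AddCommMonoid M] (t : Finset ι) (f : ι → M) :
    ∑ i : (t : Set ι), f i = ∑ i ∈ t, f i := Finset.sum_coe_sort t f

/-- Barycentric coordinates are unique and nonnegative: if a proper combination of two points has no
weight off `s`, neither has the first point. -/
theorem isExtreme_convexHull_of_subset {s t : Set E} (ht : t.Finite)
    (hi : AffineIndependent ℝ ((↑) : t → E)) (hst : s ⊆ t) :
    IsExtreme ℝ (convexHull ℝ t) (convexHull ℝ s) := by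
  classical
  obtain ⟨t, rfl⟩ := ht.exists_finset_coe
  obtain ⟨s, rfl⟩ := (t.finite_toSet.subset hst).exists_finset_coe
  have hst' : s ⊆ t := Finset.coe_subset.1 hst
  refine ⟨convexHull_mono hst, fun x hx y hy z hz hxyz => ?_⟩
  obtain ⟨a, b, ha, hb, hab, rfl⟩ := hxyz
  obtain ⟨u, hu, hu1, rfl⟩ := Finset.mem_convexHull'.1 hx
  obtain ⟨v, hv, hv1, rfl⟩ := Finset.mem_convexHull'.1 hy
  obtain ⟨w, hw, hw1, hwz⟩ := Finset.mem_convexHull'.1 hz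
  have h0 := (affineIndependent_iff.1 hi) Finset.univ
    (fun i => a * u i + b * v i - if (i : E) ∈ s then w i else 0) (by
      rw [Finset.sum_sub_distrib, Finset.sum_add_distrib, ← Finset.mul_sum, ← Finset.mul_sum,
        sum_coe t u, sum_coe t v, sum_coe t (fun i => if i ∈ s then w i else 0), hu1, hv1,
        ← Finset.sum_filter, Finset.filter_mem_eq_inter, Finset.inter_eq_right.2 hst', hw1]
      linarith) (by
      simp only [sub_smul, add_smul, mul_smul]
      rw [Finset.sum_sub_distrib, Finset.sum_add_distrib, ← Finset.smul_sum, ← Finset.smul_sum,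
        sum_coe t (fun i => u i • i), sum_coe t (fun i => v i • i),
        sum_coe t (fun i => (if i ∈ s then w i else 0) • i)]
      simp only [ite_smul, zero_smul]
      rw [← Finset.sum_filter, Finset.filter_mem_eq_inter, Finset.inter_eq_right.2 hst', hwz,
        sub_self])
  have hus : ∀ i ∈ t, i ∉ s → u i = 0 := fun i hit his => by
    have h := h0 ⟨i, hit⟩ (Finset.mem_univ _)
    simp only [his, if_false, sub_zero] at h
    have h1 := mul_nonneg ha.le (hu i hit)
    have h2 := mul_nonneg hb.le (hv i hit)
    have : a * u i = 0 := by linarith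
    exact (mul_eq_zero.1 this).resolve_left ha.ne'
  refine Finset.mem_convexHull'.2 ⟨u, fun i his => hu i (hst' his), ?_, ?_⟩
  · rw [Finset.sum_subset hst' hus, hu1]
  · exact Finset.sum_subset hst' fun i hit his => by rw [hus i hit his, zero_smul]

/-- Convex joins distribute over unions, so it suffices to split the segment from `x` to `y`. -/
theorem convexHull_bisect (x y : E) {R : Set E} (hR : R.Nonempty) :
    convexHull ℝ ({x, y} ∪ R) = convexHull ℝ ({x, midpoint ℝ x y} ∪ R) ∪
      convexHull ℝ ({y, midpoint ℝ x y} ∪ R) := by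
  have hm : midpoint ℝ x y ∈ segment ℝ x y := midpoint_mem_segment x y
  have hxy : convexHull ℝ {x, y} = convexHull ℝ {x, midpoint ℝ x y} ∪
      convexHull ℝ {y, midpoint ℝ x y} := by
    simp only [convexHull_pair]
    refine Subset.antisymm ?_ (union_subset ?_ ?_)
    · rintro z ⟨a, b, ha, hb, hab, rfl⟩
      rcases le_total b a with h | h
      · refine Or.inl ⟨a - b, 2 * b, by linarith, by linarith, by linarith, ?_⟩
        rw [midpoint_eq_smul_add, smul_smul, invOf_eq_inv]
        norm_num
        rw [sub_smul, mul_right_comm]; norm_num; abel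
      · refine Or.inr ⟨b - a, 2 * a, by linarith, by linarith, by linarith, ?_⟩
        rw [midpoint_eq_smul_add, smul_smul, invOf_eq_inv]
        norm_num
        rw [sub_smul, mul_right_comm]; norm_num; abel
    · exact (convex_segment x y).segment_subset (left_mem_segment ℝ x y) hm
    · exact (convex_segment x y).segment_subset (right_mem_segment ℝ x y) hm
  rw [convexHull_union (by simp) hR, convexHull_union (by simp) hR, convexHull_union (by simp) hR,
    hxy, convexJoin_union_left]

end ConvexGeometry

/-! ### Points in general position on a face -/

section Generic

variable {E : Type*} [NormedAddCommGroup E] [NormedSpace ℝ E]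

/-- Near a point of `convexHull ℝ s ∩ Ω` there is one that lies on a face only if the whole of `s`
does. -/
theorem exists_generic_point {Ω : Set E} (hΩ : IsOpen Ω) (s : Finset E) {z : E}
    (hz : z ∈ convexHull ℝ (s : Set E)) (hzΩ : z ∈ Ω) :
    ∃ y ∈ convexHull ℝ (s : Set E), y ∈ Ω ∧ ∀ A F : Set E, Convex ℝ A → IsExtreme ℝ A F →
      convexHull ℝ (s : Set E) ⊆ A → y ∈ F → (s : Set E) ⊆ F := by
  have hs : s.Nonempty := by
    rw [Finset.nonempty_iff_ne_empty]; rintro rfl; simp at hz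
  set n : ℝ := (s.card : ℝ) with hn
  have hn0 : 0 < n := by rw [hn]; exact_mod_cast hs.card_pos
  set c : E := ∑ i ∈ s, n⁻¹ • i with hc
  have hn1 : ∑ _i ∈ s, n⁻¹ = 1 := by
    rw [Finset.sum_const, nsmul_eq_mul, mul_inv_cancel₀ hn0.ne']
  have hcs : c ∈ convexHull ℝ (s : Set E) :=
    (convex_convexHull ℝ _).sum_mem (fun i _ => (inv_pos.2 hn0).le) hn1
      (fun i hi => subset_convexHull ℝ _ hi)
  have hcont : Filter.Tendsto (fun e : ℝ => z + e • (c - z)) (nhdsWithin 0 (Ioi 0)) (nhds z) := by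
    have : Continuous fun e : ℝ => z + e • (c - z) := by fun_prop
    simpa using (this.tendsto 0).mono_left nhdsWithin_le_nhds
  have h1 := hcont.eventually (hΩ.mem_nhds hzΩ)
  have h2 : ∀ᶠ e : ℝ in nhdsWithin 0 (Ioi 0), e ∈ Ioo (0 : ℝ) 1 :=
    Ioo_mem_nhdsGT one_pos
  obtain ⟨e, he, he0, he1⟩ := (h1.and h2).exists
  -- Moving `z` slightly towards the barycentre `c` stays in `Ω`. A face through the new point
  -- contains `c`, hence all of `s`.
  have hseg : z + e • (c - z) ∈ openSegment ℝ c z :=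
    ⟨e, 1 - e, he0, by linarith, by ring, by rw [smul_sub, sub_smul, one_smul]; abel⟩
  refine ⟨_, (convex_convexHull ℝ _).segment_subset hcs hz (openSegment_subset_segment ℝ _ _ hseg),
    he, fun A F hA hF hsA hy i hi => ?_⟩
  have hcF := hF.left_mem_of_mem_openSegment (hsA hcs) (hsA hz) hy hseg
  exact mem_of_sum_mem_isExtreme hA hF s (fun _ => n⁻¹) id (fun i _ => (inv_pos.2 hn0).le) hn1
    (fun i hi => hsA (subset_convexHull ℝ _ hi)) hcF hi (inv_pos.2 hn0)

end Generic

/-! ### Simplices that meet in a common face -/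

namespace TaggedSimplex

variable {d : ℕ}

theorem finite_verts (T : TaggedSimplex d) : T.verts.Finite := Set.finite_range _

theorem convex_body (T : TaggedSimplex d) : Convex ℝ T.body := convex_convexHull ℝ _

theorem isCompact_body (T : TaggedSimplex d) : IsCompact T.body :=
  T.finite_verts.isCompact_convexHull (𝕜 := ℝ)

theorem verts_subset_body (T : TaggedSimplex d) : T.verts ⊆ T.body := subset_convexHull ℝ _

theorem vtx_mem_verts (T : TaggedSimplex d) (i : Fin (d + 1)) : T.vtx i ∈ T.verts :=
  mem_range_self i

/-- `T` is not degenerate. -/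
def Nondeg (T : TaggedSimplex d) : Prop := AffineIndependent ℝ T.vtx

theorem Nondeg.isExtreme {T : TaggedSimplex d} (hT : T.Nondeg)
    {s : Set (EuclideanSpace ℝ (Fin d))} (hs : s ⊆ T.verts) :
    IsExtreme ℝ T.body (convexHull ℝ s) :=
  isExtreme_convexHull_of_subset T.finite_verts hT.range hs

theorem Nondeg.verts_subset_of_mem {T : TaggedSimplex d} (hT : T.Nondeg)
    {s : Set (EuclideanSpace ℝ (Fin d))} (hs : s ⊆ T.body) {v : EuclideanSpace ℝ (Fin d)}
    (hv : v ∈ T.verts) (hvs : v ∈ convexHull ℝ s) : v ∈ s := by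
  have h := hT.isExtreme (singleton_subset_iff.2 hv)
  rw [convexHull_singleton] at h
  have h' : IsExtreme ℝ (convexHull ℝ s) {v} :=
    h.mono (convexHull_min hs T.convex_body) (singleton_subset_iff.2 hvs)
  exact extremePoints_convexHull_subset (isExtreme_singleton.1 h')

/-- The intersection is a face of both simplices. -/
def Compat (T T' : TaggedSimplex d) : Prop :=
  IsExtreme ℝ T.body (T.body ∩ T'.body) ∧ IsExtreme ℝ T'.body (T.body ∩ T'.body)

theorem Compat.symm {T T' : TaggedSimplex d} (h : T.Compat T') : T'.Compat T := by
  unfold Compat; rw [inter_comm]; exact ⟨h.2, h.1⟩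

/-- A common face is spanned by vertices of `T` and also by vertices of `T'`, and a vertex of `T` in
the hull of the latter is one of them. With `compat_of_inter_eq`, `Compat` expresses the condition
in `Conforming` for nondegenerate simplices, in a form that behaves well under restriction and
intersection. -/
theorem Compat.inter_eq {T T' : TaggedSimplex d} (h : T.Compat T') (hT : T.Nondeg) :
    T.body ∩ T'.body = convexHull ℝ (T.verts ∩ T'.verts) := by
  have hc := T.convex_body.inter T'.convex_body
  refine Subset.antisymm ?_ (subset_inter (convexHull_mono inter_subset_left)
    (convexHull_mono inter_subset_right))
  have h1 := IsExtreme.eq_convexHull_inter h.1 hc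
  have h2 := IsExtreme.eq_convexHull_inter h.2 hc
  have hsub : T.verts ∩ (T.body ∩ T'.body) ⊆ T.verts ∩ T'.verts := fun v hv => by
    have hvm := hv.2
    rw [h2] at hvm
    exact ⟨hv.1, (hT.verts_subset_of_mem
      (inter_subset_right.trans inter_subset_left) hv.1 hvm).1⟩
  exact h1.le.trans (convexHull_mono hsub)

theorem compat_of_inter_eq {T T' : TaggedSimplex d} (hT : T.Nondeg) (hT' : T'.Nondeg)
    (h : T.body ∩ T'.body = convexHull ℝ (T.verts ∩ T'.verts)) : T.Compat T' := by
  unfold Compat; rw [h]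
  exact ⟨hT.isExtreme inter_subset_left, hT'.isExtreme inter_subset_right⟩

theorem Compat.vert_mem {T T' : TaggedSimplex d} (h : T.Compat T') (hT : T.Nondeg)
    {v : EuclideanSpace ℝ (Fin d)} (hv : v ∈ T.verts) (hv' : v ∈ T'.body) :
    v ∈ T'.verts := by
  have hvm : v ∈ T.body ∩ T'.body := ⟨T.verts_subset_body hv, hv'⟩
  rw [h.inter_eq hT] at hvm
  exact (hT.verts_subset_of_mem (inter_subset_left.trans T.verts_subset_body) hv hvm).2

end TaggedSimplex
end Bisection

namespace Bisection

namespace TaggedSimplex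

/-! ### Vertex lists of children and reversals -/

section Vertices

theorem child₁_vtx_two (T : TaggedSimplex 2) :
    T.child₁.vtx = ![T.vtx 0, T.newVertex, T.vtx 1] := by
  funext i; fin_cases i <;> rfl

theorem child₂_vtx_two (T : TaggedSimplex 2) (h : T.type < 2) :
    T.child₂.vtx = ![T.vtx 2, T.newVertex, T.vtx 1] := by
  obtain ⟨x, t⟩ := T
  change t < 2 at h
  funext i; interval_cases t <;> fin_cases i <;> rfl

theorem reversed_vtx_two (T : TaggedSimplex 2) (h : T.type < 2) :
    T.reversed.vtx = ![T.vtx 2, T.vtx 1, T.vtx 0] := by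
  obtain ⟨x, t⟩ := T
  change t < 2 at h
  funext i; interval_cases t <;> fin_cases i <;> rfl

theorem child₁_vtx_three (T : TaggedSimplex 3) :
    T.child₁.vtx = ![T.vtx 0, T.newVertex, T.vtx 1, T.vtx 2] := by
  funext i; fin_cases i <;> rfl

theorem child₂_vtx_three (T : TaggedSimplex 3) (h : T.type < 3) :
    T.child₂.vtx = if T.type = 0 then ![T.vtx 3, T.newVertex, T.vtx 2, T.vtx 1]
      else ![T.vtx 3, T.newVertex, T.vtx 1, T.vtx 2] := by
  obtain ⟨x, t⟩ := T
  change t < 3 at h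
  funext i; interval_cases t <;> fin_cases i <;> rfl

theorem reversed_vtx_three (T : TaggedSimplex 3) (h : T.type < 3) :
    T.reversed.vtx = if T.type = 0 then ![T.vtx 3, T.vtx 2, T.vtx 1, T.vtx 0]
      else ![T.vtx 3, T.vtx 1, T.vtx 2, T.vtx 0] := by
  obtain ⟨x, t⟩ := T
  change t < 3 at h
  funext i; interval_cases t <;> fin_cases i <;> rfl

end Vertices

variable {d : ℕ}

/-- The vertices off the refinement edge. -/
def innerVerts (T : TaggedSimplex d) : Set (EuclideanSpace ℝ (Fin d)) :=
  T.vtx '' {i | i ≠ 0 ∧ i ≠ Fin.last d}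

theorem verts_eq (T : TaggedSimplex d) :
    T.verts = {T.vtx 0, T.vtx (Fin.last d)} ∪ T.innerVerts := by
  ext v
  constructor
  · rintro ⟨i, rfl⟩
    by_cases h0 : i = 0
    · subst h0; simp
    by_cases h1 : i = Fin.last d
    · subst h1; simp
    exact Or.inr ⟨i, ⟨h0, h1⟩, rfl⟩
  · rintro ((rfl | rfl) | ⟨i, -, rfl⟩) <;> exact T.vtx_mem_verts _

theorem innerVerts_two (T : TaggedSimplex 2) : T.innerVerts = {T.vtx 1} := by
  have : {i : Fin 3 | i ≠ 0 ∧ i ≠ Fin.last 2} = {1} := by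
    ext i
    simp only [mem_ofPred_eq, mem_singleton_iff]
    revert i; decide
  unfold innerVerts
  rw [this, image_singleton]

theorem innerVerts_three (T : TaggedSimplex 3) : T.innerVerts = {T.vtx 1, T.vtx 2} := by
  have : {i : Fin 4 | i ≠ 0 ∧ i ≠ Fin.last 3} = {1, 2} := by
    ext i
    simp only [mem_ofPred_eq, mem_insert_iff, mem_singleton_iff]
    revert i; decide
  unfold innerVerts
  rw [this, image_pair]

theorem innerVerts_nonempty (hd : d = 2 ∨ d = 3) (T : TaggedSimplex d) : T.innerVerts.Nonempty := by
  rcases hd with rfl | rfl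
  · rw [innerVerts_two]; simp
  · rw [innerVerts_three]; simp

theorem verts_child₁ (hd : d = 2 ∨ d = 3) (T : TaggedSimplex d) :
    T.child₁.verts = {T.vtx 0, T.newVertex} ∪ T.innerVerts := by
  rcases hd with rfl | rfl
  · rw [innerVerts_two, verts, child₁_vtx_two]
    simp only [Matrix.range_cons, Matrix.range_empty, union_empty]
    ext v; simp; tauto
  · rw [innerVerts_three, verts, child₁_vtx_three]
    simp only [Matrix.range_cons, Matrix.range_empty, union_empty]
    ext v; simp; tauto

theorem verts_child₂ (hd : d = 2 ∨ d = 3) (T : TaggedSimplex d) (ht : T.type < d) :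
    T.child₂.verts = {T.vtx (Fin.last d), T.newVertex} ∪ T.innerVerts := by
  rcases hd with rfl | rfl
  · rw [innerVerts_two, verts, child₂_vtx_two T ht]
    simp only [Matrix.range_cons, Matrix.range_empty, union_empty]
    ext v; simp; tauto
  · rw [innerVerts_three, verts, child₂_vtx_three T ht]
    split_ifs
    all_goals
      simp only [Matrix.range_cons, Matrix.range_empty, union_empty]
      ext v; simp; tauto

theorem body_eq_union (hd : d = 2 ∨ d = 3) (T : TaggedSimplex d) (ht : T.type < d) :
    T.body = T.child₁.body ∪ T.child₂.body := by
  unfold body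
  rw [verts_child₁ hd, verts_child₂ hd T ht, verts_eq]
  exact convexHull_bisect _ _ (T.innerVerts_nonempty hd)

theorem mem_children {T S : TaggedSimplex d} : S ∈ T.children ↔ S = T.child₁ ∨ S = T.child₂ := by
  simp [children]

theorem body_subset_of_mem_children (hd : d = 2 ∨ d = 3) {T S : TaggedSimplex d} (ht : T.type < d)
    (hS : S ∈ T.children) : S.body ⊆ T.body := by
  rw [body_eq_union hd T ht]
  rcases mem_children.1 hS with rfl | rfl
  exacts [subset_union_left, subset_union_right]

theorem type_of_mem_children {T S : TaggedSimplex d} (hS : S ∈ T.children) :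
    S.type = (T.type + 1) % d := by
  rcases mem_children.1 hS with rfl | rfl <;> rfl

/-! ### Bisection halves the volume -/

section Volume

/-- The matrix of edge vectors from the first vertex. -/
def edgeMatrix (T : TaggedSimplex d) : Matrix (Fin d) (Fin d) ℝ :=
  Matrix.of fun i j => T.vtx j.succ i - T.vtx 0 i

/-- The standard simplex. -/
noncomputable def standardBody (d : ℕ) : Set (EuclideanSpace ℝ (Fin d)) :=
  convexHull ℝ (insert 0 (Set.range (EuclideanSpace.basisFun (Fin d) ℝ)))

/-- The body is an affine image of the standard simplex; halving of volume thereby becomes a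
determinant identity. -/
theorem volume_body (T : TaggedSimplex d) :
    volume T.body = ENNReal.ofReal |T.edgeMatrix.det| * volume (standardBody d) := by
  set b := (EuclideanSpace.basisFun (Fin d) ℝ).toBasis
  set f := Matrix.toLin b b T.edgeMatrix with hf
  have hb : ∀ j, f (EuclideanSpace.basisFun (Fin d) ℝ j) = T.vtx j.succ - T.vtx 0 := fun j => by
    have := Matrix.toLin_self b b T.edgeMatrix j
    rw [OrthonormalBasis.coe_toBasis] at this
    rw [hf, this]
    ext i
    simp [edgeMatrix, Pi.single_apply]
  have hbody : T.body = (fun y => T.vtx 0 + y) '' (f '' standardBody d) := by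
    have h1 : T.verts = (fun y => T.vtx 0 + y) ''
        (f '' (insert 0 (Set.range (EuclideanSpace.basisFun (Fin d) ℝ)))) := by
      rw [image_insert_eq, image_insert_eq, map_zero, add_zero, ← range_comp, ← range_comp]
      ext v
      constructor
      · rintro ⟨i, rfl⟩
        refine Fin.cases (Or.inl rfl) (fun j => Or.inr ⟨j, ?_⟩) i
        simp only [Function.comp_apply, hb, add_sub_cancel]
      · rintro (rfl | ⟨j, rfl⟩)
        · exact T.vtx_mem_verts 0
        · refine ⟨j.succ, ?_⟩
          simp only [Function.comp_apply, hb, add_sub_cancel]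
    unfold body standardBody
    rw [h1, LinearMap.image_convexHull]
    exact ((AffineEquiv.constVAdd ℝ _ (T.vtx 0)).toAffineMap.image_convexHull _).symm
  rw [hbody, image_add_left, measure_preimage_add, Measure.addHaar_image_linearMap, hf,
    LinearMap.det_toLin]

theorem abs_det_child₁ (hd : d = 2 ∨ d = 3) (T : TaggedSimplex d) :
    |T.child₁.edgeMatrix.det| = |T.edgeMatrix.det| / 2 := by
  rcases hd with rfl | rfl
  · have : T.child₁.edgeMatrix.det = - (T.edgeMatrix.det / 2) := by
      simp only [edgeMatrix, child₁_vtx_two, Matrix.det_fin_two, Matrix.of_apply, newVertex,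
        midpoint_eq_smul_add]
      simp [Fin.last]
      ring
    rw [this, abs_neg, abs_div, abs_two]
  · have : T.child₁.edgeMatrix.det = T.edgeMatrix.det / 2 := by
      simp only [edgeMatrix, child₁_vtx_three, Matrix.det_fin_three, Matrix.of_apply, newVertex,
        midpoint_eq_smul_add]
      simp [Fin.last]
      ring
    rw [this, abs_div, abs_two]

theorem abs_det_child₂ (hd : d = 2 ∨ d = 3) (T : TaggedSimplex d) (ht : T.type < d) :
    |T.child₂.edgeMatrix.det| = |T.edgeMatrix.det| / 2 := by
  rcases hd with rfl | rfl
  · have : T.child₂.edgeMatrix.det = T.edgeMatrix.det / 2 := by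
      simp only [edgeMatrix, child₂_vtx_two T ht, Matrix.det_fin_two, Matrix.of_apply, newVertex,
        midpoint_eq_smul_add]
      simp [Fin.last]
      ring
    rw [this, abs_div, abs_two]
  · by_cases h : T.type = 0
    · have : T.child₂.edgeMatrix.det = T.edgeMatrix.det / 2 := by
        simp only [edgeMatrix, child₂_vtx_three T ht, Matrix.det_fin_three, Matrix.of_apply,
          newVertex, midpoint_eq_smul_add, h, if_true]
        simp [Fin.last]
        ring
      rw [this, abs_div, abs_two]
    · have : T.child₂.edgeMatrix.det = - (T.edgeMatrix.det / 2) := by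
        simp only [edgeMatrix, child₂_vtx_three T ht, Matrix.det_fin_three, Matrix.of_apply,
          newVertex, midpoint_eq_smul_add, h, if_false]
        simp [Fin.last]
        ring
      rw [this, abs_neg, abs_div, abs_two]

theorem volume_body_ne_top (T : TaggedSimplex d) : volume T.body ≠ ⊤ :=
  T.isCompact_body.measure_lt_top.ne

theorem volume_of_mem_children (hd : d = 2 ∨ d = 3) {T S : TaggedSimplex d} (ht : T.type < d)
    (hS : S ∈ T.children) : volume S.body = volume T.body / 2 := by
  have h : |S.edgeMatrix.det| = |T.edgeMatrix.det| / 2 := by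
    rcases mem_children.1 hS with rfl | rfl
    · exact abs_det_child₁ hd T
    · exact abs_det_child₂ hd T ht
  rw [volume_body, volume_body T, h, ENNReal.ofReal_div_of_pos two_pos, ENNReal.ofReal_ofNat,
    ENNReal.div_eq_inv_mul, ENNReal.div_eq_inv_mul, mul_assoc]

/-- Through this equivalence nondegeneracy passes to children, since their volume is half that of
the parent. -/
theorem nondeg_iff_volume_pos (T : TaggedSimplex d) : T.Nondeg ↔ 0 < volume T.body := by
  have hn : Module.finrank ℝ (EuclideanSpace ℝ (Fin d)) = d := by simp
  constructor
  · intro h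
    have hs : affineSpan ℝ T.verts = ⊤ :=
      (AffineIndependent.affineSpan_eq_top_iff_card_eq_finrank_add_one h).2 (by simp)
    exact (isOpen_interior.measure_pos volume
      (interior_convexHull_nonempty_iff_affineSpan_eq_top.2 hs)).trans_le
      (measure_mono interior_subset)
  · intro h
    by_contra hi
    have hne : affineSpan ℝ T.verts ≠ ⊤ := fun h => hi <| by
      unfold Nondeg
      rw [affineIndependent_iff_finrank_vectorSpan_eq ℝ T.vtx (Fintype.card_fin _),
        ← direction_affineSpan]
      change Module.finrank ℝ (affineSpan ℝ T.verts).direction = d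
      rw [h, AffineSubspace.direction_top, finrank_top, hn]
    exact h.ne' (measure_mono_null (convexHull_subset_affineSpan _)
      (Measure.addHaar_affineSubspace volume _ hne))

/-- The two halves already account for the full volume of their union, so nothing is left for the
overlap. -/
theorem measure_child_inter (hd : d = 2 ∨ d = 3) {T : TaggedSimplex d} (ht : T.type < d) :
    volume (T.child₁.body ∩ T.child₂.body) = 0 := by
  have h1 := volume_of_mem_children hd ht (mem_children.2 (Or.inl rfl))
  have h2 := volume_of_mem_children hd ht (mem_children.2 (Or.inr rfl))
  have h := measure_union_add_inter (μ := volume) T.child₁.body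
    T.child₂.isCompact_body.measurableSet
  rw [← body_eq_union hd T ht, h1, h2, ENNReal.add_halves] at h
  have h3 : volume T.body + volume (T.child₁.body ∩ T.child₂.body) = volume T.body + 0 := by
    rw [h, add_zero]
  exact (ENNReal.add_right_inj T.volume_body_ne_top).1 h3

end Volume

/-! ### Shape regularity -/

section Frame

/-- Vectors that bisection permutes up to sign, and halves when the type returns to `0`. -/
noncomputable def frameTwo (T : TaggedSimplex 2) : Fin 2 → EuclideanSpace ℝ (Fin 2) :=
  if T.type = 0 then ![T.vtx 1 - T.vtx 0, T.vtx 2 - T.vtx 1]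
  else ![T.vtx 2 - T.vtx 0, (2 : ℝ) • (T.vtx 1 - T.vtx 0) - (T.vtx 2 - T.vtx 0)]

/-- Vectors that bisection permutes up to sign, and halves when the type returns to `0`. -/
noncomputable def frameThree (T : TaggedSimplex 3) : Fin 3 → EuclideanSpace ℝ (Fin 3) :=
  -- For type `0` these are the steps of the path through the vertices, as in a Kuhn simplex; the
  -- other cases follow these vectors through the bisections.
  if T.type = 0 then ![T.vtx 1 - T.vtx 0, T.vtx 2 - T.vtx 1, T.vtx 3 - T.vtx 2]
  else if T.type = 1 then ![T.vtx 2 - T.vtx 0, T.vtx 3 - T.vtx 2,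
    (2 : ℝ) • (T.vtx 1 - T.vtx 0) - (T.vtx 3 - T.vtx 0)]
  else ![T.vtx 3 - T.vtx 0, (2 : ℝ) • (T.vtx 1 - T.vtx 0) - (T.vtx 3 - T.vtx 0),
    (2 : ℝ) • (T.vtx 2 - T.vtx 1)]

theorem newVertex_eq (T : TaggedSimplex d) :
    T.newVertex = (1 / 2 : ℝ) • (T.vtx 0 + T.vtx (Fin.last d)) := by
  rw [newVertex, midpoint_eq_smul_add, invOf_eq_inv, one_div]

theorem norm_le_of_eq_or_eq_neg {ι F : Type*} [Fintype ι] [NormedAddCommGroup F] [NormedSpace ℝ F]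
    {f : ι → F} {c : ℝ} (hc : 0 ≤ c) {v : F} (j : ι) (h : v = c • f j ∨ v = (-c) • f j) :
    ‖v‖ ≤ c * ‖f‖ := by
  rcases h with rfl | rfl
  · rw [norm_smul, Real.norm_of_nonneg hc]
    exact mul_le_mul_of_nonneg_left (norm_le_pi_norm f j) hc
  · rw [norm_smul, norm_neg, Real.norm_of_nonneg hc]
    exact mul_le_mul_of_nonneg_left (norm_le_pi_norm f j) hc

/-- The factor by which the frame is scaled in a bisection of a simplex of type `t`. -/
noncomputable def frameFactor (d t : ℕ) : ℝ := if t + 1 = d then 1 / 2 else 1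

theorem frameFactor_nonneg (d t : ℕ) : 0 ≤ frameFactor d t := by
  unfold frameFactor; split_ifs <;> norm_num

theorem norm_frameTwo_child {T S : TaggedSimplex 2} (ht : T.type < 2) (hS : S ∈ T.children) :
    ‖S.frameTwo‖ ≤ frameFactor 2 T.type * ‖T.frameTwo‖ := by
  have hty := type_of_mem_children hS
  have hc := frameFactor_nonneg 2 T.type
  have hl : Fin.last 2 = 2 := rfl
  rw [pi_norm_le_iff_of_nonneg (mul_nonneg hc (norm_nonneg _))]
  have hc1 := child₁_vtx_two T
  have hc2 := child₂_vtx_two T ht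
  obtain ht | ht : T.type = 0 ∨ T.type = 1 := by omega
  · have hty' : S.type = 1 := by rw [hty, ht]
    have hf : frameFactor 2 T.type = 1 := by simp [frameFactor, ht]
    rw [hf]
    rcases mem_children.1 hS with rfl | rfl
    · intro i; fin_cases i
      · refine norm_le_of_eq_or_eq_neg zero_le_one 0 (Or.inl ?_)
        simp [frameTwo, hty', ht, hc1]
      · refine norm_le_of_eq_or_eq_neg zero_le_one 1 (Or.inl ?_)
        simp [frameTwo, hty', ht, hc1, hl, newVertex_eq]; module
    · intro i; fin_cases i
      · refine norm_le_of_eq_or_eq_neg zero_le_one 1 (Or.inr ?_)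
        simp [frameTwo, hty', ht, hc2]
      · refine norm_le_of_eq_or_eq_neg zero_le_one 0 (Or.inr ?_)
        simp [frameTwo, hty', ht, hc2, hl, newVertex_eq]; module
  · have hty' : S.type = 0 := by rw [hty, ht]
    have hf : frameFactor 2 T.type = 1 / 2 := by simp [frameFactor, ht]
    rw [hf]
    rcases mem_children.1 hS with rfl | rfl
    · intro i; fin_cases i
      · refine norm_le_of_eq_or_eq_neg (by norm_num) 0 (Or.inl ?_)
        simp [frameTwo, hty', ht, hc1, hl, newVertex_eq]; module
      · refine norm_le_of_eq_or_eq_neg (by norm_num) 1 (Or.inl ?_)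
        simp [frameTwo, hty', ht, hc1, hl, newVertex_eq]; module
    · intro i; fin_cases i
      · refine norm_le_of_eq_or_eq_neg (by norm_num) 0 (Or.inr ?_)
        simp [frameTwo, hty', ht, hc2, hl, newVertex_eq]; module
      · refine norm_le_of_eq_or_eq_neg (by norm_num) 1 (Or.inl ?_)
        simp [frameTwo, hty', ht, hc2, hl, newVertex_eq]; module

theorem norm_frameThree_child {T S : TaggedSimplex 3} (ht : T.type < 3) (hS : S ∈ T.children) :
    ‖S.frameThree‖ ≤ frameFactor 3 T.type * ‖T.frameThree‖ := by
  have hty := type_of_mem_children hS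
  have hc := frameFactor_nonneg 3 T.type
  have hl : Fin.last 3 = 3 := rfl
  rw [pi_norm_le_iff_of_nonneg (mul_nonneg hc (norm_nonneg _))]
  have hc1 := child₁_vtx_three T
  have hc2 := child₂_vtx_three T ht
  obtain ht | ht | ht : T.type = 0 ∨ T.type = 1 ∨ T.type = 2 := by omega
  · have hty' : S.type = 1 := by rw [hty, ht]
    have hf : frameFactor 3 T.type = 1 := by simp [frameFactor, ht]
    rw [hf]
    rcases mem_children.1 hS with rfl | rfl
    · intro i
      refine norm_le_of_eq_or_eq_neg zero_le_one i (Or.inl ?_)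
      fin_cases i <;> simp [frameThree, hty', ht, hc1, hl, newVertex_eq] <;> module
    · intro i
      refine norm_le_of_eq_or_eq_neg zero_le_one (Fin.rev i) (Or.inr ?_)
      fin_cases i <;> simp [frameThree, hty', ht, hc2, hl, newVertex_eq, Fin.rev] <;> module
  · have hty' : S.type = 2 := by rw [hty, ht]
    have hf : frameFactor 3 T.type = 1 := by simp [frameFactor, ht]
    rw [hf]
    rcases mem_children.1 hS with rfl | rfl
    · intro i
      refine norm_le_of_eq_or_eq_neg zero_le_one i (Or.inl ?_)
      fin_cases i <;> simp [frameThree, hty', ht, hc1, hl, newVertex_eq] <;> module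
    · intro i; fin_cases i
      · refine norm_le_of_eq_or_eq_neg zero_le_one 1 (Or.inr ?_)
        simp [frameThree, hty', ht, hc2]
      · refine norm_le_of_eq_or_eq_neg zero_le_one 0 (Or.inr ?_)
        simp [frameThree, hty', ht, hc2, hl, newVertex_eq]; module
      · refine norm_le_of_eq_or_eq_neg zero_le_one 2 (Or.inl ?_)
        simp [frameThree, hty', ht, hc2, hl, newVertex_eq]; module
  · have hty' : S.type = 0 := by rw [hty, ht]
    have hf : frameFactor 3 T.type = 1 / 2 := by simp [frameFactor, ht]
    rw [hf]
    rcases mem_children.1 hS with rfl | rfl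
    · intro i
      refine norm_le_of_eq_or_eq_neg (by norm_num) i (Or.inl ?_)
      fin_cases i <;> simp [frameThree, hty', ht, hc1, hl, newVertex_eq] <;> module
    · intro i; fin_cases i
      · refine norm_le_of_eq_or_eq_neg (by norm_num) 0 (Or.inr ?_)
        simp [frameThree, hty', ht, hc2, hl, newVertex_eq]; module
      · refine norm_le_of_eq_or_eq_neg (by norm_num) 1 (Or.inl ?_)
        simp [frameThree, hty', ht, hc2, hl, newVertex_eq]; module
      · refine norm_le_of_eq_or_eq_neg (by norm_num) 2 (Or.inl ?_)
        simp [frameThree, hty', ht, hc2]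

/-- Every vertex is reached from `x₀` by a combination of the frame with coefficients in `[0, 1]`.
The constant `3` is the one needed in dimension three. -/
theorem dist_vtx_le_frameTwo {T : TaggedSimplex 2} (i : Fin 3) :
    dist (T.vtx i) (T.vtx 0) ≤ 3 * ‖T.frameTwo‖ := by
  have h0 := norm_le_pi_norm T.frameTwo 0
  have h1 := norm_le_pi_norm T.frameTwo 1
  have hp := norm_nonneg T.frameTwo
  have key : ∀ a b : ℝ, |a| ≤ 1 → |b| ≤ 1 →
      ‖a • T.frameTwo 0 + b • T.frameTwo 1‖ ≤ 3 * ‖T.frameTwo‖ := fun a b ha hb => by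
    refine (norm_add_le _ _).trans ?_
    rw [norm_smul, norm_smul, Real.norm_eq_abs, Real.norm_eq_abs]
    have := mul_le_mul ha h0 (norm_nonneg _) zero_le_one
    have := mul_le_mul hb h1 (norm_nonneg _) zero_le_one
    linarith
  rw [dist_eq_norm]
  by_cases ht : T.type = 0
  · fin_cases i
    · refine le_of_eq_of_le (congrArg norm ?_) (key 0 0 (by norm_num) (by norm_num)); simp
    · refine le_of_eq_of_le (congrArg norm ?_) (key 1 0 (by norm_num) (by norm_num)); simp [frameTwo, ht]
    · refine le_of_eq_of_le (congrArg norm ?_) (key 1 1 (by norm_num) (by norm_num)); simp [frameTwo, ht]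
  · fin_cases i
    · refine le_of_eq_of_le (congrArg norm ?_) (key 0 0 (by norm_num) (by norm_num)); simp
    · refine le_of_eq_of_le (congrArg norm ?_) (key (1/2) (1/2) (by norm_num [abs_le]) (by norm_num [abs_le]))
      simp [frameTwo, ht]; module
    · refine le_of_eq_of_le (congrArg norm ?_) (key 1 0 (by norm_num) (by norm_num)); simp [frameTwo, ht]

theorem dist_vtx_le_frameThree {T : TaggedSimplex 3} (i : Fin 4) :
    dist (T.vtx i) (T.vtx 0) ≤ 3 * ‖T.frameThree‖ := by
  have h0 := norm_le_pi_norm T.frameThree 0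
  have h1 := norm_le_pi_norm T.frameThree 1
  have h2 := norm_le_pi_norm T.frameThree 2
  have key : ∀ a b c : ℝ, |a| ≤ 1 → |b| ≤ 1 → |c| ≤ 1 →
      ‖a • T.frameThree 0 + b • T.frameThree 1 + c • T.frameThree 2‖ ≤ 3 * ‖T.frameThree‖ := by
    intro a b c ha hb hc
    refine (norm_add₃_le).trans ?_
    rw [norm_smul, norm_smul, norm_smul, Real.norm_eq_abs, Real.norm_eq_abs, Real.norm_eq_abs]
    have := mul_le_mul ha h0 (norm_nonneg _) zero_le_one
    have := mul_le_mul hb h1 (norm_nonneg _) zero_le_one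
    have := mul_le_mul hc h2 (norm_nonneg _) zero_le_one
    linarith
  rw [dist_eq_norm]
  by_cases ht : T.type = 0
  · fin_cases i
    · refine le_of_eq_of_le (congrArg norm ?_) (key 0 0 0 (by norm_num) (by norm_num) (by norm_num)); simp
    · refine le_of_eq_of_le (congrArg norm ?_) (key 1 0 0 (by norm_num) (by norm_num) (by norm_num)); simp [frameThree, ht]
    · refine le_of_eq_of_le (congrArg norm ?_) (key 1 1 0 (by norm_num) (by norm_num) (by norm_num)); simp [frameThree, ht]
    · refine le_of_eq_of_le (congrArg norm ?_) (key 1 1 1 (by norm_num) (by norm_num) (by norm_num)); simp [frameThree, ht]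
  by_cases ht1 : T.type = 1
  · fin_cases i
    · refine le_of_eq_of_le (congrArg norm ?_) (key 0 0 0 (by norm_num) (by norm_num) (by norm_num)); simp
    · refine le_of_eq_of_le (congrArg norm ?_) (key (1/2) (1/2) (1/2) (by norm_num [abs_le]) (by norm_num [abs_le])
        (by norm_num [abs_le]))
      simp [frameThree, ht1]; module
    · refine le_of_eq_of_le (congrArg norm ?_) (key 1 0 0 (by norm_num) (by norm_num) (by norm_num))
      simp [frameThree, ht1]
    · refine le_of_eq_of_le (congrArg norm ?_) (key 1 1 0 (by norm_num) (by norm_num) (by norm_num))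
      simp [frameThree, ht1]
  · fin_cases i
    · refine le_of_eq_of_le (congrArg norm ?_) (key 0 0 0 (by norm_num) (by norm_num) (by norm_num)); simp
    · refine le_of_eq_of_le (congrArg norm ?_) (key (1/2) (1/2) 0 (by norm_num [abs_le]) (by norm_num [abs_le])
        (by norm_num [abs_le]))
      simp [frameThree, ht, ht1]; module
    · refine le_of_eq_of_le (congrArg norm ?_) (key (1/2) (1/2) (1/2) (by norm_num [abs_le]) (by norm_num [abs_le])
        (by norm_num [abs_le]))
      simp [frameThree, ht, ht1]; module
    · refine le_of_eq_of_le (congrArg norm ?_) (key 1 0 0 (by norm_num) (by norm_num) (by norm_num))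
      simp [frameThree, ht, ht1]

/-- A quantity that controls the diameter and is scaled down by `2^{-1/d}` in each bisection. -/
theorem exists_diam_control (hd : d = 2 ∨ d = 3) : ∃ ρ : TaggedSimplex d → ℝ,
    (∀ T, 0 ≤ ρ T) ∧ (∀ T : TaggedSimplex d, T.type < d → Metric.diam T.body ≤ ρ T) ∧
    ∀ T S : TaggedSimplex d, T.type < d → S ∈ T.children →
      ρ S ≤ (2 : ℝ) ^ (-(1 / (d : ℝ))) * ρ T := by
  obtain ⟨M, hM0, hM, hMc⟩ : ∃ M : TaggedSimplex d → ℝ, (∀ T, 0 ≤ M T) ∧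
      (∀ T : TaggedSimplex d, ∀ i, dist (T.vtx i) (T.vtx 0) ≤ 3 * M T) ∧
      ∀ T S : TaggedSimplex d, T.type < d → S ∈ T.children →
        M S ≤ frameFactor d T.type * M T := by
    rcases hd with rfl | rfl
    · exact ⟨fun T => ‖T.frameTwo‖, fun T => norm_nonneg _, fun T => dist_vtx_le_frameTwo,
        fun T S => norm_frameTwo_child⟩
    · exact ⟨fun T => ‖T.frameThree‖, fun T => norm_nonneg _, fun T => dist_vtx_le_frameThree,
        fun T S => norm_frameThree_child⟩
  have hd0 : (0 : ℝ) < d := by rcases hd with rfl | rfl <;> norm_num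
  -- A full cycle of `d` bisections halves the frame bound `M`; the weight `2^{-t/d}` spreads this
  -- evenly over the cycle. The weight is at least `1/2` and the diameter at most `6 M`, whence
  -- `12`.
  refine ⟨fun T => 12 * ((2 : ℝ) ^ (-((T.type : ℝ) / d)) * M T),
    fun T => mul_nonneg (by norm_num) (mul_nonneg (by positivity) (hM0 T)), fun T ht => ?_,
    fun T S ht hS => ?_⟩
  · have h1 : (2 : ℝ)⁻¹ ≤ (2 : ℝ) ^ (-((T.type : ℝ) / d)) := by
      rw [← Real.rpow_neg_one]
      refine Real.rpow_le_rpow_of_exponent_le one_le_two (neg_le_neg ?_)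
      rw [div_le_one hd0]; exact_mod_cast ht.le
    have h2 := mul_le_mul_of_nonneg_right h1 (hM0 T)
    refine le_trans ?_ (by linarith : 6 * M T ≤ _)
    rw [body, convexHull_diam]
    refine Metric.diam_le_of_forall_dist_le (mul_nonneg (by norm_num) (hM0 T)) ?_
    rintro _ ⟨i, rfl⟩ _ ⟨j, rfl⟩
    have := dist_triangle_right (T.vtx i) (T.vtx j) (T.vtx 0)
    have := hM T i
    have := hM T j
    linarith
  · have h1 := hMc T S ht hS
    have hty := type_of_mem_children hS
    rw [mul_left_comm]
    refine mul_le_mul_of_nonneg_left ?_ (by norm_num)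
    refine (mul_le_mul_of_nonneg_left h1 (by positivity)).trans ?_
    rw [← mul_assoc, ← mul_assoc]
    refine mul_le_mul_of_nonneg_right (le_of_eq ?_) (hM0 T)
    rw [← Real.rpow_add two_pos]
    by_cases h : T.type + 1 = d
    · rw [hty, h, Nat.mod_self, frameFactor, if_pos h]
      simp only [Nat.cast_zero, zero_div, neg_zero, Real.rpow_zero, one_mul]
      rw [one_div, ← Real.rpow_neg_one]
      congr 1
      have h' : (T.type : ℝ) + 1 = d := by exact_mod_cast h
      field_simp
      linarith
    · rw [hty, Nat.mod_eq_of_lt (by omega), frameFactor, if_neg h, mul_one]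
      congr 1
      push_cast
      ring

end Frame

end TaggedSimplex
end Bisection

/-! ### The new vertex and compatibility of children -/

namespace Bisection

namespace TaggedSimplex

variable {d : ℕ}

theorem Nondeg.injective {T : TaggedSimplex d} (hT : T.Nondeg) : Function.Injective T.vtx :=
  AffineIndependent.injective hT

theorem Nondeg.child (hd : d = 2 ∨ d = 3) {T S : TaggedSimplex d} (hT : T.Nondeg)
    (ht : T.type < d) (hS : S ∈ T.children) : S.Nondeg := by
  rw [nondeg_iff_volume_pos] at hT ⊢
  rw [volume_of_mem_children hd ht hS]
  exact ENNReal.half_pos hT.ne'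

theorem type_lt_of_mem_children (hd : d = 2 ∨ d = 3) {T S : TaggedSimplex d}
    (hS : S ∈ T.children) : S.type < d := by
  rw [type_of_mem_children hS]; exact Nat.mod_lt _ (by omega)

theorem zero_ne_last (hd : d = 2 ∨ d = 3) : (0 : Fin (d + 1)) ≠ Fin.last d := by
  intro h; have := congrArg Fin.val h; simp at this; omega

theorem newVertex_notMem_verts (hd : d = 2 ∨ d = 3) {T : TaggedSimplex d} (hT : T.Nondeg) :
    T.newVertex ∉ T.verts := by
  intro h
  have hne := zero_ne_last hd
  have hmem : T.newVertex ∈ openSegment ℝ (T.vtx 0) (T.vtx (Fin.last d)) :=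
    ⟨1 / 2, 1 / 2, by norm_num, by norm_num, by norm_num, by rw [newVertex_eq, smul_add]⟩
  have hex := hT.isExtreme (singleton_subset_iff.2 h)
  rw [convexHull_singleton] at hex
  have h0 := hex.left_mem_of_mem_openSegment (T.verts_subset_body (T.vtx_mem_verts 0))
    (T.verts_subset_body (T.vtx_mem_verts _)) (mem_singleton _) hmem
  have h1 := hex.right_mem_of_mem_openSegment (T.verts_subset_body (T.vtx_mem_verts 0))
    (T.verts_subset_body (T.vtx_mem_verts _)) (mem_singleton _) hmem
  exact hne (hT.injective ((mem_singleton_iff.1 h0).trans (mem_singleton_iff.1 h1).symm))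

theorem newVertex_mem_body (T : TaggedSimplex d) : T.newVertex ∈ T.body :=
  T.convex_body.segment_subset (T.verts_subset_body (T.vtx_mem_verts 0))
    (T.verts_subset_body (T.vtx_mem_verts _)) (midpoint_mem_segment _ _)

theorem newVertex_eq_of_refEdge_eq {T T' : TaggedSimplex d} (h : T.refEdge = T'.refEdge) :
    T.newVertex = T'.newVertex := by
  unfold refEdge at h
  unfold newVertex
  rcases pair_eq_pair_iff.1 h with ⟨h1, h2⟩ | ⟨h1, h2⟩
  · rw [h1, h2]
  · rw [h1, h2, midpoint_comm]

theorem exists_verts_of_mem_children (hd : d = 2 ∨ d = 3) {T S : TaggedSimplex d}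
    (ht : T.type < d) (hS : S ∈ T.children) :
    ∃ e ∈ T.refEdge, S.verts = {e, T.newVertex} ∪ T.innerVerts := by
  rcases mem_children.1 hS with rfl | rfl
  · exact ⟨_, Or.inl rfl, verts_child₁ hd T⟩
  · exact ⟨_, Or.inr rfl, verts_child₂ hd T ht⟩

theorem exists_child_of_mem_refEdge (hd : d = 2 ∨ d = 3) {T : TaggedSimplex d}
    (ht : T.type < d) {e : EuclideanSpace ℝ (Fin d)} (he : e ∈ T.refEdge) :
    ∃ S ∈ T.children, S.verts = {e, T.newVertex} ∪ T.innerVerts := by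
  rcases he with rfl | rfl
  · exact ⟨_, mem_children.2 (Or.inl rfl), verts_child₁ hd T⟩
  · exact ⟨_, mem_children.2 (Or.inr rfl), verts_child₂ hd T ht⟩

theorem verts_eq_refEdge_union (T : TaggedSimplex d) : T.verts = T.refEdge ∪ T.innerVerts :=
  T.verts_eq

theorem Nondeg.disjoint_refEdge {T : TaggedSimplex d} (hT : T.Nondeg) :
    Disjoint T.refEdge T.innerVerts := by
  rw [Set.disjoint_left]
  rintro _ (rfl | rfl) ⟨i, hi, h⟩
  · exact hi.1 (hT.injective h)
  · exact hi.2 (hT.injective h)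

theorem verts_child_subset (hd : d = 2 ∨ d = 3) {T S : TaggedSimplex d} (ht : T.type < d)
    (hS : S ∈ T.children) : S.verts ⊆ insert T.newVertex T.verts := by
  obtain ⟨e, he, hv⟩ := exists_verts_of_mem_children hd ht hS
  rw [hv, verts_eq_refEdge_union]
  rintro v ((rfl | rfl) | hv)
  · exact Or.inr (Or.inl he)
  · exact Or.inl rfl
  · exact Or.inr (Or.inr hv)

/-! ### Faces and bisection -/

/-- `S ∩ C` is a face of `C`, spanned by vertices of `C`. None of these is the new vertex, so all
are vertices of `A` in `S`, hence vertices of `S`. -/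
theorem Compat.child_of_newVertex_notMem (hd : d = 2 ∨ d = 3) {S A C : TaggedSimplex d}
    (hS : S.Nondeg) (hA : A.Nondeg) (ht : A.type < d) (h : S.Compat A) (hC : C ∈ A.children)
    (hm : A.newVertex ∉ S.body) : S.Compat C := by
  have hCA := body_subset_of_mem_children hd ht hC
  have heq : C.body ∩ (S.body ∩ A.body) = S.body ∩ C.body := by
    ext x; constructor
    · exact fun hx => ⟨hx.2.1, hx.1⟩
    · exact fun hx => ⟨hx.2, hx.1, hCA hx.2⟩
  have h2 := IsExtreme.inter_of_subset h.2 hCA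
  rw [heq] at h2
  refine ⟨?_, h2⟩
  rw [IsExtreme.eq_convexHull_inter h2 (S.convex_body.inter C.convex_body)]
  refine hS.isExtreme fun v hv => ?_
  rcases verts_child_subset hd ht hC hv.1 with rfl | hvA
  · exact absurd hv.2.1 hm
  · exact h.symm.vert_mem hA hvA hv.2.1

/-- The difference of the barycentric coordinates of the two ends of the refinement edge is
nonnegative on one child and nonpositive on the other; its zero set cuts the same face out of both.
-/
theorem compat_children (hd : d = 2 ∨ d = 3) {T : TaggedSimplex d} (hT : T.Nondeg)
    (ht : T.type < d) : T.child₁.Compat T.child₂ := by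
  have hspan : affineSpan ℝ (range T.vtx) = ⊤ :=
    (AffineIndependent.affineSpan_eq_top_iff_card_eq_finrank_add_one hT).2 (by simp)
  let b : AffineBasis (Fin (d + 1)) ℝ (EuclideanSpace ℝ (Fin d)) := ⟨T.vtx, hT, hspan⟩
  have hne := zero_ne_last hd
  let φ : EuclideanSpace ℝ (Fin d) →ᵃ[ℝ] ℝ := b.coord 0 - b.coord (Fin.last d)
  have hb : ∀ i j, b.coord i (T.vtx j) = if i = j then 1 else 0 := fun i j => b.coord_apply i j
  have h0 : φ (T.vtx 0) = 1 := by
    change b.coord 0 (T.vtx 0) - b.coord (Fin.last d) (T.vtx 0) = 1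
    rw [hb, hb, if_pos rfl, if_neg hne.symm, sub_zero]
  have h1 : φ (T.vtx (Fin.last d)) = -1 := by
    change b.coord 0 (T.vtx _) - b.coord (Fin.last d) (T.vtx _) = -1
    rw [hb, hb, if_pos rfl, if_neg hne, zero_sub]
  have hm : φ T.newVertex = 0 := by
    rw [newVertex, AffineMap.map_midpoint, h0, h1]; simp
  have hR : ∀ v ∈ T.innerVerts, φ v = 0 := by
    rintro _ ⟨i, hi, rfl⟩
    change b.coord 0 (T.vtx i) - b.coord (Fin.last d) (T.vtx i) = 0
    rw [hb, hb, if_neg (Ne.symm hi.1), if_neg (Ne.symm hi.2), sub_zero]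
  have hp : ∀ x ∈ T.child₁.body, 0 ≤ φ x := by
    refine convexHull_min ?_ ((convex_Ici (0 : ℝ)).affine_preimage φ)
    rw [verts_child₁ hd]
    rintro v ((rfl | rfl) | hv)
    · exact h0.ge.trans' zero_le_one
    · exact hm.ge
    · exact (hR v hv).ge
  have hn : ∀ x ∈ T.child₂.body, φ x ≤ 0 := by
    refine convexHull_min ?_ ((convex_Iic (0 : ℝ)).affine_preimage φ)
    rw [verts_child₂ hd T ht]
    rintro v ((rfl | rfl) | hv)
    · exact h1.le.trans (by norm_num)
    · exact hm.le
    · exact (hR v hv).le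
  have hc : ∀ x y, ∀ a b : ℝ, a + b = 1 → φ (a • x + b • y) = a * φ x + b * φ y :=
    fun x y a b hab => by
      have := Convex.combo_affine_apply (f := φ) (x := x) (y := y) hab
      simpa using this
  have hz : Convex ℝ {x | φ x = 0} := (convex_singleton (0 : ℝ)).affine_preimage φ
  have e1 : IsExtreme ℝ T.child₁.body (T.child₁.body ∩ {x | φ x = 0}) := by
    refine ⟨inter_subset_left, ?_⟩
    rintro x hx y hy z ⟨-, hz⟩ ⟨a, b, ha, hb, hab, rfl⟩
    refine ⟨hx, ?_⟩
    have hz' : φ (a • x + b • y) = 0 := hz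
    rw [hc x y a b hab] at hz'
    have := mul_nonneg hb.le (hp y hy)
    have := mul_nonneg ha.le (hp x hx)
    have h3 : a * φ x = 0 := by linarith
    exact (mul_eq_zero.1 h3).resolve_left ha.ne'
  have e2 : IsExtreme ℝ T.child₂.body (T.child₂.body ∩ {x | φ x = 0}) := by
    refine ⟨inter_subset_left, ?_⟩
    rintro x hx y hy z ⟨-, hz⟩ ⟨a, b, ha, hb, hab, rfl⟩
    refine ⟨hx, ?_⟩
    have hz' : φ (a • x + b • y) = 0 := hz
    rw [hc x y a b hab] at hz'
    have := mul_nonneg hb.le (neg_nonneg.2 (hn y hy))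
    have := mul_nonneg ha.le (neg_nonneg.2 (hn x hx))
    have h3 : a * φ x = 0 := by linarith
    exact (mul_eq_zero.1 h3).resolve_left ha.ne'
  have s1 : T.child₁.body ∩ {x | φ x = 0} ⊆ T.child₂.body := by
    rw [IsExtreme.eq_convexHull_inter e1 (T.child₁.convex_body.inter hz)]
    refine convexHull_mono ?_
    rw [verts_child₁ hd, verts_child₂ hd T ht]
    rintro v ⟨(rfl | rfl) | hv, -, hv0⟩
    · exact absurd (h0.symm.trans hv0) one_ne_zero
    · exact Or.inl (Or.inr rfl)
    · exact Or.inr hv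
  have s2 : T.child₂.body ∩ {x | φ x = 0} ⊆ T.child₁.body := by
    rw [IsExtreme.eq_convexHull_inter e2 (T.child₂.convex_body.inter hz)]
    refine convexHull_mono ?_
    rw [verts_child₁ hd, verts_child₂ hd T ht]
    rintro v ⟨(rfl | rfl) | hv, -, hv0⟩
    · exact absurd (h1.symm.trans hv0) (by norm_num)
    · exact Or.inl (Or.inr rfl)
    · exact Or.inr hv
  have i1 : T.child₁.body ∩ {x | φ x = 0} = T.child₁.body ∩ T.child₂.body :=
    Subset.antisymm (subset_inter inter_subset_left s1)
      fun x hx => ⟨hx.1, le_antisymm (hn x hx.2) (hp x hx.1)⟩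
  have i2 : T.child₂.body ∩ {x | φ x = 0} = T.child₁.body ∩ T.child₂.body :=
    Subset.antisymm (subset_inter s2 inter_subset_left)
      fun x hx => ⟨hx.2, le_antisymm (hn x hx.2) (hp x hx.1)⟩
  exact ⟨i1 ▸ e1, i2 ▸ e2⟩

theorem compat_self (T : TaggedSimplex d) : T.Compat T := by
  unfold Compat; rw [inter_self]; exact ⟨IsExtreme.rfl, IsExtreme.rfl⟩

theorem compat_of_mem_children (hd : d = 2 ∨ d = 3) {T S S' : TaggedSimplex d} (hT : T.Nondeg)
    (ht : T.type < d) (hS : S ∈ T.children) (hS' : S' ∈ T.children) : S.Compat S' := by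
  have h := compat_children hd hT ht
  rcases mem_children.1 hS with rfl | rfl <;> rcases mem_children.1 hS' with rfl | rfl
  exacts [compat_self _, h, h.symm, compat_self _]

/-- On the common face `f` both simplices are split in the same way: `S'` meets `f` in the same set
as the child `C` of `T` at the same end of the edge. So `S ∩ S'` is the intersection of the faces `S
∩ C` and `S ∩ f` of `S`. -/
theorem isExtreme_inter_child (hd : d = 2 ∨ d = 3) {T T' S S' : TaggedSimplex d} (hT : T.Nondeg)
    (hT' : T'.Nondeg) (ht : T.type < d) (ht' : T'.type < d) (h : T.Compat T')
    (he : T.refEdge = T'.refEdge) (hS : S ∈ T.children) (hS' : S' ∈ T'.children) :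
    IsExtreme ℝ S.body (S.body ∩ S'.body) := by
  have hm := newVertex_eq_of_refEdge_eq he
  set f := T.body ∩ T'.body with hf
  have hfc : Convex ℝ f := T.convex_body.inter T'.convex_body
  have heT : T.refEdge ⊆ T.body := subset_union_left.trans
    (T.verts_eq_refEdge_union.symm.subset.trans T.verts_subset_body)
  have heT' : T'.refEdge ⊆ T'.body := subset_union_left.trans
    (T'.verts_eq_refEdge_union.symm.subset.trans T'.verts_subset_body)
  have hef : T.refEdge ⊆ f := subset_inter heT (he ▸ heT')
  have hmf : T.newVertex ∈ f := ⟨T.newVertex_mem_body, hm ▸ T'.newVertex_mem_body⟩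
  have hRf : T.innerVerts ∩ f = T.innerVerts ∩ T'.innerVerts := by
    refine Subset.antisymm (fun v hv => ⟨hv.1, ?_⟩) (fun v hv => ⟨hv.1, ?_, ?_⟩)
    · have hvT : v ∈ T.verts := T.verts_eq_refEdge_union.symm.subset (Or.inr hv.1)
      have := h.vert_mem hT hvT hv.2.2
      rw [verts_eq_refEdge_union, ← he] at this
      exact this.resolve_left fun h' => (Set.disjoint_left.1 hT.disjoint_refEdge) h' hv.1
    · exact T.verts_subset_body (T.verts_eq_refEdge_union.symm.subset (Or.inr hv.1))
    · exact T'.verts_subset_body (T'.verts_eq_refEdge_union.symm.subset (Or.inr hv.2))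
  have hRf' : T'.innerVerts ∩ f = T.innerVerts ∩ T'.innerVerts := by
    refine Subset.antisymm (fun v hv => ⟨?_, hv.1⟩) (fun v hv => ⟨hv.2, ?_, ?_⟩)
    · have hvT : v ∈ T'.verts := T'.verts_eq_refEdge_union.symm.subset (Or.inr hv.1)
      have := h.symm.vert_mem hT' hvT hv.2.1
      rw [verts_eq_refEdge_union, he] at this
      exact this.resolve_left fun h' => (Set.disjoint_left.1 hT'.disjoint_refEdge) h' hv.1
    · exact T.verts_subset_body (T.verts_eq_refEdge_union.symm.subset (Or.inr hv.1))
    · exact T'.verts_subset_body (T'.verts_eq_refEdge_union.symm.subset (Or.inr hv.2))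
  set R := T.innerVerts ∩ T'.innerVerts
  have face : ∀ C ∈ T.children, ∀ e ∈ T.refEdge, C.verts = {e, T.newVertex} ∪ T.innerVerts →
      C.body ∩ f = convexHull ℝ ({e, T.newVertex} ∪ R) := by
    intro C hC e hee hv
    have hx : IsExtreme ℝ C.body (C.body ∩ f) :=
      IsExtreme.inter_of_subset h.1 (body_subset_of_mem_children hd ht hC)
    rw [IsExtreme.eq_convexHull_inter hx (C.convex_body.inter hfc), ← inter_assoc, inter_eq_left.2 C.verts_subset_body, hv,
      union_inter_distrib_right, hRf, inter_eq_left.2 (pair_subset (hef hee) hmf)]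
  have face' : ∀ C ∈ T'.children, ∀ e ∈ T.refEdge, C.verts = {e, T.newVertex} ∪ T'.innerVerts →
      C.body ∩ f = convexHull ℝ ({e, T.newVertex} ∪ R) := by
    intro C hC e hee hv
    have hx : IsExtreme ℝ C.body (C.body ∩ f) :=
      IsExtreme.inter_of_subset h.2 (body_subset_of_mem_children hd ht' hC)
    rw [IsExtreme.eq_convexHull_inter hx (C.convex_body.inter hfc), ← inter_assoc, inter_eq_left.2 C.verts_subset_body, hv,
      union_inter_distrib_right, hRf', inter_eq_left.2 (pair_subset (hef hee) hmf)]
  obtain ⟨e', he', hv'⟩ := exists_verts_of_mem_children hd ht' hS'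
  rw [← he] at he'
  rw [← hm] at hv'
  obtain ⟨C, hC, hvC⟩ := exists_child_of_mem_refEdge hd ht he'
  have hSS' : S.body ∩ S'.body = (S.body ∩ C.body) ∩ (S.body ∩ f) := by
    have hST := body_subset_of_mem_children hd ht hS
    have hST' := body_subset_of_mem_children hd ht' hS'
    have h1 : C.body ∩ f = S'.body ∩ f := by rw [face C hC e' he' hvC, face' S' hS' e' he' hv']
    ext x
    constructor
    · intro hx
      have hxf : x ∈ f := ⟨hST hx.1, hST' hx.2⟩
      exact ⟨⟨hx.1, (h1.symm.subset ⟨hx.2, hxf⟩).1⟩, hx.1, hxf⟩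
    · intro hx
      exact ⟨hx.1.1, (h1.subset ⟨hx.1.2, hx.2.2⟩).1⟩
  rw [hSS']
  exact (compat_of_mem_children hd hT ht hS hC).1.inter
    (IsExtreme.inter_of_subset h.1 (body_subset_of_mem_children hd ht hS))

theorem Compat.children_of_refEdge_eq (hd : d = 2 ∨ d = 3) {T T' S S' : TaggedSimplex d}
    (hT : T.Nondeg) (hT' : T'.Nondeg) (ht : T.type < d) (ht' : T'.type < d) (h : T.Compat T')
    (he : T.refEdge = T'.refEdge) (hS : S ∈ T.children) (hS' : S' ∈ T'.children) :
    S.Compat S' := by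
  refine ⟨isExtreme_inter_child hd hT hT' ht ht' h he hS hS', ?_⟩
  rw [inter_comm]
  exact isExtreme_inter_child hd hT' hT ht' ht h.symm he.symm hS' hS

/-- If the common face contains neither new vertex, the children are compatible. -/
theorem Compat.children_of_newVertex_notMem (hd : d = 2 ∨ d = 3) {T T' S S' : TaggedSimplex d}
    (hT : T.Nondeg) (hT' : T'.Nondeg) (ht : T.type < d) (ht' : T'.type < d) (h : T.Compat T')
    (hm : T.newVertex ∉ T'.body) (hm' : T'.newVertex ∉ T.body) (hS : S ∈ T.children)
    (hS' : S' ∈ T'.children) : S.Compat S' :=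
  ((h.child_of_newVertex_notMem hd hT hT' ht' hS' hm').symm.child_of_newVertex_notMem hd
    (hT'.child hd ht' hS') hT ht hS
    fun hx => hm (body_subset_of_mem_children hd ht' hS' hx)).symm

/-- The refinement edge lies in a face as soon as its midpoint does. -/
theorem Compat.refEdge_subset {T T' : TaggedSimplex d} (h : T.Compat T') (hT : T.Nondeg)
    (hm : T.newVertex ∈ T'.body) : T.refEdge ⊆ T.verts ∩ T'.verts := by
  have hmem : T.newVertex ∈ openSegment ℝ (T.vtx 0) (T.vtx (Fin.last d)) :=
    ⟨1 / 2, 1 / 2, by norm_num, by norm_num, by norm_num, by rw [newVertex_eq, smul_add]⟩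
  have a := T.verts_subset_body (T.vtx_mem_verts 0)
  have b := T.verts_subset_body (T.vtx_mem_verts (Fin.last d))
  have h0 := h.1.left_mem_of_mem_openSegment a b ⟨T.newVertex_mem_body, hm⟩ hmem
  have h1 := h.1.right_mem_of_mem_openSegment a b ⟨T.newVertex_mem_body, hm⟩ hmem
  rintro v (rfl | rfl)
  · exact ⟨T.vtx_mem_verts _, h.vert_mem hT (T.vtx_mem_verts _) h0.2⟩
  · exact ⟨T.vtx_mem_verts _, h.vert_mem hT (T.vtx_mem_verts _) h1.2⟩

end TaggedSimplex
end Bisection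

namespace Bisection

namespace TaggedSimplex

variable {d : ℕ}

/-! ### Reversal -/

theorem reversed_vtx_zero (T : TaggedSimplex d) : T.reversed.vtx 0 = T.vtx (Fin.last d) := by
  simp [reversed]

theorem reversed_vtx_last (hd : d = 2 ∨ d = 3) (T : TaggedSimplex d) :
    T.reversed.vtx (Fin.last d) = T.vtx 0 := by
  have : d ≠ 0 := by omega
  simp [reversed, this]

theorem refEdge_reversed (hd : d = 2 ∨ d = 3) (T : TaggedSimplex d) :
    T.reversed.refEdge = T.refEdge := by
  rw [refEdge, refEdge, reversed_vtx_zero, reversed_vtx_last hd, pair_comm]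

theorem newVertex_reversed (hd : d = 2 ∨ d = 3) (T : TaggedSimplex d) :
    T.reversed.newVertex = T.newVertex :=
  newVertex_eq_of_refEdge_eq (refEdge_reversed hd T)

theorem innerVerts_reversed (hd : d = 2 ∨ d = 3) {T : TaggedSimplex d} (ht : T.type < d) :
    T.reversed.innerVerts = T.innerVerts := by
  rcases hd with rfl | rfl
  · rw [innerVerts_two, innerVerts_two, reversed_vtx_two T ht]; rfl
  · rw [innerVerts_three, innerVerts_three, reversed_vtx_three T ht]
    split_ifs
    · exact pair_comm _ _
    · rfl

theorem verts_reversed (hd : d = 2 ∨ d = 3) {T : TaggedSimplex d} (ht : T.type < d) :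
    T.reversed.verts = T.verts := by
  rw [verts_eq_refEdge_union, verts_eq_refEdge_union T, refEdge_reversed hd,
    innerVerts_reversed hd ht]

theorem Nondeg.reversed (hd : d = 2 ∨ d = 3) {T : TaggedSimplex d} (hT : T.Nondeg)
    (ht : T.type < d) : T.reversed.Nondeg := by
  rw [nondeg_iff_volume_pos] at hT ⊢
  rwa [body, verts_reversed hd ht]

/-- Reversal swaps the children, so what is known at one end of the refinement edge transfers to the
other. -/
theorem child₁_reversed (hd : d = 2 ∨ d = 3) {T : TaggedSimplex d} (ht : T.type < d) :
    T.reversed.child₁ = T.child₂ := by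
  have hm := newVertex_reversed hd T
  ext1
  · rcases hd with rfl | rfl
    · rw [child₁_vtx_two, child₂_vtx_two T ht, hm, reversed_vtx_two T ht]; rfl
    · rw [child₁_vtx_three, child₂_vtx_three T ht, hm, reversed_vtx_three T ht]
      split_ifs <;> rfl
  · rfl

theorem child₂_reversed (hd : d = 2 ∨ d = 3) {T : TaggedSimplex d} (ht : T.type < d) :
    T.reversed.child₂ = T.child₁ := by
  have hm := newVertex_reversed hd T
  have ht' : T.reversed.type < d := ht
  have hty : T.reversed.type = T.type := rfl
  ext1
  · rcases hd with rfl | rfl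
    · rw [child₁_vtx_two, child₂_vtx_two _ ht', hm, reversed_vtx_two T ht]; rfl
    · rw [child₁_vtx_three, child₂_vtx_three _ ht', hm, reversed_vtx_three T ht, hty]
      split_ifs <;> rfl
  · rfl

theorem children_reversed (hd : d = 2 ∨ d = 3) {T : TaggedSimplex d} (ht : T.type < d) :
    T.reversed.children = T.children := by
  ext S
  rw [mem_children, mem_children, child₁_reversed hd ht, child₂_reversed hd ht, or_comm]

/-! ### Simplices that differ in one vertex -/

theorem DifferInOne.symm {T T' : TaggedSimplex d} (h : T.DifferInOne T') : T'.DifferInOne T := by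
  obtain ⟨i, hi, hj⟩ := h
  exact ⟨i, hi.symm, fun j h => (hj j h).symm⟩

theorem notMem_verts_of_differ {T T' : TaggedSimplex d} (hT : T.Nondeg) {i : Fin (d + 1)}
    (hi : T.vtx i ≠ T'.vtx i) (hj : ∀ j, j ≠ i → T.vtx j = T'.vtx j) : T.vtx i ∉ T'.verts := by
  rintro ⟨k, hk⟩
  by_cases h : k = i
  · subst h; exact hi hk.symm
  · rw [← hj k h] at hk
    exact h (hT.injective hk)

/-- The two vertices at the exceptional position are not shared, so this position cannot be an end
of a refinement edge that lies in the common face. -/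
theorem differ_index_inner {T T' : TaggedSimplex d} (hT : T.Nondeg) (hT' : T'.Nondeg)
    {i : Fin (d + 1)} (hi : T.vtx i ≠ T'.vtx i) (hj : ∀ j, j ≠ i → T.vtx j = T'.vtx j)
    (he : T.refEdge ⊆ T.verts ∩ T'.verts ∨ T'.refEdge ⊆ T.verts ∩ T'.verts) :
    i ≠ 0 ∧ i ≠ Fin.last d := by
  have h1 := notMem_verts_of_differ hT hi hj
  have h2 := notMem_verts_of_differ hT' hi.symm (fun j h => (hj j h).symm)
  constructor
  · rintro rfl
    rcases he with he | he
    · exact h1 (he (Or.inl rfl)).2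
    · exact h2 (he (Or.inl rfl)).1
  · rintro rfl
    rcases he with he | he
    · exact h1 (he (Or.inr rfl)).2
    · exact h2 (he (Or.inr rfl)).1

theorem DifferInOne.refEdge_eq {T T' : TaggedSimplex d} (h : T.DifferInOne T') (hT : T.Nondeg)
    (hT' : T'.Nondeg)
    (he : T.refEdge ⊆ T.verts ∩ T'.verts ∨ T'.refEdge ⊆ T.verts ∩ T'.verts) :
    T.refEdge = T'.refEdge := by
  obtain ⟨i, hi, hj⟩ := h
  obtain ⟨h0, h1⟩ := differ_index_inner hT hT' hi hj he
  rw [refEdge, refEdge, hj _ h0.symm, hj _ h1.symm]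

theorem ReflectedNeighbours.refEdge_eq (hd : d = 2 ∨ d = 3) {T T' : TaggedSimplex d}
    (h : T.ReflectedNeighbours T') (hT : T.Nondeg) (hT' : T'.Nondeg) (ht : T.type < d)
    (he : T.refEdge ⊆ T.verts ∩ T'.verts ∨ T'.refEdge ⊆ T.verts ∩ T'.verts) :
    T.refEdge = T'.refEdge := by
  rcases h.2 with h | h
  · exact h.refEdge_eq hT hT' he
  · rw [← refEdge_reversed hd] at he ⊢
    rw [← verts_reversed hd ht] at he
    exact h.refEdge_eq (hT.reversed hd ht) hT' he

theorem differ_child₁ (hd : d = 2 ∨ d = 3) {T T' : TaggedSimplex d} {i : Fin (d + 1)}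
    (hi : T.vtx i ≠ T'.vtx i) (hj : ∀ j, j ≠ i → T.vtx j = T'.vtx j) (h0 : i ≠ 0)
    (h1 : i ≠ Fin.last d) : T.child₁.DifferInOne T'.child₁ := by
  have hm : T.newVertex = T'.newVertex := by rw [newVertex, newVertex, hj _ h0.symm, hj _ h1.symm]
  have e0 := hj 0 h0.symm
  rcases hd with rfl | rfl
  · fin_cases i
    · exact absurd rfl h0
    · refine ⟨2, ?_, fun j hj2 => ?_⟩
      · rw [child₁_vtx_two, child₁_vtx_two]; exact hi
      · rw [child₁_vtx_two, child₁_vtx_two]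
        fin_cases j
        exacts [e0, hm, absurd rfl hj2]
    · exact absurd rfl h1
  · fin_cases i
    · exact absurd rfl h0
    · refine ⟨2, ?_, fun j hj2 => ?_⟩
      · rw [child₁_vtx_three, child₁_vtx_three]; exact hi
      · rw [child₁_vtx_three, child₁_vtx_three]
        fin_cases j
        exacts [e0, hm, absurd rfl hj2, hj 2 (by decide)]
    · refine ⟨3, ?_, fun j hj2 => ?_⟩
      · rw [child₁_vtx_three, child₁_vtx_three]; exact hi
      · rw [child₁_vtx_three, child₁_vtx_three]
        fin_cases j
        exacts [e0, hm, hj 1 (by decide), absurd rfl hj2]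
    · exact absurd rfl h1

theorem differ_child₂ (hd : d = 2 ∨ d = 3) {T T' : TaggedSimplex d} (hty : T.type = T'.type)
    (ht : T.type < d) {i : Fin (d + 1)}
    (hi : T.vtx i ≠ T'.vtx i) (hj : ∀ j, j ≠ i → T.vtx j = T'.vtx j) (h0 : i ≠ 0)
    (h1 : i ≠ Fin.last d) : T.child₂.DifferInOne T'.child₂ := by
  have hm : T.newVertex = T'.newVertex := by rw [newVertex, newVertex, hj _ h0.symm, hj _ h1.symm]
  have e0 := hj _ h1.symm
  have ht' : T'.type < d := hty ▸ ht
  rcases hd with rfl | rfl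
  · fin_cases i
    · exact absurd rfl h0
    · refine ⟨2, ?_, fun j hj2 => ?_⟩
      · rw [child₂_vtx_two _ ht, child₂_vtx_two _ ht']; exact hi
      · rw [child₂_vtx_two _ ht, child₂_vtx_two _ ht']
        fin_cases j
        exacts [e0, hm, absurd rfl hj2]
    · exact absurd rfl h1
  · have v1 := child₂_vtx_three _ ht
    have v2 := child₂_vtx_three _ ht'
    rw [← hty] at v2
    by_cases htz : T.type = 0
    · rw [if_pos htz] at v1 v2
      fin_cases i
      · exact absurd rfl h0
      · refine ⟨3, ?_, fun j hj2 => ?_⟩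
        · rw [v1, v2]; exact hi
        · rw [v1, v2]
          fin_cases j
          exacts [e0, hm, hj 2 (by decide), absurd rfl hj2]
      · refine ⟨2, ?_, fun j hj2 => ?_⟩
        · rw [v1, v2]; exact hi
        · rw [v1, v2]
          fin_cases j
          exacts [e0, hm, absurd rfl hj2, hj 1 (by decide)]
      · exact absurd rfl h1
    · rw [if_neg htz] at v1 v2
      fin_cases i
      · exact absurd rfl h0
      · refine ⟨2, ?_, fun j hj2 => ?_⟩
        · rw [v1, v2]; exact hi
        · rw [v1, v2]
          fin_cases j
          exacts [e0, hm, absurd rfl hj2, hj 2 (by decide)]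
      · refine ⟨3, ?_, fun j hj2 => ?_⟩
        · rw [v1, v2]; exact hi
        · rw [v1, v2]
          fin_cases j
          exacts [e0, hm, hj 1 (by decide), absurd rfl hj2]
      · exact absurd rfl h1

theorem ncard_innerVerts_le (hd : d = 2 ∨ d = 3) (T : TaggedSimplex d) :
    T.innerVerts.ncard + 1 ≤ d := by
  rcases hd with rfl | rfl
  · rw [innerVerts_two, ncard_singleton]
  · rw [innerVerts_three]
    exact Nat.succ_le_succ ((ncard_insert_le _ _).trans (by rw [ncard_singleton]))

theorem finite_innerVerts (T : TaggedSimplex d) : T.innerVerts.Finite := (Set.toFinite _).image _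

/-- Children at opposite ends of the refinement edge do not share a hyperface. -/
theorem ncard_child₁_inter_child₂_lt (hd : d = 2 ∨ d = 3) {T T' : TaggedSimplex d}
    (hT : T.Nondeg) (hT' : T'.Nondeg) (ht' : T'.type < d) {i : Fin (d + 1)}
    (hi : T.vtx i ≠ T'.vtx i) (hj : ∀ j, j ≠ i → T.vtx j = T'.vtx j) (h0 : i ≠ 0)
    (h1 : i ≠ Fin.last d) : (T.child₁.verts ∩ T'.child₂.verts).ncard < d := by
  have hm : T.newVertex = T'.newVertex := by rw [newVertex, newVertex, hj _ h0.symm, hj _ h1.symm]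
  have e0 := hj _ h0.symm
  have e1 := hj _ h1.symm
  have hne := zero_ne_last hd
  have hsub : T.child₁.verts ∩ T'.child₂.verts ⊆
      insert T.newVertex (T.innerVerts \ {T.vtx i}) := by
    rw [verts_child₁ hd, verts_child₂ hd T' ht', ← e1, ← hm]
    rintro v ⟨hv | hv, hv'⟩
    · rcases hv with rfl | rfl
      · exfalso
        rcases hv' with (hv' | hv') | hv'
        · exact hne (hT.injective hv')
        · exact newVertex_notMem_verts hd hT (hv' ▸ T.vtx_mem_verts 0)
        · rw [e0] at hv'
          exact (Set.disjoint_left.1 hT'.disjoint_refEdge) (Or.inl rfl) hv'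
      · exact Or.inl rfl
    · refine Or.inr ⟨hv, ?_⟩
      rintro rfl
      rcases hv' with (hv' | hv') | hv'
      · exact (Set.disjoint_left.1 hT.disjoint_refEdge) (Or.inr hv') hv
      · exact newVertex_notMem_verts hd hT (by rw [← mem_singleton_iff.1 hv']; exact T.vtx_mem_verts i)
      · exact notMem_verts_of_differ hT hi hj
          (T'.verts_eq_refEdge_union.symm.subset (Or.inr hv'))
  have hfin := T.finite_innerVerts
  have hlt : (T.innerVerts \ {T.vtx i}).ncard < T.innerVerts.ncard :=
    ncard_sdiff_singleton_lt_of_mem (mem_image_of_mem _ ⟨h0, h1⟩) hfin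
  have h2 := ncard_le_ncard hsub (hfin.sdiff.insert _)
  have h3 := ncard_insert_le T.newVertex (T.innerVerts \ {T.vtx i})
  have h4 := T.ncard_innerVerts_le hd
  omega

/-- Sharing a hyperface forces both children to sit at the same end of the common refinement edge;
there the bisection rule moves the exceptional vertex to the same position in both lists. -/
theorem DifferInOne.children (hd : d = 2 ∨ d = 3) {T T' S S' : TaggedSimplex d} (hT : T.Nondeg)
    (hT' : T'.Nondeg) (hty : T.type = T'.type) (ht : T.type < d) (h : T.DifferInOne T')
    (he : T.refEdge ⊆ T.verts ∩ T'.verts ∨ T'.refEdge ⊆ T.verts ∩ T'.verts)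
    (hS : S ∈ T.children) (hS' : S' ∈ T'.children) (hc : (S.verts ∩ S'.verts).ncard = d) :
    S.DifferInOne S' := by
  obtain ⟨i, hi, hj⟩ := h
  obtain ⟨h0, h1⟩ := differ_index_inner hT hT' hi hj he
  rcases mem_children.1 hS with rfl | rfl <;> rcases mem_children.1 hS' with rfl | rfl
  · exact differ_child₁ hd hi hj h0 h1
  · exact absurd hc (ncard_child₁_inter_child₂_lt hd hT hT' (hty ▸ ht) hi hj h0 h1).ne
  · rw [inter_comm] at hc
    exact absurd hc (ncard_child₁_inter_child₂_lt hd hT' hT ht hi.symm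
      (fun j h => (hj j h).symm) h0 h1).ne
  · exact differ_child₂ hd hty ht hi hj h0 h1

theorem type_eq_of_mem_children {T T' S S' : TaggedSimplex d} (hty : T.type = T'.type)
    (hS : S ∈ T.children) (hS' : S' ∈ T'.children) : S.type = S'.type := by
  rw [type_of_mem_children hS, type_of_mem_children hS', hty]

theorem ReflectedNeighbours.children (hd : d = 2 ∨ d = 3) {T T' S S' : TaggedSimplex d}
    (hT : T.Nondeg) (hT' : T'.Nondeg) (ht : T.type < d) (h : T.ReflectedNeighbours T')
    (he : T.refEdge ⊆ T.verts ∩ T'.verts ∨ T'.refEdge ⊆ T.verts ∩ T'.verts)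
    (hS : S ∈ T.children) (hS' : S' ∈ T'.children) (hc : (S.verts ∩ S'.verts).ncard = d) :
    S.ReflectedNeighbours S' := by
  refine ⟨type_eq_of_mem_children h.1 hS hS', Or.inl ?_⟩
  rcases h.2 with h2 | h2
  · exact h2.children hd hT hT' h.1 ht he hS hS' hc
  · rw [← refEdge_reversed hd, ← verts_reversed hd ht] at he
    exact h2.children hd (hT.reversed hd ht) hT' h.1 ht he (by rwa [children_reversed hd ht]) hS' hc

theorem last_notMem_child₁ (hd : d = 2 ∨ d = 3) {T : TaggedSimplex d} (hT : T.Nondeg) :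
    T.vtx (Fin.last d) ∉ T.child₁.verts := by
  rw [verts_child₁ hd]
  rintro ((h | h) | h)
  · exact zero_ne_last hd (hT.injective h).symm
  · exact newVertex_notMem_verts hd hT (by rw [← mem_singleton_iff.1 h]; exact T.vtx_mem_verts _)
  · exact (Set.disjoint_left.1 hT.disjoint_refEdge) (Or.inr rfl) h

theorem zero_notMem_child₂ (hd : d = 2 ∨ d = 3) {T : TaggedSimplex d} (hT : T.Nondeg)
    (ht : T.type < d) : T.vtx 0 ∉ T.child₂.verts := by
  rw [← child₁_reversed hd ht, ← reversed_vtx_last hd T]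
  exact last_notMem_child₁ hd (hT.reversed hd ht)

theorem eq_child₂_of_last_mem (hd : d = 2 ∨ d = 3) {T S : TaggedSimplex d} (hT : T.Nondeg)
    (hS : S ∈ T.children) (h : T.vtx (Fin.last d) ∈ S.verts) : S = T.child₂ := by
  rcases mem_children.1 hS with rfl | rfl
  · exact absurd h (last_notMem_child₁ hd hT)
  · rfl

theorem eq_child₁_of_zero_mem (hd : d = 2 ∨ d = 3) {T S : TaggedSimplex d} (hT : T.Nondeg)
    (ht : T.type < d) (hS : S ∈ T.children) (h : T.vtx 0 ∈ S.verts) : S = T.child₁ := by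
  rcases mem_children.1 hS with rfl | rfl
  · rfl
  · exact absurd h (zero_notMem_child₂ hd hT ht)

theorem midpoint_ne_of_ne_left {E : Type*} [AddCommGroup E] [Module ℝ E] {a b c : E}
    (h : a ≠ b) : midpoint ℝ a c ≠ midpoint ℝ b c := fun h' => h <| by
  rw [midpoint_eq_smul_add, midpoint_eq_smul_add] at h'
  have := smul_right_injective E (r := (⅟2 : ℝ)) (by simp) h'
  exact add_right_cancel this

theorem differ_child₁_of_last (hd : d = 2 ∨ d = 3) {T T' : TaggedSimplex d}
    (hi : T.vtx (Fin.last d) ≠ T'.vtx (Fin.last d))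
    (hj : ∀ j, j ≠ Fin.last d → T.vtx j = T'.vtx j) : T.child₁.DifferInOne T'.child₁ := by
  have e0 := hj 0 (zero_ne_last hd)
  have hm : T.newVertex ≠ T'.newVertex := by
    rw [newVertex, newVertex, e0, midpoint_comm, midpoint_comm (T'.vtx 0)]
    exact midpoint_ne_of_ne_left hi
  refine ⟨1, ?_, fun j hj1 => ?_⟩
  · rcases hd with rfl | rfl
    · rw [child₁_vtx_two, child₁_vtx_two]; exact hm
    · rw [child₁_vtx_three, child₁_vtx_three]; exact hm
  · rcases hd with rfl | rfl
    · rw [child₁_vtx_two, child₁_vtx_two]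
      fin_cases j
      exacts [e0, absurd rfl hj1, hj 1 (by decide)]
    · rw [child₁_vtx_three, child₁_vtx_three]
      fin_cases j
      exacts [e0, absurd rfl hj1, hj 1 (by decide), hj 2 (by decide)]

theorem differ_child₂_of_zero (hd : d = 2 ∨ d = 3) {T T' : TaggedSimplex d}
    (hty : T.type = T'.type) (ht : T.type < d) (hi : T.vtx 0 ≠ T'.vtx 0)
    (hj : ∀ j, j ≠ 0 → T.vtx j = T'.vtx j) : T.child₂.DifferInOne T'.child₂ := by
  have e0 := hj _ (zero_ne_last hd).symm
  have ht' : T'.type < d := hty ▸ ht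
  have hm : T.newVertex ≠ T'.newVertex := by
    rw [newVertex, newVertex, e0]
    exact midpoint_ne_of_ne_left hi
  refine ⟨1, ?_, fun j hj1 => ?_⟩
  · rcases hd with rfl | rfl
    · rw [child₂_vtx_two _ ht, child₂_vtx_two _ ht']; exact hm
    · rw [child₂_vtx_three _ ht, child₂_vtx_three _ ht', ← hty]
      split_ifs <;> exact hm
  · rcases hd with rfl | rfl
    · rw [child₂_vtx_two _ ht, child₂_vtx_two _ ht']
      fin_cases j
      exacts [e0, absurd rfl hj1, hj 1 (by decide)]
    · rw [child₂_vtx_three _ ht, child₂_vtx_three _ ht', ← hty]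
      split_ifs
      · fin_cases j
        exacts [e0, absurd rfl hj1, hj 2 (by decide), hj 1 (by decide)]
      · fin_cases j
        exacts [e0, absurd rfl hj1, hj 1 (by decide), hj 2 (by decide)]

/-- Now the exceptional vertex is an end of the refinement edge, and the children that contain the
shared vertices sit at the other end. They differ only in their new vertices, at position `1`. -/
theorem DifferInOne.children_of_not_refEdge (hd : d = 2 ∨ d = 3) {T T' S S' : TaggedSimplex d}
    (hT : T.Nondeg) (hT' : T'.Nondeg) (hty : T.type = T'.type) (ht : T.type < d)
    (h : T.DifferInOne T') (he : ¬ T.refEdge ⊆ T.verts ∩ T'.verts)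
    (hS : S ∈ T.children) (hS' : S' ∈ T'.children) (hc : T.verts ∩ T'.verts ⊆ S.verts)
    (hc' : T.verts ∩ T'.verts ⊆ S'.verts) : S.DifferInOne S' := by
  obtain ⟨i, hi, hj⟩ := h
  have hmem : ∀ j, j ≠ i → T.vtx j ∈ T.verts ∩ T'.verts := fun j h =>
    ⟨T.vtx_mem_verts j, by rw [hj j h]; exact T'.vtx_mem_verts j⟩
  have hne := zero_ne_last hd
  by_cases h0 : i = 0
  · subst h0
    have hl := hmem _ hne.symm
    have hl' := hc' hl
    rw [hj _ hne.symm] at hl'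
    rw [eq_child₂_of_last_mem hd hT hS (hc hl), eq_child₂_of_last_mem hd hT' hS' hl']
    exact differ_child₂_of_zero hd hty ht hi hj
  by_cases h1 : i = Fin.last d
  · subst h1
    have hl := hmem _ hne
    have hl' := hc' hl
    rw [hj _ hne] at hl'
    rw [eq_child₁_of_zero_mem hd hT ht hS (hc hl), eq_child₁_of_zero_mem hd hT' (hty ▸ ht) hS' hl']
    exact differ_child₁_of_last hd hi hj
  · refine absurd ?_ he
    rintro v (rfl | rfl)
    · exact hmem _ (Ne.symm h0)
    · exact hmem _ (Ne.symm h1)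

theorem ReflectedNeighbours.children_of_not_refEdge (hd : d = 2 ∨ d = 3)
    {T T' S S' : TaggedSimplex d} (hT : T.Nondeg) (hT' : T'.Nondeg) (ht : T.type < d)
    (h : T.ReflectedNeighbours T') (he : ¬ T.refEdge ⊆ T.verts ∩ T'.verts)
    (hS : S ∈ T.children) (hS' : S' ∈ T'.children) (hc : T.verts ∩ T'.verts ⊆ S.verts)
    (hc' : T.verts ∩ T'.verts ⊆ S'.verts) : S.ReflectedNeighbours S' := by
  refine ⟨type_eq_of_mem_children h.1 hS hS', Or.inl ?_⟩
  rcases h.2 with h2 | h2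
  · exact h2.children_of_not_refEdge hd hT hT' h.1 ht he hS hS' hc hc'
  · rw [← refEdge_reversed hd, ← verts_reversed hd ht] at he
    rw [← verts_reversed hd ht] at hc hc'
    exact h2.children_of_not_refEdge hd (hT.reversed hd ht) hT' h.1 ht he
      (by rwa [children_reversed hd ht]) hS' hc hc'

/-! ### Siblings -/

/-- Equality would be the affine dependence `x₀ - x₁ + x₂ - x₃ = 0`. -/
theorem midpoint_ne_of_nondeg {T : TaggedSimplex 3} (hT : T.Nondeg) :
    midpoint ℝ (T.vtx 0) (T.vtx 2) ≠ midpoint ℝ (T.vtx 3) (T.vtx 1) := by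
  intro h
  rw [midpoint_eq_smul_add, midpoint_eq_smul_add] at h
  have h' : T.vtx 0 + T.vtx 2 = T.vtx 3 + T.vtx 1 :=
    smul_right_injective _ (r := (⅟2 : ℝ)) (by simp) h
  have := (affineIndependent_iff.1 hT) Finset.univ ![1, -1, 1, -1] (by simp [Fin.sum_univ_four])
    (by
      refine (Fin.sum_univ_four _).trans ?_
      change (1 : ℝ) • T.vtx 0 + (-1 : ℝ) • T.vtx 1 + (1 : ℝ) • T.vtx 2 + (-1 : ℝ) • T.vtx 3 = 0
      rw [show (1 : ℝ) • T.vtx 0 + (-1 : ℝ) • T.vtx 1 + (1 : ℝ) • T.vtx 2 + (-1 : ℝ) • T.vtx 3 =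
        (T.vtx 0 + T.vtx 2) - (T.vtx 3 + T.vtx 1) by module, h', sub_self]) 0 (Finset.mem_univ _)
  simp at this

/-- These grandchildren differ in the midpoints of the siblings' refinement edges, at position `1`.
For `d = 3` and type `0` the siblings list the inner vertices in opposite orders, so the lists match
only after a reversal. -/
theorem differ_grandchildren (hd : d = 2 ∨ d = 3) {T : TaggedSimplex d} (hT : T.Nondeg)
    (ht : T.type < d) : T.child₁.child₂.ReflectedNeighbours T.child₂.child₂ ∧
      T.child₂.child₂.ReflectedNeighbours T.child₁.child₂ := by
  have t1 : T.child₁.type < d := type_lt_of_mem_children hd (mem_children.2 (Or.inl rfl))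
  have t2 : T.child₂.type < d := type_lt_of_mem_children hd (mem_children.2 (Or.inr rfl))
  have h03 : T.vtx 0 ≠ T.vtx (Fin.last d) := fun h => zero_ne_last hd (hT.injective h)
  rcases hd with rfl | rfl
  · have v1 := child₂_vtx_two _ t1
    have v2 := child₂_vtx_two _ t2
    have w1 : T.child₁.newVertex = midpoint ℝ (T.vtx 0) (T.vtx 1) := by
      rw [newVertex, child₁_vtx_two]; rfl
    have w2 : T.child₂.newVertex = midpoint ℝ (T.vtx 2) (T.vtx 1) := by
      rw [newVertex, child₂_vtx_two _ ht]; rfl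
    rw [child₁_vtx_two, w1] at v1
    rw [child₂_vtx_two _ ht, w2] at v2
    have hD : T.child₁.child₂.DifferInOne T.child₂.child₂ := by
      refine ⟨1, ?_, fun j hj => ?_⟩
      · rw [v1, v2]; exact midpoint_ne_of_ne_left h03
      · rw [v1, v2]
        fin_cases j
        exacts [rfl, absurd rfl hj, rfl]
    exact ⟨⟨rfl, Or.inl hD⟩, ⟨rfl, Or.inl hD.symm⟩⟩
  · have v1 := child₂_vtx_three _ t1
    have v2 := child₂_vtx_three _ t2
    by_cases h0 : T.type = 0
    · have y1 : T.child₁.type = 1 := by change (T.type + 1) % 3 = 1; rw [h0]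
      have y2 : T.child₂.type = 1 := y1
      have c2 := child₂_vtx_three _ ht
      rw [if_pos h0] at c2
      have w1 : T.child₁.newVertex = midpoint ℝ (T.vtx 0) (T.vtx 2) := by
        rw [newVertex, child₁_vtx_three]; rfl
      have w2 : T.child₂.newVertex = midpoint ℝ (T.vtx 3) (T.vtx 1) := by
        rw [newVertex, c2]; rfl
      rw [if_neg (by omega), child₁_vtx_three, w1] at v1
      rw [if_neg (by omega), c2, w2] at v2
      have z1 : T.child₁.child₂.type = 2 := by change (T.child₁.type + 1) % 3 = 2; rw [y1]
      have z2 : T.child₂.child₂.type = 2 := z1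
      have r1 := reversed_vtx_three T.child₁.child₂ (by omega)
      rw [if_neg (by omega), v1] at r1
      have r2 := reversed_vtx_three T.child₂.child₂ (by omega)
      rw [if_neg (by omega), v2] at r2
      refine ⟨⟨rfl, Or.inr ⟨1, ?_, fun j hj => ?_⟩⟩, ⟨rfl, Or.inr ⟨1, ?_, fun j hj => ?_⟩⟩⟩
      · rw [r1, v2]; exact midpoint_ne_of_nondeg hT
      · rw [r1, v2]
        fin_cases j
        exacts [rfl, absurd rfl hj, rfl, rfl]
      · rw [r2, v1]; exact (midpoint_ne_of_nondeg hT).symm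
      · rw [r2, v1]
        fin_cases j
        exacts [rfl, absurd rfl hj, rfl, rfl]
    · have hty : T.child₂.type = T.child₁.type := rfl
      have c2 := child₂_vtx_three _ ht
      rw [if_neg h0] at c2
      have w1 : T.child₁.newVertex = midpoint ℝ (T.vtx 0) (T.vtx 2) := by
        rw [newVertex, child₁_vtx_three]; rfl
      have w2 : T.child₂.newVertex = midpoint ℝ (T.vtx 3) (T.vtx 2) := by
        rw [newVertex, c2]; rfl
      rw [child₁_vtx_three, w1] at v1
      rw [c2, w2, hty] at v2
      have hD : T.child₁.child₂.DifferInOne T.child₂.child₂ := by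
        refine ⟨1, ?_, fun j hj => ?_⟩
        · rw [v1, v2]; split_ifs <;> exact midpoint_ne_of_ne_left h03
        · rw [v1, v2]
          split_ifs
          all_goals
            fin_cases j
            exacts [rfl, absurd rfl hj, rfl, rfl]
      exact ⟨⟨rfl, Or.inl hD⟩, ⟨rfl, Or.inl hD.symm⟩⟩

theorem last_child₁_mem_innerVerts (hd : d = 2 ∨ d = 3) (T : TaggedSimplex d) :
    T.child₁.vtx (Fin.last d) ∈ T.innerVerts := by
  rcases hd with rfl | rfl
  · rw [innerVerts_two, child₁_vtx_two]; rfl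
  · rw [innerVerts_three, child₁_vtx_three]; exact Or.inr rfl

theorem last_child₂_mem_innerVerts (hd : d = 2 ∨ d = 3) {T : TaggedSimplex d} (ht : T.type < d) :
    T.child₂.vtx (Fin.last d) ∈ T.innerVerts := by
  rw [← child₁_reversed hd ht, ← innerVerts_reversed hd ht]
  exact last_child₁_mem_innerVerts hd _

theorem innerVerts_subset_verts_child (hd : d = 2 ∨ d = 3) {T S : TaggedSimplex d}
    (ht : T.type < d) (hS : S ∈ T.children) : T.innerVerts ⊆ S.verts := by
  obtain ⟨e, -, h⟩ := exists_verts_of_mem_children hd ht hS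
  rw [h]; exact subset_union_right

theorem child₁_vtx_zero (T : TaggedSimplex d) : T.child₁.vtx 0 = T.vtx 0 := by simp [child₁]

theorem child₂_vtx_zero (T : TaggedSimplex d) : T.child₂.vtx 0 = T.vtx (Fin.last d) := by
  simp [child₂]

/-- The refinement edge of a sibling starts at the end of the parent's edge that the other sibling
has lost. Consequently only the clause of `ProperlyFlagged` on children of neighbours concerns
siblings. -/
theorem not_refEdge_subset_of_siblings (hd : d = 2 ∨ d = 3) {T S S' : TaggedSimplex d}
    (hT : T.Nondeg) (ht : T.type < d) (hS : S ∈ T.children) (hS' : S' ∈ T.children)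
    (hne : S ≠ S') : ¬ S.refEdge ⊆ S'.verts := by
  rcases mem_children.1 hS with rfl | rfl <;> rcases mem_children.1 hS' with rfl | rfl
  · exact absurd rfl hne
  · intro h
    exact zero_notMem_child₂ hd hT ht (T.child₁_vtx_zero ▸ h (Or.inl rfl))
  · intro h
    exact last_notMem_child₁ hd hT (T.child₂_vtx_zero ▸ h (Or.inl rfl))
  · exact absurd rfl hne

theorem siblings_children_reflected (hd : d = 2 ∨ d = 3) {T S S' C C' : TaggedSimplex d}
    (hT : T.Nondeg) (ht : T.type < d) (hS : S ∈ T.children) (hS' : S' ∈ T.children)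
    (hne : S ≠ S') (hC : C ∈ S.children) (hC' : C' ∈ S'.children)
    (hc : S.verts ∩ S'.verts ⊆ C.verts) (hc' : S.verts ∩ S'.verts ⊆ C'.verts) :
    C.ReflectedNeighbours C' := by
  have hsub : T.innerVerts ⊆ S.verts ∩ S'.verts :=
    subset_inter (innerVerts_subset_verts_child hd ht hS) (innerVerts_subset_verts_child hd ht hS')
  have m1 := last_child₁_mem_innerVerts hd T
  have m2 := last_child₂_mem_innerVerts hd ht
  have hSn := hT.child hd ht hS
  have hSn' := hT.child hd ht hS'
  have hg := differ_grandchildren hd hT ht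
  rcases mem_children.1 hS with rfl | rfl <;> rcases mem_children.1 hS' with rfl | rfl
  · exact absurd rfl hne
  · rw [eq_child₂_of_last_mem hd hSn hC (hc (hsub m1)),
      eq_child₂_of_last_mem hd hSn' hC' (hc' (hsub m2))]
    exact hg.1
  · rw [eq_child₂_of_last_mem hd hSn hC (hc (hsub m2)),
      eq_child₂_of_last_mem hd hSn' hC' (hc' (hsub m1))]
    exact hg.2
  · exact absurd rfl hne

end TaggedSimplex
end Bisection

/-! ### Partitions and chains of neighbours -/

namespace Bisection

variable {d : ℕ}

/-- The properties of a partition of `Ω` that survive arbitrary bisections. -/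
structure IsPartition (Ω : Set (EuclideanSpace ℝ (Fin d))) (𝒯 : Mesh d) : Prop where
  nondeg : ∀ T ∈ 𝒯, T.Nondeg
  type_lt : ∀ T ∈ 𝒯, T.type < d
  null_inter : ∀ T ∈ 𝒯, ∀ T' ∈ 𝒯, T ≠ T' → volume (T.body ∩ T'.body) = 0
  cover : Ω ⊆ ⋃ T ∈ 𝒯, T.body

theorem IsInitialTriangulation.isPartition {Ω : Set (EuclideanSpace ℝ (Fin d))} {𝒯 : Mesh d}
    (h : IsInitialTriangulation Ω 𝒯) : IsPartition Ω 𝒯 where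
  nondeg := h.affineIndependent
  type_lt := h.properlyFlagged.type_lt
  cover := subset_closure.trans h.cover.symm.subset
  null_inter T hT T' hT' hne := by
    have hsub : T.body ∩ T'.body ⊆ frontier T.body ∪ frontier T'.body := by
      intro x hx
      by_contra hn
      rw [mem_union, not_or] at hn
      have h1 : x ∈ interior T.body := by
        by_contra hi; exact hn.1 ⟨subset_closure hx.1, hi⟩
      have h2 : x ∈ interior T'.body := by
        by_contra hi; exact hn.2 ⟨subset_closure hx.2, hi⟩
      exact (Set.disjoint_left.1 (h.disjoint T hT T' hT' hne)) h1 h2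
    exact measure_mono_null hsub (measure_union_null
      (T.convex_body.addHaar_frontier volume) (T'.convex_body.addHaar_frontier volume))

theorem IsPartition.eq_of_body_subset {Ω : Set (EuclideanSpace ℝ (Fin d))} {𝒯 : Mesh d}
    (h : IsPartition Ω 𝒯) {T T' : TaggedSimplex d} (hT : T ∈ 𝒯) (hT' : T' ∈ 𝒯)
    (hb : T.body ⊆ T'.body) : T = T' := by
  by_contra hne
  have := h.null_inter T hT T' hT' hne
  rw [inter_eq_left.2 hb] at this
  exact ((TaggedSimplex.nondeg_iff_volume_pos T).1 (h.nondeg T hT)).ne' this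

namespace TaggedSimplex

theorem affineSpan_ne_top_of_ncard_le {T : TaggedSimplex d} (hT : T.Nondeg)
    {s : Set (EuclideanSpace ℝ (Fin d))} (hs : s.Finite) (hc : s.ncard ≤ d) :
    affineSpan ℝ s ≠ ⊤ := by
  classical
  intro h
  obtain ⟨s, rfl⟩ := hs.exists_finset_coe
  rw [ncard_coe_finset] at hc
  have hi : AffineIndependent ℝ ((↑) : (Finset.univ.image T.vtx) → EuclideanSpace ℝ (Fin d)) := by
    have e : ((Finset.univ.image T.vtx : Finset _) : Set (EuclideanSpace ℝ (Fin d))) =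
        range T.vtx := by simp
    change AffineIndependent ℝ ((↑) : ((Finset.univ.image T.vtx : Finset _) :
      Set (EuclideanSpace ℝ (Fin d))) → EuclideanSpace ℝ (Fin d))
    rw [e]
    exact hT.range
  have := hi.card_le_card_of_subset_affineSpan (t := s) (by rw [h]; exact subset_univ _)
  rw [Finset.card_image_of_injective _ hT.injective, Finset.card_univ, Fintype.card_fin] at this
  omega

theorem Nondeg.ncard_verts {T : TaggedSimplex d} (hT : T.Nondeg) : T.verts.ncard = d + 1 := by
  rw [verts, ← image_univ, ncard_image_of_injective _ hT.injective, ncard_univ]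
  simp

theorem Nondeg.interior_nonempty {T : TaggedSimplex d} (hT : T.Nondeg) :
    (interior T.body).Nonempty :=
  interior_convexHull_nonempty_iff_affineSpan_eq_top.2
    ((AffineIndependent.affineSpan_eq_top_iff_card_eq_finrank_add_one hT).2 (by simp))

end TaggedSimplex

/-- The relation of being neighbours that contain a given point. -/
def NeighboursAt (Ω : Set (EuclideanSpace ℝ (Fin d))) (𝒯 : Mesh d)
    (z : EuclideanSpace ℝ (Fin d)) (A B : TaggedSimplex d) : Prop :=
  A ∈ 𝒯 ∧ B ∈ 𝒯 ∧ z ∈ A.body ∧ z ∈ B.body ∧ A.NeighboursIn Ω B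

theorem exists_mem_open_notMem_null {U N : Set (EuclideanSpace ℝ (Fin d))} (hU : IsOpen U)
    (hne : U.Nonempty) (hN : volume N = 0) : ∃ a ∈ U, a ∉ N := by
  by_contra! h
  exact (hU.measure_pos volume hne).ne' (measure_mono_null h hN)

/-- For keeping a whole segment off the span of `s`: it is enough that `a` avoids this span and `b`
the span of `insert a s`. -/
theorem mem_affineSpan_insert_of_mem_segment {E : Type*} [AddCommGroup E] [Module ℝ E]
    {a b y : E} {s : Set E} (hy : y ∈ segment ℝ a b) (hys : y ∈ affineSpan ℝ s) (hya : y ≠ a) :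
    b ∈ affineSpan ℝ (insert a s) := by
  rw [segment_eq_image_lineMap] at hy
  obtain ⟨t, -, rfl⟩ := hy
  have ht : t ≠ 0 := by rintro rfl; simp at hya
  have h1 : AffineMap.lineMap a b t ∈ affineSpan ℝ (insert a s) :=
    affineSpan_mono ℝ (subset_insert _ _) hys
  have h2 : a ∈ affineSpan ℝ (insert a s) := subset_affineSpan ℝ _ (mem_insert _ _)
  have h3 := AffineMap.lineMap_mem (t⁻¹) h2 h1
  rwa [AffineMap.lineMap_apply (k := ℝ) a b t, AffineMap.lineMap_vadd_apply,
    smul_smul, inv_mul_cancel₀ ht, one_smul, vsub_vadd] at h3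

/-- Simplices that meet at a point of `Ω` are joined by neighbours that contain this point. -/
theorem exists_chain {Ω : Set (EuclideanSpace ℝ (Fin d))} {𝒯 : Mesh d} (hΩ : IsOpen Ω)
    (h𝒯 : IsPartition Ω 𝒯) (hc : Conforming Ω 𝒯) {T T' : TaggedSimplex d} (hT : T ∈ 𝒯)
    (hT' : T' ∈ 𝒯) {z : EuclideanSpace ℝ (Fin d)} (hz : z ∈ T.body) (hz' : z ∈ T'.body)
    (hzΩ : z ∈ Ω) : Relation.ReflTransGen (NeighboursAt Ω 𝒯 z) T T' := by
  classical
  -- a ball that only meets simplices through `z`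
  obtain ⟨r, hr, hball, hr𝒯⟩ : ∃ r > 0, Metric.ball z r ⊆ Ω ∧
      ∀ S ∈ 𝒯, ∀ y ∈ S.body, y ∈ Metric.ball z r → z ∈ S.body := by
    have hclosed : IsClosed (⋃ S ∈ 𝒯.filter (fun S => z ∉ S.body), S.body) :=
      isClosed_biUnion_finset fun S _ => S.isCompact_body.isClosed
    have hmem : Ω ∩ (⋃ S ∈ 𝒯.filter (fun S => z ∉ S.body), S.body)ᶜ ∈ nhds z := by
      refine (hΩ.inter hclosed.isOpen_compl).mem_nhds ⟨hzΩ, fun h => ?_⟩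
      simp only [Finset.mem_filter, mem_iUnion] at h
      obtain ⟨S, hS, h⟩ := h
      exact hS.2 h
    obtain ⟨r, hr, h⟩ := Metric.mem_nhds_iff.1 hmem
    refine ⟨r, hr, h.trans inter_subset_left, fun S hS y hy hyr => ?_⟩
    by_contra hzS
    refine (h hyr).2 ?_
    simp only [mem_iUnion]
    exact ⟨S, Finset.mem_filter.2 ⟨hS, hzS⟩, hy⟩
  -- the faces of codimension at least two
  let 𝒮 : Set (Set (EuclideanSpace ℝ (Fin d))) := {s | ∃ S ∈ 𝒯, s ⊆ S.verts ∧ s.ncard < d}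
  have h𝒮 : 𝒮.Finite := by
    refine ((𝒯.finite_toSet.biUnion fun S _ => S.finite_verts.finite_subsets)).subset ?_
    rintro s ⟨S, hS, hs, -⟩
    exact mem_biUnion hS hs
  have hfin : ∀ s ∈ 𝒮, s.Finite := by
    rintro s ⟨S, -, hs, -⟩
    exact S.finite_verts.subset hs
  have hn := h𝒯.nondeg T hT
  have hint : ∀ S ∈ 𝒯, z ∈ S.body → (Metric.ball z r ∩ interior S.body).Nonempty := by
    intro S hS hzS
    have : z ∈ closure (interior S.body) := by
      rw [S.convex_body.closure_interior_eq_closure_of_nonempty_interior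
        (h𝒯.nondeg S hS).interior_nonempty]
      exact subset_closure hzS
    exact mem_closure_iff.1 this _ Metric.isOpen_ball (Metric.mem_ball_self hr)
  -- The ends `a` and `b` avoid null sets in such a way that the segment between them misses all
  -- faces with fewer than `d` vertices; walking along it, only hyperfaces are crossed.
  obtain ⟨a, ⟨haB, haT⟩, haN⟩ := exists_mem_open_notMem_null
    (Metric.isOpen_ball.inter isOpen_interior) (hint T hT hz)
    ((measure_biUnion_null_iff h𝒮.countable).2 fun s hs => Measure.addHaar_affineSubspace volume
      (affineSpan ℝ s) (TaggedSimplex.affineSpan_ne_top_of_ncard_le hn (hfin s hs)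
        (by obtain ⟨-, -, -, h⟩ := hs; exact h.le)))
  obtain ⟨b, ⟨hbB, hbT⟩, hbN⟩ := exists_mem_open_notMem_null
    (Metric.isOpen_ball.inter isOpen_interior) (hint T' hT' hz')
    ((measure_biUnion_null_iff h𝒮.countable).2 fun s hs => Measure.addHaar_affineSubspace volume
      (affineSpan ℝ (insert a s)) (TaggedSimplex.affineSpan_ne_top_of_ncard_le hn
        ((hfin s hs).insert a) (by
          obtain ⟨-, -, -, h⟩ := hs; exact (ncard_insert_le a s).trans h)))
  simp only [mem_iUnion, not_exists] at haN hbN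
  have hgen : ∀ y ∈ segment ℝ a b, ∀ s ∈ 𝒮, y ∉ convexHull ℝ s := by
    intro y hy s hs hys
    have hys' := convexHull_subset_affineSpan s hys
    exact hbN s hs (mem_affineSpan_insert_of_mem_segment hy hys' (by
      rintro rfl; exact haN s hs hys'))
  have hseg : segment ℝ a b ⊆ Metric.ball z r := (convex_ball z r).segment_subset haB hbB
  -- The simplices reachable from `T` and the remaining ones form two closed sets that cover the
  -- segment. By connectedness they meet, and at a common point conformity provides a neighbour step
  -- from the first kind to the second.
  by_contra hnot
  set P : TaggedSimplex d → Prop := fun S => Relation.ReflTransGen (NeighboursAt Ω 𝒯 z) T S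
  have hcl : ∀ Q : TaggedSimplex d → Prop, 
      IsClosed (⋃ S ∈ {S | S ∈ 𝒯 ∧ Q S}, S.body) := fun Q =>
    (𝒯.finite_toSet.subset fun _ h => h.1).isClosed_biUnion
      fun S _ => S.isCompact_body.isClosed
  obtain ⟨y, hy, hy1, hy2⟩ := (isPreconnected_closed_iff.1 (convex_segment a b).isPreconnected)
    _ _ (hcl P) (hcl fun S => ¬ P S) (by
      intro y hy
      have := h𝒯.cover (hball (hseg hy))
      simp only [mem_iUnion] at this
      obtain ⟨S, hS, hyS⟩ := this
      by_cases hP : P S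
      · exact Or.inl (mem_biUnion ⟨hS, hP⟩ hyS)
      · exact Or.inr (mem_biUnion ⟨hS, hP⟩ hyS))
    ⟨a, left_mem_segment ℝ a b, mem_biUnion
      ⟨hT, Relation.ReflTransGen.refl⟩ (interior_subset haT)⟩
    ⟨b, right_mem_segment ℝ a b, mem_biUnion
      ⟨hT', hnot⟩ (interior_subset hbT)⟩
  simp only [mem_iUnion] at hy1 hy2
  obtain ⟨S, ⟨hS, hPS⟩, hyS⟩ := hy1
  obtain ⟨S', ⟨hS', hPS'⟩, hyS'⟩ := hy2
  have hyB := hseg hy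
  have hyΩ := hball hyB
  have hSS' := hc S hS S' hS' ⟨y, ⟨hyS, hyS'⟩, hyΩ⟩
  have hyc : y ∈ convexHull ℝ (S.verts ∩ S'.verts) := hSS' ▸ ⟨hyS, hyS'⟩
  have hge : d ≤ (S.verts ∩ S'.verts).ncard := by
    by_contra hlt
    exact hgen y hy _ ⟨S, hS, inter_subset_left, not_le.1 hlt⟩ hyc
  have hne : S ≠ S' := by rintro rfl; exact hPS' hPS
  have hle : (S.verts ∩ S'.verts).ncard ≤ d := by
    by_contra hlt
    have hsub : S.verts ∩ S'.verts = S.verts := by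
      refine eq_of_subset_of_ncard_le inter_subset_left ?_ S.finite_verts
      rw [(h𝒯.nondeg S hS).ncard_verts]; omega
    exact hne (h𝒯.eq_of_body_subset hS hS'
      (convexHull_mono (inter_eq_left.1 hsub)))
  exact hPS' (hPS.tail ⟨hS, hS', hr𝒯 S hS y hyS hyB, hr𝒯 S' hS' y hyS' hyB,
    hle.antisymm hge, y, hyc, hyΩ⟩)

end Bisection

/-! ### Uniform refinement preserves conformity and flagging -/

namespace Bisection

open TaggedSimplex

variable {d : ℕ}

open scoped Classical in
/-- The mesh in which every simplex is bisected once. -/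
noncomputable def bisectAll (𝒯 : Mesh d) : Mesh d := 𝒯.biUnion TaggedSimplex.children

theorem mem_bisectAll {𝒯 : Mesh d} {S : TaggedSimplex d} :
    S ∈ bisectAll 𝒯 ↔ ∃ T ∈ 𝒯, S ∈ T.children := by
  classical
  simp [bisectAll]

theorem null_inter_children (hd : d = 2 ∨ d = 3) {T S S' : TaggedSimplex d} (ht : T.type < d)
    (hS : S ∈ T.children) (hS' : S' ∈ T.children) (hne : S ≠ S') :
    volume (S.body ∩ S'.body) = 0 := by
  have h := measure_child_inter hd ht
  rcases mem_children.1 hS with rfl | rfl <;> rcases mem_children.1 hS' with rfl | rfl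
  · exact absurd rfl hne
  · exact h
  · rwa [inter_comm]
  · exact absurd rfl hne

theorem IsPartition.bisectAll (hd : d = 2 ∨ d = 3) {Ω : Set (EuclideanSpace ℝ (Fin d))}
    {𝒯 : Mesh d} (h : IsPartition Ω 𝒯) : IsPartition Ω (bisectAll 𝒯) where
  nondeg S hS := by
    obtain ⟨T, hT, hS⟩ := mem_bisectAll.1 hS
    exact (h.nondeg T hT).child hd (h.type_lt T hT) hS
  type_lt S hS := by
    obtain ⟨T, hT, hS⟩ := mem_bisectAll.1 hS
    exact type_lt_of_mem_children hd hS
  null_inter S hS S' hS' hne := by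
    obtain ⟨T, hT, hS⟩ := mem_bisectAll.1 hS
    obtain ⟨T', hT', hS'⟩ := mem_bisectAll.1 hS'
    by_cases hTT : T = T'
    · subst hTT
      exact null_inter_children hd (h.type_lt T hT) hS hS' hne
    · exact measure_mono_null (inter_subset_inter
        (body_subset_of_mem_children hd (h.type_lt T hT) hS)
        (body_subset_of_mem_children hd (h.type_lt T' hT') hS')) (h.null_inter T hT T' hT' hTT)
  cover := by
    refine h.cover.trans (iUnion₂_subset fun T hT => ?_)
    rw [body_eq_union hd T (h.type_lt T hT)]
    exact union_subset
      (subset_biUnion_of_mem (u := fun S : TaggedSimplex d => S.body)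
        (mem_bisectAll.2 ⟨T, hT, mem_children.2 (Or.inl rfl)⟩))
      (subset_biUnion_of_mem (u := fun S : TaggedSimplex d => S.body)
        (mem_bisectAll.2 ⟨T, hT, mem_children.2 (Or.inr rfl)⟩))

theorem Conforming.compat {Ω : Set (EuclideanSpace ℝ (Fin d))} {𝒯 : Mesh d}
    (h : IsPartition Ω 𝒯) (hc : Conforming Ω 𝒯) {T T' : TaggedSimplex d} (hT : T ∈ 𝒯)
    (hT' : T' ∈ 𝒯) {z : EuclideanSpace ℝ (Fin d)} (hz : z ∈ T.body) (hz' : z ∈ T'.body)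
    (hzΩ : z ∈ Ω) : T.Compat T' :=
  compat_of_inter_eq (h.nondeg T hT) (h.nondeg T' hT') (hc T hT T' hT' ⟨z, ⟨hz, hz'⟩, hzΩ⟩)

/-- If the midpoint of the refinement edge of `T` lies in `T'`, then `T'` has the same
refinement edge. -/
theorem refEdge_eq_of_newVertex_mem (hd : d = 2 ∨ d = 3) {Ω : Set (EuclideanSpace ℝ (Fin d))}
    {𝒯 : Mesh d} (hΩ : IsOpen Ω) (h : IsPartition Ω 𝒯) (hc : Conforming Ω 𝒯)
    (hf : ProperlyFlagged Ω 𝒯) {T T' : TaggedSimplex d} (hT : T ∈ 𝒯)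
    (hT' : T' ∈ 𝒯) {z : EuclideanSpace ℝ (Fin d)} (hz : z ∈ T.body) (hz' : z ∈ T'.body)
    (hzΩ : z ∈ Ω) (hm : T.newVertex ∈ T'.body) : T.refEdge = T'.refEdge := by
  have hn := h.nondeg T hT
  have hTT := hc.compat h hT hT' hz hz' hzΩ
  have he := hTT.refEdge_subset hn hm
  obtain ⟨s, hs⟩ := (T.finite_verts.inter_of_left T'.verts).exists_finset_coe
  have hzs : z ∈ convexHull ℝ (s : Set (EuclideanSpace ℝ (Fin d))) := by
    rw [hs, ← hTT.inter_eq hn]; exact ⟨hz, hz'⟩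
  -- Every simplex through the generic point `y` contains the whole common face, in particular
  -- `T.refEdge`. The flagging condition therefore applies at each step of a chain of neighbours
  -- through `y`.
  obtain ⟨y, hys, hyΩ, hy⟩ := exists_generic_point hΩ s hzs hzΩ
  rw [hs] at hy hys
  have hyT : y ∈ T.body := convexHull_mono inter_subset_left hys
  have hyT' : y ∈ T'.body := convexHull_mono inter_subset_right hys
  have hsub : ∀ A ∈ 𝒯, y ∈ A.body → T.refEdge ⊆ A.body := fun A hA hyA =>
    he.trans ((hy T.body _ T.convex_body (hc.compat h hT hA hyT hyA hyΩ).1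
      (convexHull_mono inter_subset_left) ⟨hyT, hyA⟩).trans inter_subset_right)
  have key : ∀ A, Relation.ReflTransGen (NeighboursAt Ω 𝒯 y) T A → T.refEdge = A.refEdge := by
    intro A hA
    induction hA with
    | refl => rfl
    | @tail A B _ hAB ih =>
      obtain ⟨hA, hB, hyA, hyB, hN⟩ := hAB
      have hAe : A.refEdge ⊆ A.verts ∩ B.verts := by
        intro v hv
        have hvA : v ∈ A.verts := A.verts_eq_refEdge_union.symm.subset (Or.inl hv)
        exact ⟨hvA, (hc.compat h hA hB hyA hyB hyΩ).vert_mem (h.nondeg A hA) hvA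
          (hsub B hB hyB (ih ▸ hv))⟩
      exact ih.trans ((hf.refEdge_mem A hA B hB hN (Or.inl hAe)).refEdge_eq hd (h.nondeg A hA)
        (h.nondeg B hB) (h.type_lt A hA) (Or.inl hAe))
  exact key T' (exists_chain hΩ h hc hT hT' hyT hyT' hyΩ)

/-- Parents of meeting children either have the same refinement edge and are split at the same
midpoint, or neither contains the other's midpoint; both cases preserve common faces. -/
theorem Conforming.bisectAll (hd : d = 2 ∨ d = 3) {Ω : Set (EuclideanSpace ℝ (Fin d))}
    {𝒯 : Mesh d} (hΩ : IsOpen Ω) (h : IsPartition Ω 𝒯) (hc : Conforming Ω 𝒯)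
    (hf : ProperlyFlagged Ω 𝒯) : Conforming Ω (bisectAll 𝒯) := by
  rintro S hS S' hS' ⟨z, ⟨hz, hz'⟩, hzΩ⟩
  have hSn := (h.bisectAll hd).nondeg S hS
  obtain ⟨T, hT, hS⟩ := mem_bisectAll.1 hS
  obtain ⟨T', hT', hS'⟩ := mem_bisectAll.1 hS'
  have hn := h.nondeg T hT
  have hn' := h.nondeg T' hT'
  have ht := h.type_lt T hT
  have ht' := h.type_lt T' hT'
  have hzT := body_subset_of_mem_children hd ht hS hz
  have hzT' := body_subset_of_mem_children hd ht' hS' hz'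
  have hTT := hc.compat h hT hT' hzT hzT' hzΩ
  refine TaggedSimplex.Compat.inter_eq ?_ hSn
  by_cases h1 : T.newVertex ∈ T'.body
  · exact hTT.children_of_refEdge_eq hd hn hn' ht ht'
      (refEdge_eq_of_newVertex_mem hd hΩ h hc hf hT hT' hzT hzT' hzΩ h1) hS hS'
  by_cases h2 : T'.newVertex ∈ T.body
  · exact hTT.children_of_refEdge_eq hd hn hn' ht ht'
      (refEdge_eq_of_newVertex_mem hd hΩ h hc hf hT' hT hzT' hzT hzΩ h2).symm hS hS'
  · exact hTT.children_of_newVertex_notMem hd hn hn' ht ht' h1 h2 hS hS'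

/-- A hyperface shared by children of different simplices lies in a hyperface which these share. -/
theorem ncard_inter_of_children (hd : d = 2 ∨ d = 3) {Ω : Set (EuclideanSpace ℝ (Fin d))}
    {𝒯 : Mesh d} (h : IsPartition Ω 𝒯) {T T' S S' : TaggedSimplex d} (hT : T ∈ 𝒯)
    (hT' : T' ∈ 𝒯) (hne : T ≠ T') (hTT : T.Compat T') (hS : S ∈ T.children)
    (hS' : S' ∈ T'.children) (hc : (S.verts ∩ S'.verts).ncard = d) :
    (T.verts ∩ T'.verts).ncard = d := by
  classical
  have hn := h.nondeg T hT
  have hsub : S.verts ∩ S'.verts ⊆ convexHull ℝ (T.verts ∩ T'.verts) := by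
    rw [← hTT.inter_eq hn]
    exact inter_subset_inter
      (S.verts_subset_body.trans (body_subset_of_mem_children hd (h.type_lt T hT) hS))
      (S'.verts_subset_body.trans (body_subset_of_mem_children hd (h.type_lt T' hT') hS'))
  refine le_antisymm ?_ ?_
  · by_contra hlt
    have hs : T.verts ∩ T'.verts = T.verts := by
      refine eq_of_subset_of_ncard_le inter_subset_left ?_ T.finite_verts
      rw [hn.ncard_verts]; omega
    exact hne (h.eq_of_body_subset hT hT' (convexHull_mono (inter_eq_left.1 hs)))
  · obtain ⟨s, hs⟩ := (S.finite_verts.inter_of_left S'.verts).exists_finset_coe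
    obtain ⟨t, ht⟩ := (T.finite_verts.inter_of_left T'.verts).exists_finset_coe
    have hi : AffineIndependent ℝ (fun x : (s : Set (EuclideanSpace ℝ (Fin d))) => (x : EuclideanSpace ℝ (Fin d))) := by
      rw [hs]
      exact AffineIndependent.mono
        (hn.child hd (h.type_lt T hT) hS).range inter_subset_left
    rw [← ht] at hsub ⊢
    rw [← hs] at hsub hc
    rw [ncard_coe_finset] at hc ⊢
    refine hc.ge.trans ?_
    -- The `d` shared vertices of the children are affinely independent and lie in the span of those
    -- shared by the parents.
    exact AffineIndependent.card_le_card_of_subset_affineSpan hi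
      (hsub.trans (convexHull_subset_affineSpan _))

/-- If the parents' common face contains a refinement edge, the parents are reflected and pass this
on. Otherwise no new vertex lies on the face, the children share it entirely, and the flagging
condition on children applies verbatim. -/
theorem reflectedNeighbours_children (hd : d = 2 ∨ d = 3) {Ω : Set (EuclideanSpace ℝ (Fin d))}
    {𝒯 : Mesh d} (h : IsPartition Ω 𝒯) (hc : Conforming Ω 𝒯)
    (hf : ProperlyFlagged Ω 𝒯) {T T' S S' : TaggedSimplex d} (hT : T ∈ 𝒯) (hT' : T' ∈ 𝒯)
    (hne : T ≠ T') (hS : S ∈ T.children) (hS' : S' ∈ T'.children)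
    (hN : S.NeighboursIn Ω S') : S.ReflectedNeighbours S' := by
  have hn := h.nondeg T hT
  have hn' := h.nondeg T' hT'
  have ht := h.type_lt T hT
  have ht' := h.type_lt T' hT'
  obtain ⟨hcard, z, hz, hzΩ⟩ := hN
  have hST := body_subset_of_mem_children hd ht hS
  have hST' := body_subset_of_mem_children hd ht' hS'
  have hzT : z ∈ T.body := hST (convexHull_mono inter_subset_left hz)
  have hzT' : z ∈ T'.body := hST' (convexHull_mono inter_subset_right hz)
  have hTT := hc.compat h hT hT' hzT hzT' hzΩ
  have hcard' := ncard_inter_of_children hd h hT hT' hne hTT hS hS' hcard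
  have hNT : T.NeighboursIn Ω T' := by
    refine ⟨hcard', z, ?_, hzΩ⟩
    rw [← hTT.inter_eq hn]; exact ⟨hzT, hzT'⟩
  by_cases he : T.refEdge ⊆ T.verts ∩ T'.verts ∨ T'.refEdge ⊆ T.verts ∩ T'.verts
  · exact (hf.refEdge_mem T hT T' hT' hNT he).children hd hn hn' ht he hS hS' hcard
  · have hsub : S.verts ∩ S'.verts ⊆ T.verts ∩ T'.verts := by
      intro v hv
      have hvT : v ∈ T.body := hST (S.verts_subset_body hv.1)
      have hvT' : v ∈ T'.body := hST' (S'.verts_subset_body hv.2)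
      constructor
      · rcases verts_child_subset hd ht hS hv.1 with rfl | hv1
        · exact absurd (Or.inl (hTT.refEdge_subset hn hvT')) he
        · exact hv1
      · rcases verts_child_subset hd ht' hS' hv.2 with rfl | hv1
        · exact absurd (Or.inr (by rw [inter_comm]; exact hTT.symm.refEdge_subset hn' hvT)) he
        · exact hv1
    have heq : S.verts ∩ S'.verts = T.verts ∩ T'.verts :=
      eq_of_subset_of_ncard_le hsub (hcard'.le.trans hcard.ge) (T.finite_verts.inter_of_left _)
    exact hf.refEdge_notMem T hT T' hT' hNT he S hS S' hS' (heq ▸ inter_subset_left)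
      (heq ▸ inter_subset_right)

theorem ProperlyFlagged.bisectAll (hd : d = 2 ∨ d = 3) {Ω : Set (EuclideanSpace ℝ (Fin d))}
    {𝒯 : Mesh d} (h : IsPartition Ω 𝒯) (hc : Conforming Ω 𝒯)
    (hf : ProperlyFlagged Ω 𝒯) : ProperlyFlagged Ω (bisectAll 𝒯) where
  type_lt := (h.bisectAll hd).type_lt
  type_eq S hS S' hS' := by
    obtain ⟨T, hT, hS⟩ := mem_bisectAll.1 hS
    obtain ⟨T', hT', hS'⟩ := mem_bisectAll.1 hS'
    exact type_eq_of_mem_children (hf.type_eq T hT T' hT') hS hS'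
  refEdge_mem S hS S' hS' hN he := by
    have hSn := (h.bisectAll hd).nondeg S hS
    obtain ⟨T, hT, hS⟩ := mem_bisectAll.1 hS
    obtain ⟨T', hT', hS'⟩ := mem_bisectAll.1 hS'
    by_cases hTT : T = T'
    · subst hTT
      have hne : S ≠ S' := by
        rintro rfl
        have := hN.1
        rw [inter_self, hSn.ncard_verts] at this
        omega
      rcases he with he | he
      · exact absurd (he.trans inter_subset_right)
          (not_refEdge_subset_of_siblings hd (h.nondeg T hT) (h.type_lt T hT) hS hS' hne)
      · exact absurd (he.trans inter_subset_left)
          (not_refEdge_subset_of_siblings hd (h.nondeg T hT) (h.type_lt T hT) hS' hS hne.symm)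
    · exact reflectedNeighbours_children hd h hc hf hT hT' hTT hS hS' hN
  refEdge_notMem S hS S' hS' hN he C hC C' hC' hsub hsub' := by
    have hSn := (h.bisectAll hd).nondeg S hS
    have hSn' := (h.bisectAll hd).nondeg S' hS'
    have ht := (h.bisectAll hd).type_lt S hS
    obtain ⟨T, hT, hS⟩ := mem_bisectAll.1 hS
    obtain ⟨T', hT', hS'⟩ := mem_bisectAll.1 hS'
    by_cases hTT : T = T'
    · subst hTT
      have hne : S ≠ S' := by
        rintro rfl
        have := hN.1
        rw [inter_self, hSn.ncard_verts] at this
        omega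
      exact siblings_children_reflected hd (h.nondeg T hT) (h.type_lt T hT) hS hS' hne hC hC'
        hsub hsub'
    · exact (reflectedNeighbours_children hd h hc hf hT hT' hTT hS hS' hN).children_of_not_refEdge
        hd hSn hSn' ht (fun h' => he (Or.inl h')) hC hC' hsub hsub'

/-- The uniform refinement of generation `g`. -/
noncomputable def uniform (𝒯₀ : Mesh d) (g : ℕ) : Mesh d := bisectAll^[g] 𝒯₀

theorem uniform_zero (𝒯₀ : Mesh d) : uniform 𝒯₀ 0 = 𝒯₀ := rfl

theorem uniform_succ (𝒯₀ : Mesh d) (g : ℕ) :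
    uniform 𝒯₀ (g + 1) = bisectAll (uniform 𝒯₀ g) := Function.iterate_succ_apply' _ _ _

theorem mem_uniform_succ {𝒯₀ : Mesh d} {g : ℕ} {S : TaggedSimplex d} :
    S ∈ uniform 𝒯₀ (g + 1) ↔ ∃ T ∈ uniform 𝒯₀ g, S ∈ T.children := by
  rw [uniform_succ, mem_bisectAll]

theorem IsInitialTriangulation.uniform (hd : d = 2 ∨ d = 3)
    {Ω : Set (EuclideanSpace ℝ (Fin d))} {𝒯₀ : Mesh d} (h : IsInitialTriangulation Ω 𝒯₀) (g : ℕ) :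
    IsPartition Ω (uniform 𝒯₀ g) ∧ Conforming Ω (uniform 𝒯₀ g) ∧
      ProperlyFlagged Ω (uniform 𝒯₀ g) := by
  induction g with
  | zero => exact ⟨h.isPartition, h.conforming, h.properlyFlagged⟩
  | succ g ih =>
    rw [uniform_succ]
    obtain ⟨h1, h2, h3⟩ := ih
    exact ⟨h1.bisectAll hd, h2.bisectAll hd h.isOpen h1 h3, h3.bisectAll hd h1 h2⟩

end Bisection

namespace Bisection

open TaggedSimplex

variable {d : ℕ} {Ω : Set (EuclideanSpace ℝ (Fin d))} {𝒯₀ : Mesh d}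

/-! ### The bisection forest -/

theorem exists_ancestor (hd : d = 2 ∨ d = 3) (h : IsInitialTriangulation Ω 𝒯₀) {g k : ℕ}
    {T : TaggedSimplex d} (hT : T ∈ uniform 𝒯₀ (g + k)) :
    ∃ A ∈ uniform 𝒯₀ g, T.body ⊆ A.body ∧ volume T.body = volume A.body / 2 ^ k := by
  induction k generalizing T with
  | zero => exact ⟨T, hT, Subset.rfl, by simp⟩
  | succ k ih =>
    obtain ⟨B, hB, hTB⟩ := mem_uniform_succ.1 hT
    obtain ⟨A, hA, hBA, hv⟩ := ih hB
    have ht := (h.uniform hd (g + k)).1.type_lt B hB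
    refine ⟨A, hA, (body_subset_of_mem_children hd ht hTB).trans hBA, ?_⟩
    rw [volume_of_mem_children hd ht hTB, hv, pow_succ, ENNReal.div_eq_inv_mul,
      ENNReal.div_eq_inv_mul, ENNReal.div_eq_inv_mul, ← mul_assoc,
      ENNReal.mul_inv (Or.inr (by simp)) (Or.inr (by simp)), mul_comm (2 : ENNReal)⁻¹]

/-- A simplex that recurred `k` generations later would equal its own ancestor, while its volume had
dropped by the factor `2^k`. -/
theorem uniform_disjoint (hd : d = 2 ∨ d = 3) (h : IsInitialTriangulation Ω 𝒯₀) {g k : ℕ}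
    {T : TaggedSimplex d} (hT : T ∈ uniform 𝒯₀ g) (hT' : T ∈ uniform 𝒯₀ (g + k)) : k = 0 := by
  obtain ⟨A, hA, hTA, hv⟩ := exists_ancestor hd h hT'
  have hU := (h.uniform hd g).1
  have := hU.eq_of_body_subset hT hA hTA
  subst this
  by_contra hk
  have hpos := (nondeg_iff_volume_pos T).1 (hU.nondeg T hT)
  have hlt : volume T.body / 2 ^ k < volume T.body := by
    refine ENNReal.div_lt_of_lt_mul' ?_
    have h2 : (1 : ENNReal) < 2 ^ k := one_lt_pow₀ (by norm_num) hk
    calc volume T.body = 1 * volume T.body := (one_mul _).symm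
      _ < 2 ^ k * volume T.body := by
        rw [mul_comm 1, mul_comm (2 ^ k)]
        exact (ENNReal.mul_lt_mul_iff_right hpos.ne' T.volume_body_ne_top).2 h2
  exact hlt.ne hv.symm

theorem generation_unique (hd : d = 2 ∨ d = 3) (h : IsInitialTriangulation Ω 𝒯₀) {g g' : ℕ}
    {T : TaggedSimplex d} (hT : T ∈ uniform 𝒯₀ g) (hT' : T ∈ uniform 𝒯₀ g') : g = g' := by
  rcases le_total g g' with hle | hle
  · obtain ⟨k, rfl⟩ := Nat.exists_eq_add_of_le hle
    rw [uniform_disjoint hd h hT hT', add_zero]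
  · obtain ⟨k, rfl⟩ := Nat.exists_eq_add_of_le hle
    rw [uniform_disjoint hd h hT' hT, add_zero]

/-- The nodes of the infinite forest of all possible descendants. -/
def IsNode (𝒯₀ : Mesh d) (T : TaggedSimplex d) : Prop := ∃ g, T ∈ uniform 𝒯₀ g

theorem IsNode.child {T S : TaggedSimplex d} (hT : IsNode 𝒯₀ T) (hS : S ∈ T.children) :
    IsNode 𝒯₀ S := by
  obtain ⟨g, hg⟩ := hT
  exact ⟨g + 1, mem_uniform_succ.2 ⟨T, hg, hS⟩⟩

theorem IsNode.nondeg (hd : d = 2 ∨ d = 3) (h : IsInitialTriangulation Ω 𝒯₀)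
    {T : TaggedSimplex d} (hT : IsNode 𝒯₀ T) : T.Nondeg := by
  obtain ⟨g, hg⟩ := hT
  exact (h.uniform hd g).1.nondeg T hg

theorem IsNode.type_lt (hd : d = 2 ∨ d = 3) (h : IsInitialTriangulation Ω 𝒯₀)
    {T : TaggedSimplex d} (hT : IsNode 𝒯₀ T) : T.type < d := by
  obtain ⟨g, hg⟩ := hT
  exact (h.uniform hd g).1.type_lt T hg

theorem parent_unique (hd : d = 2 ∨ d = 3) (h : IsInitialTriangulation Ω 𝒯₀)
    {T T' S : TaggedSimplex d} (hT : IsNode 𝒯₀ T) (hT' : IsNode 𝒯₀ T') (hS : S ∈ T.children)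
    (hS' : S ∈ T'.children) : T = T' := by
  have hn := (hT.child hS).nondeg hd h
  have ht := hT.type_lt hd h
  have ht' := hT'.type_lt hd h
  obtain ⟨g, hg⟩ := hT
  obtain ⟨g', hg'⟩ := hT'
  have hgg : g + 1 = g' + 1 := generation_unique hd h (mem_uniform_succ.2 ⟨T, hg, hS⟩)
    (mem_uniform_succ.2 ⟨T', hg', hS'⟩)
  obtain rfl : g = g' := by omega
  by_contra hne
  exact ((nondeg_iff_volume_pos S).1 hn).ne' (measure_mono_null
    (subset_inter (body_subset_of_mem_children hd ht hS) (body_subset_of_mem_children hd ht' hS'))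
    ((h.uniform hd g).1.null_inter T hg T' hg' hne))

theorem notMem_of_mem_children (hd : d = 2 ∨ d = 3) (h : IsInitialTriangulation Ω 𝒯₀)
    {T S : TaggedSimplex d} (hT : IsNode 𝒯₀ T) (hS : S ∈ T.children) : S ∉ 𝒯₀ := by
  obtain ⟨g, hg⟩ := hT
  intro hS0
  have := generation_unique hd h (g := 0) hS0 (mem_uniform_succ.2 ⟨T, hg, hS⟩)
  omega

/-! ### Meshes as sets of leaves -/

/-- A finite set of nodes that contains the parent of each of its members: the simplices that have
been bisected in the course of a refinement. -/
structure IsTree (𝒯₀ I : Mesh d) : Prop where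
  isNode : ∀ T ∈ I, IsNode 𝒯₀ T
  parent_mem : ∀ T, IsNode 𝒯₀ T → ∀ S ∈ T.children, S ∈ I → T ∈ I

/-- The simplices that occur when the members of `I` are bisected. -/
def Reached (𝒯₀ I : Mesh d) (S : TaggedSimplex d) : Prop :=
  S ∈ 𝒯₀ ∨ ∃ T ∈ I, S ∈ T.children

open scoped Classical in
/-- The mesh that arises when the members of `I` are bisected. -/
noncomputable def leaves (𝒯₀ I : Mesh d) : Mesh d := (𝒯₀ ∪ I.biUnion TaggedSimplex.children) \ I

theorem mem_leaves {I : Mesh d} {S : TaggedSimplex d} :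
    S ∈ leaves 𝒯₀ I ↔ Reached 𝒯₀ I S ∧ S ∉ I := by
  classical
  simp [leaves, Reached]

theorem leaves_empty (𝒯₀ : Mesh d) : leaves 𝒯₀ ∅ = 𝒯₀ := by simp [leaves]

theorem isTree_empty (𝒯₀ : Mesh d) : IsTree 𝒯₀ ∅ := ⟨by simp, by simp⟩

theorem mem_refine {𝒯 ℳ : Mesh d} {S : TaggedSimplex d} :
    S ∈ refine 𝒯 ℳ ↔ (S ∈ 𝒯 ∧ S ∉ ℳ) ∨ ∃ T ∈ ℳ, S ∈ T.children := by
  classical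
  simp [refine]

theorem Reached.mono {I J : Mesh d} (hIJ : I ⊆ J) {S : TaggedSimplex d} (hS : Reached 𝒯₀ I S) :
    Reached 𝒯₀ J S := by
  rcases hS with hS | ⟨T, hT, hS⟩
  exacts [Or.inl hS, Or.inr ⟨T, hIJ hT, hS⟩]

theorem Reached.isNode {I : Mesh d} (hI : IsTree 𝒯₀ I) {S : TaggedSimplex d}
    (hS : Reached 𝒯₀ I S) : IsNode 𝒯₀ S := by
  rcases hS with hS | ⟨T, hT, hS⟩
  exacts [⟨0, hS⟩, (hI.isNode T hT).child hS]

theorem IsTree.reached {I : Mesh d} (hI : IsTree 𝒯₀ I) {S : TaggedSimplex d} (hS : S ∈ I) :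
    Reached 𝒯₀ I S := by
  obtain ⟨g, hg⟩ := hI.isNode S hS
  cases g with
  | zero => exact Or.inl hg
  | succ g =>
    obtain ⟨T, hT, hST⟩ := mem_uniform_succ.1 hg
    exact Or.inr ⟨T, hI.parent_mem T ⟨g, hT⟩ S hST hS, hST⟩

open scoped Classical in
theorem IsTree.union (hd : d = 2 ∨ d = 3) (h : IsInitialTriangulation Ω 𝒯₀) {I ℳ : Mesh d}
    (hI : IsTree 𝒯₀ I) (hℳ : ∀ T ∈ ℳ, Reached 𝒯₀ I T) : IsTree 𝒯₀ (I ∪ ℳ) where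
  isNode T hT := by
    rcases Finset.mem_union.1 hT with hT | hT
    exacts [hI.isNode T hT, (hℳ T hT).isNode hI]
  parent_mem T hT S hST hS := by
    rcases Finset.mem_union.1 hS with hS | hS
    · exact Finset.mem_union_left _ (hI.parent_mem T hT S hST hS)
    · rcases hℳ S hS with h0 | ⟨T', hT', hST'⟩
      · exact absurd h0 (notMem_of_mem_children hd h hT hST)
      · rw [parent_unique hd h hT (hI.isNode T' hT') hST hST']
        exact Finset.mem_union_left _ hT'

open scoped Classical in
theorem IsTree.inter {I J : Mesh d} (hI : IsTree 𝒯₀ I) (hJ : IsTree 𝒯₀ J) :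
    IsTree 𝒯₀ (I ∩ J) where
  isNode T hT := hI.isNode T (Finset.mem_inter.1 hT).1
  parent_mem T hT S hST hS := by
    rw [Finset.mem_inter] at hS ⊢
    exact ⟨hI.parent_mem T hT S hST hS.1, hJ.parent_mem T hT S hST hS.2⟩

open scoped Classical in
-- Bisecting marked leaves means adding them to the tree; this turns refinement and completion into
-- statements about subsets of the forest.
theorem refine_leaves (hd : d = 2 ∨ d = 3) (h : IsInitialTriangulation Ω 𝒯₀) {I ℳ : Mesh d}
    (hI : IsTree 𝒯₀ I) (hℳ : ℳ ⊆ leaves 𝒯₀ I) :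
    refine (leaves 𝒯₀ I) ℳ = leaves 𝒯₀ (I ∪ ℳ) := by
  ext S
  rw [mem_refine, mem_leaves, mem_leaves, Finset.mem_union, not_or]
  constructor
  · rintro (⟨⟨hS, hSI⟩, hSℳ⟩ | ⟨T, hT, hS⟩)
    · exact ⟨hS.mono Finset.subset_union_left, hSI, hSℳ⟩
    · obtain ⟨hTr, hTI⟩ := mem_leaves.1 (hℳ hT)
      have hTn := hTr.isNode hI
      refine ⟨Or.inr ⟨T, Finset.mem_union_right _ hT, hS⟩,
        fun hSI => hTI (hI.parent_mem T hTn S hS hSI), fun hSℳ => ?_⟩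
      rcases (mem_leaves.1 (hℳ hSℳ)).1 with h0 | ⟨T', hT', hST'⟩
      · exact notMem_of_mem_children hd h hTn hS h0
      · rw [parent_unique hd h hTn (hI.isNode T' hT') hS hST'] at hTI
        exact hTI hT'
  · rintro ⟨hS | ⟨T, hT, hS⟩, hSI, hSℳ⟩
    · exact Or.inl ⟨⟨Or.inl hS, hSI⟩, hSℳ⟩
    · rcases Finset.mem_union.1 hT with hT | hT
      · exact Or.inl ⟨⟨Or.inr ⟨T, hT, hS⟩, hSI⟩, hSℳ⟩
      · exact Or.inr ⟨T, hT, hS⟩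

/-- A member of `J` outside `I` of least generation either belongs to `𝒯₀` or has its parent in `I`.
-/
theorem IsTree.exists_reached_of_not_subset {I J : Mesh d} (hJ : IsTree 𝒯₀ J)
    (hIJ : ¬ J ⊆ I) : ∃ T ∈ J, T ∉ I ∧ Reached 𝒯₀ I T := by
  classical
  rw [Finset.not_subset] at hIJ
  have hex : ∃ g, ∃ T ∈ J, T ∉ I ∧ T ∈ uniform 𝒯₀ g := by
    obtain ⟨T, hT, hTI⟩ := hIJ
    obtain ⟨g, hg⟩ := hJ.isNode T hT
    exact ⟨g, T, hT, hTI, hg⟩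
  obtain ⟨T, hT, hTI, hg⟩ := Nat.find_spec hex
  refine ⟨T, hT, hTI, ?_⟩
  cases hk : Nat.find hex with
  | zero => rw [hk] at hg; exact Or.inl hg
  | succ k =>
    rw [hk] at hg
    obtain ⟨A, hA, hTA⟩ := mem_uniform_succ.1 hg
    refine Or.inr ⟨A, ?_, hTA⟩
    by_contra hAI
    have := Nat.find_min hex (m := k) (by omega)
    exact this ⟨A, hJ.parent_mem A ⟨k, hA⟩ T hTA hT, hAI, hA⟩

theorem IsTree.subset_of_leaves_eq {I J : Mesh d} (hJ : IsTree 𝒯₀ J)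
    (he : leaves 𝒯₀ I = leaves 𝒯₀ J) : J ⊆ I := by
  by_contra hIJ
  obtain ⟨T, hT, hTI, hr⟩ := hJ.exists_reached_of_not_subset hIJ
  have : T ∈ leaves 𝒯₀ I := mem_leaves.2 ⟨hr, hTI⟩
  rw [he] at this
  exact (mem_leaves.1 this).2 hT

theorem refines_of_subset (hd : d = 2 ∨ d = 3) (h : IsInitialTriangulation Ω 𝒯₀) {I J : Mesh d}
    (hI : IsTree 𝒯₀ I) (hJ : IsTree 𝒯₀ J) (hIJ : I ⊆ J) :
    Refines (leaves 𝒯₀ I) (leaves 𝒯₀ J) := by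
  classical
  induction hn : (J \ I).card generalizing I with
  | zero =>
    rw [Finset.card_eq_zero, Finset.sdiff_eq_empty_iff_subset] at hn
    rw [hIJ.antisymm hn]
    exact Relation.ReflTransGen.refl
  | succ n ih =>
    have hnot : ¬ J ⊆ I := fun hs => by
      rw [Finset.sdiff_eq_empty_iff_subset.2 hs] at hn; simp at hn
    obtain ⟨T, hT, hTI, hr⟩ := hJ.exists_reached_of_not_subset hnot
    have hTl : T ∈ leaves 𝒯₀ I := mem_leaves.2 ⟨hr, hTI⟩
    refine Relation.ReflTransGen.head (b := leaves 𝒯₀ (I ∪ {T})) ⟨T, hTl, ?_⟩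
      (ih (hI.union hd h fun S hS => by rwa [Finset.mem_singleton.1 hS])
        (Finset.union_subset hIJ (Finset.singleton_subset_iff.2 hT)) ?_)
    · rw [refine_leaves hd h hI (Finset.singleton_subset_iff.2 hTl)]
    · have : J \ (I ∪ {T}) = (J \ I).erase T := by
        ext S; simp only [Finset.mem_sdiff, Finset.mem_union, Finset.mem_singleton,
          Finset.mem_erase]; tauto
      rw [this, Finset.card_erase_of_mem (Finset.mem_sdiff.2 ⟨hT, hTI⟩), hn]
      rfl

theorem exists_isTree_of_refines (hd : d = 2 ∨ d = 3) (h : IsInitialTriangulation Ω 𝒯₀)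
    {I 𝒮 : Mesh d} (hI : IsTree 𝒯₀ I) (hr : Refines (leaves 𝒯₀ I) 𝒮) :
    ∃ J, IsTree 𝒯₀ J ∧ I ⊆ J ∧ 𝒮 = leaves 𝒯₀ J := by
  classical
  induction hr with
  | refl => exact ⟨I, hI, Finset.Subset.refl _, rfl⟩
  | tail _ hstep ih =>
    obtain ⟨J, hJ, hIJ, rfl⟩ := ih
    obtain ⟨T, hT, rfl⟩ := hstep
    refine ⟨J ∪ {T}, hJ.union hd h fun S hS => ?_, hIJ.trans Finset.subset_union_left,
      refine_leaves hd h hJ (Finset.singleton_subset_iff.2 hT)⟩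
    rw [Finset.mem_singleton.1 hS]
    exact (mem_leaves.1 hT).1

theorem exists_ancestor_mem (hd : d = 2 ∨ d = 3) (h : IsInitialTriangulation Ω 𝒯₀) {I : Mesh d}
    (hI : IsTree 𝒯₀ I) {g k : ℕ} {S : TaggedSimplex d} (hS : S ∈ uniform 𝒯₀ (g + (k + 1)))
    (hSr : Reached 𝒯₀ I S) : ∃ A ∈ uniform 𝒯₀ g, A ∈ I ∧ S.body ⊆ A.body := by
  have hpar : ∀ n S, S ∈ uniform 𝒯₀ (n + 1) → Reached 𝒯₀ I S →
      ∃ A ∈ uniform 𝒯₀ n, A ∈ I ∧ S.body ⊆ A.body := by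
    intro n S hS hSr
    obtain ⟨A, hA, hSA⟩ := mem_uniform_succ.1 hS
    refine ⟨A, hA, ?_, body_subset_of_mem_children hd (IsNode.type_lt hd h ⟨n, hA⟩) hSA⟩
    rcases hSr with h0 | ⟨T, hT, hST⟩
    · exact absurd h0 (notMem_of_mem_children hd h ⟨n, hA⟩ hSA)
    · rwa [parent_unique hd h ⟨n, hA⟩ (hI.isNode T hT) hSA hST]
  induction k generalizing S with
  | zero => exact hpar g S hS hSr
  | succ k ih =>
    obtain ⟨B, hB, hBI, hSB⟩ := hpar _ S hS hSr
    obtain ⟨A, hA, hAI, hBA⟩ := ih hB (hI.reached hBI)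
    exact ⟨A, hA, hAI, hSB.trans hBA⟩

/-- The leaf of later generation lies in an ancestor of the same generation as the other leaf. This
ancestor has been bisected, so it is a different simplex of the same uniform mesh. -/
theorem null_inter_leaves (hd : d = 2 ∨ d = 3) (h : IsInitialTriangulation Ω 𝒯₀) {I : Mesh d}
    (hI : IsTree 𝒯₀ I) {S S' : TaggedSimplex d} (hS : S ∈ leaves 𝒯₀ I) (hS' : S' ∈ leaves 𝒯₀ I)
    (hne : S ≠ S') : volume (S.body ∩ S'.body) = 0 := by
  obtain ⟨hr, hSI⟩ := mem_leaves.1 hS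
  obtain ⟨hr', hSI'⟩ := mem_leaves.1 hS'
  obtain ⟨g, hg⟩ := hr.isNode hI
  obtain ⟨g', hg'⟩ := hr'.isNode hI
  wlog hle : g ≤ g' generalizing S S' g g'
  · rw [inter_comm]
    exact this hS' hS hne.symm hr' hSI' hr hSI g' hg' g hg (le_of_not_ge hle)
  obtain ⟨k, rfl⟩ := Nat.exists_eq_add_of_le hle
  have hU := (h.uniform hd g).1
  cases k with
  | zero => exact hU.null_inter S hg S' hg' hne
  | succ k =>
    obtain ⟨A, hA, hAI, hSA⟩ := exists_ancestor_mem hd h hI hg' hr'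
    have hSA' : S ≠ A := by rintro rfl; exact hSI hAI
    exact measure_mono_null (inter_subset_inter_right _ hSA) (hU.null_inter S hg A hA hSA')

theorem exists_leaf_mem (hd : d = 2 ∨ d = 3) (h : IsInitialTriangulation Ω 𝒯₀) {I : Mesh d}
    (hI : IsTree 𝒯₀ I) {T : TaggedSimplex d} (hT : Reached 𝒯₀ I T)
    {z : EuclideanSpace ℝ (Fin d)} (hz : z ∈ T.body) :
    ∃ S ∈ leaves 𝒯₀ I, z ∈ S.body ∧ S.body ⊆ T.body := by
  -- `N` exceeds the generation of every bisected simplex, so the descent from `T` through children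
  -- that contain `z` ends.
  obtain ⟨N, hN⟩ : ∃ N, ∀ A ∈ I, ∀ g, A ∈ uniform 𝒯₀ g → g < N := by
    choose! gen hgen using hI.isNode
    refine ⟨I.sup gen + 1, fun A hA g hg => ?_⟩
    rw [generation_unique hd h hg (hgen A hA)]
    exact Nat.lt_succ_of_le (Finset.le_sup hA)
  obtain ⟨g, hg⟩ := hT.isNode hI
  induction hn : N - g generalizing g T with
  | zero =>
    refine ⟨T, mem_leaves.2 ⟨hT, fun hTI => ?_⟩, hz, Subset.rfl⟩
    have := hN T hTI g hg
    omega
  | succ n ih =>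
    by_cases hTI : T ∈ I
    · have ht := hT.isNode hI |>.type_lt hd h
      have hz' := hz
      rw [body_eq_union hd T ht] at hz'
      obtain ⟨C, hC, hzC⟩ : ∃ C ∈ T.children, z ∈ C.body := by
        rcases hz' with hz' | hz'
        exacts [⟨_, mem_children.2 (Or.inl rfl), hz'⟩, ⟨_, mem_children.2 (Or.inr rfl), hz'⟩]
      obtain ⟨S, hS, hzS, hSC⟩ := ih (Or.inr ⟨T, hTI, hC⟩) hzC (g + 1)
        (mem_uniform_succ.2 ⟨T, hg, hC⟩) (by omega)
      exact ⟨S, hS, hzS, hSC.trans (body_subset_of_mem_children hd ht hC)⟩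
    · exact ⟨T, mem_leaves.2 ⟨hT, hTI⟩, hz, Subset.rfl⟩

theorem compat_leaves (hd : d = 2 ∨ d = 3) (h : IsInitialTriangulation Ω 𝒯₀) {I : Mesh d}
    (hI : IsTree 𝒯₀ I) (hc : Conforming Ω (leaves 𝒯₀ I)) {S S' : TaggedSimplex d}
    (hS : S ∈ leaves 𝒯₀ I) (hS' : S' ∈ leaves 𝒯₀ I) {z : EuclideanSpace ℝ (Fin d)}
    (hz : z ∈ S.body) (hz' : z ∈ S'.body) (hzΩ : z ∈ Ω) : S.Compat S' :=
  compat_of_inter_eq (((mem_leaves.1 hS).1.isNode hI).nondeg hd h)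
    (((mem_leaves.1 hS').1.isNode hI).nondeg hd h) (hc S hS S' hS' ⟨z, ⟨hz, hz'⟩, hzΩ⟩)

/-- In a conforming refinement, a leaf meets every simplex that has been reached in a face of the
leaf. -/
theorem isExtreme_inter_of_reached (hd : d = 2 ∨ d = 3) (h : IsInitialTriangulation Ω 𝒯₀)
    {I : Mesh d} (hI : IsTree 𝒯₀ I) (hc : Conforming Ω (leaves 𝒯₀ I)) {S S' : TaggedSimplex d}
    (hS : S ∈ leaves 𝒯₀ I) (hS' : Reached 𝒯₀ I S') {z : EuclideanSpace ℝ (Fin d)}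
    (hz : z ∈ S.body) (hz' : z ∈ S'.body) (hzΩ : z ∈ Ω) :
    IsExtreme ℝ S.body (S.body ∩ S'.body) := by
  classical
  -- `𝓕` collects the leaves that miss part of `S ∩ S'`, each with a witness `y A`. For a generic
  -- point of the hull of `z` and the witnesses, a leaf `A` inside `S'` through this point contains
  -- all witnesses. It is thus not in `𝓕`, and `S ∩ S' = S ∩ A`.
  let 𝓕 := (leaves 𝒯₀ I).filter fun A => ∃ y ∈ S.body ∩ S'.body, y ∉ A.body
  have hex : ∀ A, ∃ y, A ∈ 𝓕 → y ∈ S.body ∩ S'.body ∧ y ∉ A.body := fun A => by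
    by_cases hA : A ∈ 𝓕
    · obtain ⟨y, hy⟩ := (Finset.mem_filter.1 hA).2
      exact ⟨y, fun _ => hy⟩
    · exact ⟨z, fun h => absurd h hA⟩
  choose y hy using hex
  have hconv := S.convex_body.inter S'.convex_body
  have hsub : convexHull ℝ ((insert z (𝓕.image y) : Finset _) : Set (EuclideanSpace ℝ (Fin d))) ⊆
      S.body ∩ S'.body := by
    refine convexHull_min (fun v hv => ?_) hconv
    rcases Finset.mem_insert.1 (Finset.mem_coe.1 hv) with rfl | hv
    · exact ⟨hz, hz'⟩
    · obtain ⟨A, hA, rfl⟩ := Finset.mem_image.1 hv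
      exact (hy A hA).1
  obtain ⟨w, hw, hwΩ, hgen⟩ := exists_generic_point h.isOpen (insert z (𝓕.image y))
    (subset_convexHull ℝ _ (by simp)) hzΩ
  obtain ⟨hwS, hwS'⟩ := hsub hw
  obtain ⟨A, hA, hwA, hAS'⟩ := exists_leaf_mem hd h hI hS' hwS'
  have hSA := compat_leaves hd h hI hc hS hA hwS hwA hwΩ
  by_cases hsubA : S.body ∩ S'.body ⊆ A.body
  · have : S.body ∩ S'.body = S.body ∩ A.body :=
      Subset.antisymm (subset_inter inter_subset_left hsubA) (inter_subset_inter_right _ hAS')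
    rw [this]; exact hSA.1
  · have hA𝓕 : A ∈ 𝓕 := Finset.mem_filter.2 ⟨hA, not_subset.1 hsubA⟩
    have := hgen S.body _ S.convex_body hSA.1 (hsub.trans inter_subset_left) ⟨hwS, hwA⟩
      (Finset.mem_coe.2 (Finset.mem_insert_of_mem (Finset.mem_image_of_mem y hA𝓕)))
    exact absurd this.2 (hy A hA𝓕).2

open scoped Classical in
-- A leaf for `I ∩ J` is a leaf for `I` or for `J`, and any other leaf for `I ∩ J` is at least
-- reached in that tree. So the intersection is a face of each of the two leaves, possibly seen in
-- different trees.
theorem conforming_leaves_inter (hd : d = 2 ∨ d = 3) (h : IsInitialTriangulation Ω 𝒯₀)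
    {I J : Mesh d} (hI : IsTree 𝒯₀ I) (hJ : IsTree 𝒯₀ J) (hIc : Conforming Ω (leaves 𝒯₀ I))
    (hJc : Conforming Ω (leaves 𝒯₀ J)) : Conforming Ω (leaves 𝒯₀ (I ∩ J)) := by
  have key : ∀ S ∈ leaves 𝒯₀ (I ∩ J), ∀ S' ∈ leaves 𝒯₀ (I ∩ J), ∀ z ∈ S.body, z ∈ S'.body →
      z ∈ Ω → IsExtreme ℝ S.body (S.body ∩ S'.body) := by
    intro S hS S' hS' z hz hz' hzΩ
    obtain ⟨hr, hn⟩ := mem_leaves.1 hS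
    obtain ⟨hr', -⟩ := mem_leaves.1 hS'
    by_cases hSI : S ∈ I
    · have hSJ : S ∉ J := fun hSJ => hn (Finset.mem_inter.2 ⟨hSI, hSJ⟩)
      exact isExtreme_inter_of_reached hd h hJ hJc
        (mem_leaves.2 ⟨hr.mono Finset.inter_subset_right, hSJ⟩)
        (hr'.mono Finset.inter_subset_right) hz hz' hzΩ
    · exact isExtreme_inter_of_reached hd h hI hIc
        (mem_leaves.2 ⟨hr.mono Finset.inter_subset_left, hSI⟩)
        (hr'.mono Finset.inter_subset_left) hz hz' hzΩ
  rintro S hS S' hS' ⟨z, ⟨hz, hz'⟩, hzΩ⟩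
  refine Compat.inter_eq ⟨key S hS S' hS' z hz hz' hzΩ, ?_⟩
    (((mem_leaves.1 hS).1.isNode (hI.inter hJ)).nondeg hd h)
  rw [inter_comm]
  exact key S' hS' S hS z hz' hz hzΩ

/-- A mesh that has a conforming refinement has a coarsest one. -/
theorem exists_isCompletion (hd : d = 2 ∨ d = 3) (h : IsInitialTriangulation Ω 𝒯₀)
    {I J : Mesh d} (hI : IsTree 𝒯₀ I) (hJ : IsTree 𝒯₀ J) (hIJ : I ⊆ J)
    (hJc : Conforming Ω (leaves 𝒯₀ J)) : ∃ 𝒯', IsCompletion Ω (leaves 𝒯₀ I) 𝒯' := by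
  classical
  -- A competitor `K` of least cardinality is the least one: its intersection with another
  -- competitor is again one, hence equal to `K`.
  have hex : ∃ n, ∃ K, IsTree 𝒯₀ K ∧ I ⊆ K ∧ Conforming Ω (leaves 𝒯₀ K) ∧ K.card = n :=
    ⟨_, J, hJ, hIJ, hJc, rfl⟩
  obtain ⟨K, hK, hIK, hKc, hKn⟩ := Nat.find_spec hex
  refine ⟨leaves 𝒯₀ K, refines_of_subset hd h hI hK hIK, hKc, fun 𝒯'' hr hc => ?_⟩
  obtain ⟨L, hL, hIL, rfl⟩ := exists_isTree_of_refines hd h hI hr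
  have hmin := Nat.find_min' hex ⟨K ∩ L, hK.inter hL, Finset.subset_inter hIK hIL,
    conforming_leaves_inter hd h hK hL hKc hc, rfl⟩
  rw [← hKn] at hmin
  have hKL : K ∩ L = K := Finset.eq_of_subset_of_card_le Finset.inter_subset_left hmin
  exact refines_of_subset hd h hK hL (Finset.inter_eq_left.1 hKL)

/-- A completion stays below every conforming refinement. -/
theorem IsCompletion.exists_isTree (hd : d = 2 ∨ d = 3) (h : IsInitialTriangulation Ω 𝒯₀)
    {I J 𝒯' : Mesh d} (hI : IsTree 𝒯₀ I) (hJ : IsTree 𝒯₀ J) (hIJ : I ⊆ J)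
    (hJc : Conforming Ω (leaves 𝒯₀ J)) (hc : IsCompletion Ω (leaves 𝒯₀ I) 𝒯') :
    ∃ K, IsTree 𝒯₀ K ∧ I ⊆ K ∧ K ⊆ J ∧ 𝒯' = leaves 𝒯₀ K := by
  obtain ⟨K, hK, hIK, rfl⟩ := exists_isTree_of_refines hd h hI hc.refines
  obtain ⟨L, hL, hKL, he⟩ := exists_isTree_of_refines hd h hK
    (hc.least _ (refines_of_subset hd h hI hJ hIJ) hJc)
  exact ⟨K, hK, hIK, hKL.trans (hL.subset_of_leaves_eq he), rfl⟩

theorem card_leaves_le (𝒯₀ I : Mesh d) : (leaves 𝒯₀ I).card ≤ 𝒯₀.card + 2 * I.card := by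
  classical
  refine (Finset.card_le_card Finset.sdiff_subset).trans ((Finset.card_union_le _ _).trans ?_)
  refine Nat.add_le_add_left ?_ _
  rw [mul_comm]
  exact Finset.card_biUnion_le_card_mul _ _ _ fun T _ => Finset.card_le_two

end Bisection

/-! ### Conforming graded meshes and size bounds -/

namespace Bisection

open TaggedSimplex

variable {d : ℕ} {Ω : Set (EuclideanSpace ℝ (Fin d))} {𝒯₀ : Mesh d}

open scoped Classical in
/-- The nodes of generation `g < G` whose new vertex satisfies `Q g`. -/
noncomputable def gradedTree (𝒯₀ : Mesh d) (Q : ℕ → EuclideanSpace ℝ (Fin d) → Prop) (G : ℕ) :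
    Mesh d :=
  (Finset.range G).biUnion fun g => (uniform 𝒯₀ g).filter fun T => Q g T.newVertex

theorem mem_gradedTree {Q : ℕ → EuclideanSpace ℝ (Fin d) → Prop} {G : ℕ} {T : TaggedSimplex d} :
    T ∈ gradedTree 𝒯₀ Q G ↔ ∃ g < G, T ∈ uniform 𝒯₀ g ∧ Q g T.newVertex := by
  classical
  simp [gradedTree]

theorem isTree_gradedTree (hd : d = 2 ∨ d = 3) (h : IsInitialTriangulation Ω 𝒯₀)
    {Q : ℕ → EuclideanSpace ℝ (Fin d) → Prop} {G : ℕ}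
    (hQ : ∀ g k, ∀ S ∈ uniform 𝒯₀ g, ∀ m ∈ S.body, Q (g + (k + 1)) m → Q g S.newVertex) :
    IsTree 𝒯₀ (gradedTree 𝒯₀ Q G) where
  isNode T hT := by
    obtain ⟨g, -, hT, -⟩ := mem_gradedTree.1 hT
    exact ⟨g, hT⟩
  parent_mem T hTn S hST hS := by
    have ht := hTn.type_lt hd h
    obtain ⟨g, hg⟩ := hTn
    obtain ⟨g', hg', hS', hm⟩ := mem_gradedTree.1 hS
    obtain rfl : g + 1 = g' := generation_unique hd h (mem_uniform_succ.2 ⟨T, hg, hST⟩) hS'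
    exact mem_gradedTree.2 ⟨g, by omega, hg, hQ g 0 T hg _
      (body_subset_of_mem_children hd ht hST S.newVertex_mem_body) hm⟩

/-- Compatibility descends from the uniform mesh of generation `g` along the ancestors of `A`, as
long as none of them puts its new vertex on `S`. If one did, `S` would be selected too: in
generation `g` because the refinement edges agree, later because of `hQ`. -/
theorem compat_gradedTree (hd : d = 2 ∨ d = 3) (h : IsInitialTriangulation Ω 𝒯₀)
    {Q : ℕ → EuclideanSpace ℝ (Fin d) → Prop} {G : ℕ}
    (hQ : ∀ g k, ∀ S ∈ uniform 𝒯₀ g, ∀ m ∈ S.body, Q (g + (k + 1)) m → Q g S.newVertex)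
    {g k : ℕ} {S A : TaggedSimplex d} (hS : S ∈ uniform 𝒯₀ g) (hSn : S ∉ gradedTree 𝒯₀ Q G)
    (hA : A ∈ uniform 𝒯₀ (g + k)) (hAr : Reached 𝒯₀ (gradedTree 𝒯₀ Q G) A)
    {z : EuclideanSpace ℝ (Fin d)} (hz : z ∈ S.body) (hz' : z ∈ A.body) (hzΩ : z ∈ Ω) :
    S.Compat A := by
  have hJ := isTree_gradedTree hd h (G := G) hQ
  obtain ⟨hUp, hUc, hUf⟩ := h.uniform hd g
  induction k generalizing A with
  | zero => exact hUc.compat hUp hS hA hz hz' hzΩ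
  | succ k ih =>
    obtain ⟨B, hB, hAB⟩ := mem_uniform_succ.1 hA
    have hBn : IsNode 𝒯₀ B := ⟨_, hB⟩
    have ht := hBn.type_lt hd h
    have hBJ : B ∈ gradedTree 𝒯₀ Q G := by
      rcases hAr with h0 | ⟨T, hT, hAT⟩
      · exact absurd h0 (notMem_of_mem_children hd h hBn hAB)
      · rwa [parent_unique hd h hBn (hJ.isNode T hT) hAB hAT]
    have hzB := body_subset_of_mem_children hd ht hAB hz'
    refine (ih hB (hJ.reached hBJ) hzB).child_of_newVertex_notMem hd (hUp.nondeg S hS)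
      (hBn.nondeg hd h) ht hAB fun hm => hSn ?_
    obtain ⟨g', hg', hB', hQB⟩ := mem_gradedTree.1 hBJ
    obtain rfl : g + k = g' := generation_unique hd h hB hB'
    refine mem_gradedTree.2 ⟨g, by omega, hS, ?_⟩
    cases k with
    | zero =>
      rwa [← newVertex_eq_of_refEdge_eq (refEdge_eq_of_newVertex_mem hd h.isOpen hUp hUc hUf hB hS
        hzB hz hzΩ hm)]
    | succ k => exact hQ g k S hS _ hm hQB

/-- A graded mesh is conforming. -/
theorem conforming_gradedTree (hd : d = 2 ∨ d = 3) (h : IsInitialTriangulation Ω 𝒯₀)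
    {Q : ℕ → EuclideanSpace ℝ (Fin d) → Prop} {G : ℕ}
    (hQ : ∀ g k, ∀ S ∈ uniform 𝒯₀ g, ∀ m ∈ S.body, Q (g + (k + 1)) m → Q g S.newVertex) :
    Conforming Ω (leaves 𝒯₀ (gradedTree 𝒯₀ Q G)) := by
  have hJ := isTree_gradedTree hd h (G := G) hQ
  rintro S hS S' hS' ⟨z, ⟨hz, hz'⟩, hzΩ⟩
  obtain ⟨hr, hn⟩ := mem_leaves.1 hS
  obtain ⟨hr', hn'⟩ := mem_leaves.1 hS'
  have hSn := (hr.isNode hJ).nondeg hd h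
  refine Compat.inter_eq ?_ hSn
  obtain ⟨g, hg⟩ := hr.isNode hJ
  obtain ⟨g', hg'⟩ := hr'.isNode hJ
  rcases le_total g g' with hle | hle
  · obtain ⟨k, rfl⟩ := Nat.exists_eq_add_of_le hle
    exact compat_gradedTree hd h hQ hg hn hg' hr' hz hz' hzΩ
  · obtain ⟨k, rfl⟩ := Nat.exists_eq_add_of_le hle
    exact (compat_gradedTree hd h hQ hg' hn' hg hr hz' hz hzΩ).symm

/-! ### Size of the simplices -/

/-- The factor by which one bisection reduces the size. -/
noncomputable def ratio (d : ℕ) : ℝ := (2 : ℝ) ^ (-(1 / (d : ℝ)))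

theorem ratio_pos (d : ℕ) : 0 < ratio d := Real.rpow_pos_of_pos two_pos _

theorem ratio_lt_one (hd : 0 < d) : ratio d < 1 :=
  Real.rpow_lt_one_of_one_lt_of_neg one_lt_two
    (neg_lt_zero.2 (one_div_pos.2 (by exact_mod_cast hd)))

theorem ratio_pow (hd : 0 < d) : ratio d ^ d = 1 / 2 := by
  have : (d : ℝ) ≠ 0 := by exact_mod_cast hd.ne'
  rw [ratio, ← Real.rpow_natCast, ← Real.rpow_mul two_pos.le, neg_mul, one_div_mul_cancel this,
    Real.rpow_neg_one, one_div]

theorem exists_diam_le (hd : d = 2 ∨ d = 3) (h : IsInitialTriangulation Ω 𝒯₀) :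
    ∃ D : ℝ, 0 < D ∧ ∀ g, ∀ T ∈ uniform 𝒯₀ g, ∀ x ∈ T.body, ∀ y ∈ T.body,
      dist x y ≤ D * ratio d ^ g := by
  obtain ⟨ρ, hρ0, hρd, hρc⟩ := exists_diam_control (d := d) hd
  have hbound : ∀ g, ∀ T ∈ uniform 𝒯₀ g, ρ T ≤ (1 + ∑ A ∈ 𝒯₀, ρ A) * ratio d ^ g := by
    intro g
    induction g with
    | zero =>
      intro T hT
      have := Finset.single_le_sum (fun A _ => hρ0 A) (show T ∈ 𝒯₀ from hT)
      rw [pow_zero, mul_one]; linarith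
    | succ g ih =>
      intro T hT
      obtain ⟨B, hB, hTB⟩ := mem_uniform_succ.1 hT
      refine (hρc B T (IsNode.type_lt hd h ⟨g, hB⟩) hTB).trans ?_
      rw [pow_succ, ← mul_assoc, mul_comm]
      exact mul_le_mul_of_nonneg_right (ih B hB) (ratio_pos d).le
  have hs := Finset.sum_nonneg fun A (_ : A ∈ 𝒯₀) => hρ0 A
  refine ⟨1 + ∑ A ∈ 𝒯₀, ρ A, by linarith, fun g T hT x hx y hy => ?_⟩
  exact (Metric.dist_le_diam_of_mem T.isCompact_body.isBounded hx hy).trans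
    ((hρd T (IsNode.type_lt hd h ⟨g, hT⟩)).trans (hbound g T hT))

theorem card_uniform_le (𝒯₀ : Mesh d) (g : ℕ) : (uniform 𝒯₀ g).card ≤ 2 ^ g * 𝒯₀.card := by
  induction g with
  | zero => simp [uniform_zero]
  | succ g ih =>
    classical
    rw [uniform_succ, bisectAll, pow_succ]
    refine (Finset.card_biUnion_le_card_mul _ _ 2 fun T _ => Finset.card_le_two).trans ?_
    linarith

theorem exists_volume_bounds (hd : d = 2 ∨ d = 3) (h : IsInitialTriangulation Ω 𝒯₀) :
    ∃ v V : ℝ, 0 < v ∧ 0 < V ∧ ∀ g, ∀ T ∈ uniform 𝒯₀ g,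
      v / 2 ^ g ≤ volume.real T.body ∧ volume.real T.body ≤ V / 2 ^ g := by
  have hvol : ∀ g, ∀ T ∈ uniform 𝒯₀ g,
      ∃ A ∈ 𝒯₀, volume.real T.body = volume.real A.body / 2 ^ g := by
    intro g T hT
    rw [← Nat.zero_add g] at hT
    obtain ⟨A, hA, -, hv⟩ := exists_ancestor hd h hT
    refine ⟨A, hA, ?_⟩
    rw [Measure.real, hv, ENNReal.toReal_div]
    simp [Measure.real]
  have hpos : ∀ A ∈ 𝒯₀, 0 < volume.real A.body := fun A hA =>
    ENNReal.toReal_pos ((nondeg_iff_volume_pos A).1 (h.isPartition.nondeg A hA)).ne'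
      A.volume_body_ne_top
  obtain ⟨v, hv, hv'⟩ : ∃ v : ℝ, 0 < v ∧ ∀ A ∈ 𝒯₀, v ≤ volume.real A.body := by
    rcases 𝒯₀.eq_empty_or_nonempty with he | hne
    · exact ⟨1, one_pos, by simp [he]⟩
    · obtain ⟨B, hB, hmin⟩ := 𝒯₀.exists_min_image (fun A => volume.real A.body) hne
      exact ⟨_, hpos B hB, hmin⟩
  refine ⟨v, 1 + ∑ A ∈ 𝒯₀, volume.real A.body, hv,
    add_pos_of_pos_of_nonneg one_pos (Finset.sum_nonneg fun A _ => measureReal_nonneg), ?_⟩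
  intro g T hT
  obtain ⟨A, hA, he⟩ := hvol g T hT
  rw [he]
  constructor
  · exact div_le_div_of_nonneg_right (hv' A hA) (by positivity)
  · refine div_le_div_of_nonneg_right ?_ (by positivity)
    have : volume.real A.body ≤ ∑ A ∈ 𝒯₀, volume.real A.body :=
      Finset.single_le_sum (f := fun A : TaggedSimplex d => volume.real A.body)
        (fun A _ => measureReal_nonneg) hA
    linarith

theorem exists_size_le (hd : d = 2 ∨ d = 3) (h : IsInitialTriangulation Ω 𝒯₀) :
    ∃ H : ℝ, 0 < H ∧ ∀ g, ∀ T ∈ uniform 𝒯₀ g, T.size ≤ H * ratio d ^ g := by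
  obtain ⟨v, V, hv, hV, hb⟩ := exists_volume_bounds hd h
  refine ⟨V ^ (1 / (d : ℝ)), Real.rpow_pos_of_pos hV _, fun g T hT => ?_⟩
  have h1 : T.size ≤ (V / 2 ^ g) ^ (1 / (d : ℝ)) :=
    Real.rpow_le_rpow measureReal_nonneg (hb g T hT).2 (by positivity)
  refine h1.trans (le_of_eq ?_)
  rw [Real.div_rpow hV.le (by positivity), div_eq_mul_inv]
  congr 1
  rw [ratio, ← Real.rpow_natCast, ← Real.rpow_natCast, ← Real.rpow_mul two_pos.le,
    ← Real.rpow_mul two_pos.le, ← Real.rpow_neg two_pos.le]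
  ring_nf

open scoped Classical in
/-- Few simplices of a generation have their new vertex in a given ball. -/
theorem exists_card_near_le (hd : d = 2 ∨ d = 3) (h : IsInitialTriangulation Ω 𝒯₀) {D : ℝ}
    (hD : ∀ g, ∀ T ∈ uniform 𝒯₀ g, ∀ x ∈ T.body, ∀ y ∈ T.body, dist x y ≤ D * ratio d ^ g) :
    ∃ C : ℝ, 0 < C ∧ ∀ g (x : EuclideanSpace ℝ (Fin d)) (R : ℝ), 0 ≤ R + D * ratio d ^ g →
      (((uniform 𝒯₀ g).filter fun T => dist T.newVertex x ≤ R).card : ℝ) ≤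
        C * 2 ^ g * (R + D * ratio d ^ g) ^ d := by
  obtain ⟨v, V, hv, hV, hb⟩ := exists_volume_bounds hd h
  set c := volume.real (Metric.closedBall (0 : EuclideanSpace ℝ (Fin d)) 1) with hc
  have hc0 : 0 ≤ c := measureReal_nonneg
  refine ⟨(c + 1) / v, by positivity, fun g x R hR => ?_⟩
  set F := (uniform 𝒯₀ g).filter fun T => dist T.newVertex x ≤ R with hF
  set r := R + D * ratio d ^ g with hr
  have hU := (h.uniform hd g).1
  -- The bodies overlap in null sets, have volume at least `v / 2^g` each, and fit into the ball
  -- enlarged by one diameter.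
  have hsub : (⋃ T ∈ F, T.body) ⊆ Metric.closedBall x r := by
    refine iUnion₂_subset fun T hT y hy => ?_
    obtain ⟨hT, hTx⟩ := Finset.mem_filter.1 hT
    have := hD g T hT y hy _ T.newVertex_mem_body
    have := dist_triangle y T.newVertex x
    rw [Metric.mem_closedBall]; linarith
  have hball : volume.real (Metric.closedBall x r) = r ^ d * c := by
    rw [Measure.addHaar_real_closedBall' volume x hR]
    simp [hc]
  have hsum : volume.real (⋃ T ∈ F, T.body) = ∑ T ∈ F, volume.real T.body := by
    refine measureReal_biUnion_finset₀ ?_ ?_ ?_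
    · intro T hT T' hT' hne
      exact hU.null_inter T (Finset.mem_filter.1 hT).1 T' (Finset.mem_filter.1 hT').1 hne
    · exact fun T _ => T.isCompact_body.measurableSet.nullMeasurableSet
    · exact fun T _ => T.volume_body_ne_top
  have hle : (F.card : ℝ) * (v / 2 ^ g) ≤ r ^ d * c := by
    rw [← hball]
    refine le_trans ?_ (measureReal_mono hsub
      (isCompact_closedBall x r).measure_lt_top.ne)
    rw [hsum, ← nsmul_eq_mul]
    exact Finset.card_nsmul_le_sum _ _ _ fun T hT => (hb g T (Finset.mem_filter.1 hT).1).1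
  have h2 : (0 : ℝ) < 2 ^ g := by positivity
  have h3 : (F.card : ℝ) ≤ r ^ d * c / (v / 2 ^ g) := by
    rwa [le_div_iff₀ (by positivity)]
  refine h3.trans ?_
  rw [div_div_eq_mul_div, div_mul_eq_mul_div, div_mul_eq_mul_div]
  refine div_le_div_of_nonneg_right ?_ hv.le
  have h4 : 0 ≤ r ^ d * 2 ^ g := by positivity
  nlinarith

end Bisection

/-! ### Cardinality of the graded mesh -/

namespace Bisection

open TaggedSimplex

variable {d : ℕ} {Ω : Set (EuclideanSpace ℝ (Fin d))} {𝒯₀ : Mesh d}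

/-- The bisected simplices of a mesh of size `δ` that is graded towards the points of `s`: a simplex
of generation `g` with new vertex `m`, whose size is at most `H b^g` with `b = 2^{-1/d}`. -/
def GradedCond (s : Set (EuclideanSpace ℝ (Fin d))) (H F a δ : ℝ) (L g : ℕ)
    (m : EuclideanSpace ℝ (Fin d)) : Prop :=
  δ < H * ratio d ^ g ∨ (δ * ratio d ^ (a * L) < H * ratio d ^ g ∧
    ∃ v ∈ s, dist m v ≤ (H * ratio d ^ g / δ) ^ (1 / a) + F * ratio d ^ g)

/-- From generation `g` to the next the margin `F b^g` drops by `F (1 - b) b^g ≥ D b^g`, which pays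
for moving from `m` to the new vertex within `S`. -/
theorem GradedCond.of_mem_body (hd : 0 < d) {s : Set (EuclideanSpace ℝ (Fin d))}
    {H F a δ D : ℝ} {L : ℕ} (hH : 0 < H) (ha : 0 < a) (hδ : 0 < δ) (hF0 : 0 ≤ F)
    (hF : D ≤ F * (1 - ratio d))
    (hD : ∀ g, ∀ T ∈ uniform 𝒯₀ g, ∀ x ∈ T.body, ∀ y ∈ T.body, dist x y ≤ D * ratio d ^ g)
    (g k : ℕ) (S : TaggedSimplex d) (hS : S ∈ uniform 𝒯₀ g) (m : EuclideanSpace ℝ (Fin d))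
    (hm : m ∈ S.body) (h : GradedCond s H F a δ L (g + (k + 1)) m) :
    GradedCond s H F a δ L g S.newVertex := by
  have hb := ratio_pos d
  have hb1 := ratio_lt_one hd
  have hpow : ratio d ^ (g + (k + 1)) ≤ ratio d ^ (g + 1) :=
    pow_le_pow_of_le_one hb.le hb1.le (by omega)
  have hpow' : ratio d ^ (g + 1) ≤ ratio d ^ g := pow_le_pow_of_le_one hb.le hb1.le (by omega)
  have hHle : H * ratio d ^ (g + (k + 1)) ≤ H * ratio d ^ g :=
    mul_le_mul_of_nonneg_left (hpow.trans hpow') hH.le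
  rcases h with h | ⟨h, v, hv, hmv⟩
  · exact Or.inl (h.trans_le hHle)
  · refine Or.inr ⟨h.trans_le hHle, v, hv, ?_⟩
    have h1 : (H * ratio d ^ (g + (k + 1)) / δ) ^ (1 / a) ≤ (H * ratio d ^ g / δ) ^ (1 / a) :=
      Real.rpow_le_rpow (by positivity) (div_le_div_of_nonneg_right hHle hδ.le) (by positivity)
    have h2 := hD g S hS _ S.newVertex_mem_body m hm
    have h3 : F * ratio d ^ (g + (k + 1)) ≤ F * ratio d ^ (g + 1) :=
      mul_le_mul_of_nonneg_left hpow hF0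
    have h4 : D * ratio d ^ g ≤ F * (1 - ratio d) * ratio d ^ g :=
      mul_le_mul_of_nonneg_right hF (by positivity)
    have h5 : F * (1 - ratio d) * ratio d ^ g = F * ratio d ^ g - F * ratio d ^ (g + 1) := by ring
    have := dist_triangle S.newVertex m v
    linarith

/-- Serves to choose the cutoff `G` of `gradedTree` so large that it discards nothing. -/
theorem exists_forall_gradedCond_lt (hd : 0 < d) {s : Set (EuclideanSpace ℝ (Fin d))}
    {H F a δ : ℝ} {L : ℕ} (hH : 0 < H) (ha : 0 < a) (hδ : 0 < δ) :
    ∃ G, ∀ g m, GradedCond s H F a δ L g m → g < G := by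
  have hb := ratio_pos d
  have hb1 := ratio_lt_one hd
  have hle : ratio d ^ (a * L) ≤ 1 := Real.rpow_le_one hb.le hb1.le (by positivity)
  have hpos : 0 < δ * ratio d ^ (a * L) := mul_pos hδ (Real.rpow_pos_of_pos hb _)
  obtain ⟨G, hG⟩ := exists_pow_lt_of_lt_one (div_pos hpos hH) hb1
  refine ⟨G, fun g m h => ?_⟩
  have h1 : δ * ratio d ^ (a * L) < H * ratio d ^ g := by
    rcases h with h | h
    · exact (mul_le_of_le_one_right hδ.le hle).trans_lt h
    · exact h.1
  by_contra hg
  have h2 : ratio d ^ g ≤ ratio d ^ G := pow_le_pow_of_le_one hb.le hb1.le (not_lt.1 hg)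
  rw [lt_div_iff₀ hH] at hG
  nlinarith

theorem two_pow_mul_ratio_pow (hd : 0 < d) (g : ℕ) : (2 : ℝ) ^ g * (ratio d ^ g) ^ d = 1 := by
  rw [← pow_mul, mul_comm g d, pow_mul, ratio_pow hd, ← mul_pow]; norm_num

/-- The number of simplices of one generation in a layer around a point. -/
theorem layer_le (hd : 0 < d) {H a δ B : ℝ} (hH : 0 < H) (ha : 0 < a) (ha1 : a < 1) (hδ : 0 < δ)
    (hB : 0 ≤ B) {g k : ℕ} (hg : H * ratio d ^ g ≤ δ * ratio d ^ k) :
    2 ^ g * ((H * ratio d ^ g / δ) ^ (1 / a) + B * ratio d ^ g) ^ d ≤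
      2 ^ d * (H ^ d * (δ ^ d)⁻¹ * ((ratio d ^ (1 / a - 1)) ^ d) ^ k + B ^ d) := by
  have hb := ratio_pos d
  have h2g := two_pow_mul_ratio_pow hd g
  set q := H * ratio d ^ g / δ with hq
  have hq0 : 0 < q := by positivity
  have hqk : q ≤ ratio d ^ k := by rwa [hq, div_le_iff₀ hδ, mul_comm (ratio d ^ k)]
  have hexp : 0 ≤ 1 / a - 1 := by rw [sub_nonneg, le_div_iff₀ ha]; linarith
  -- One factor `q` absorbs `2^g` by `2^g b^{gd} = 1`; the remaining power `q^{1/a - 1}` decays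
  -- geometrically in `k` because `a < 1`.
  have hsplit : q ^ (1 / a) = q * q ^ (1 / a - 1) := by
    rw [← Real.rpow_one_add' hq0.le (by linarith [one_div_pos.2 ha])]; congr 1; ring
  have h1 : 2 ^ g * (q ^ (1 / a)) ^ d ≤
      H ^ d * (δ ^ d)⁻¹ * ((ratio d ^ (1 / a - 1)) ^ d) ^ k := by
    have h3 : (q ^ (1 / a - 1)) ^ d ≤ ((ratio d ^ (1 / a - 1)) ^ d) ^ k := by
      rw [← pow_mul, mul_comm d k, pow_mul]
      refine pow_le_pow_left₀ (by positivity) ?_ d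
      rw [← Real.rpow_natCast, ← Real.rpow_mul hb.le, mul_comm, Real.rpow_mul hb.le,
        Real.rpow_natCast]
      exact Real.rpow_le_rpow hq0.le hqk hexp
    calc 2 ^ g * (q ^ (1 / a)) ^ d = (2 ^ g * (ratio d ^ g) ^ d) * (H ^ d * (δ ^ d)⁻¹ *
          (q ^ (1 / a - 1)) ^ d) := by
          rw [hsplit, mul_pow, hq, div_pow, mul_pow]; ring
      _ ≤ _ := by
          rw [h2g, one_mul]
          exact mul_le_mul_of_nonneg_left h3 (by positivity)
  have h4 := add_pow_le (Real.rpow_nonneg hq0.le (1 / a)) (by positivity : 0 ≤ B * ratio d ^ g) d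
  have h5 : (2 : ℝ) ^ (d - 1) ≤ 2 ^ d := pow_le_pow_right₀ one_le_two (by omega)
  have h6 : 2 ^ g * (B * ratio d ^ g) ^ d = B ^ d := by
    rw [mul_pow, mul_left_comm, h2g, mul_one]
  have hs : 0 ≤ (q ^ (1 / a)) ^ d + (B * ratio d ^ g) ^ d := by positivity
  calc 2 ^ g * (q ^ (1 / a) + B * ratio d ^ g) ^ d
      ≤ 2 ^ g * (2 ^ d * ((q ^ (1 / a)) ^ d + (B * ratio d ^ g) ^ d)) :=
        mul_le_mul_of_nonneg_left (h4.trans (mul_le_mul_of_nonneg_right h5 hs)) (by positivity)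
    _ = 2 ^ d * (2 ^ g * (q ^ (1 / a)) ^ d + 2 ^ g * (B * ratio d ^ g) ^ d) := by ring
    _ ≤ _ := by
        rw [h6]
        exact mul_le_mul_of_nonneg_left (add_le_add_left h1 _) (by positivity)

/-- With `g₀` the first generation where `H b^g ≤ δ`, the earlier ones have `O(2^{g₀}) = O(δ^{-d})`
members in total. Of the later ones at most `L` occur, each with a term of a geometric series plus a
bounded number of simplices close to the centres. -/
theorem exists_card_gradedTree_le (hd : d = 2 ∨ d = 3) (h : IsInitialTriangulation Ω 𝒯₀)
    (s : Finset (EuclideanSpace ℝ (Fin d))) {H F a D : ℝ} (hH : 0 < H) (ha : 0 < a) (ha1 : a < 1)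
    (hF0 : 0 ≤ F) (hD0 : 0 ≤ D)
    (hD : ∀ g, ∀ T ∈ uniform 𝒯₀ g, ∀ x ∈ T.body, ∀ y ∈ T.body, dist x y ≤ D * ratio d ^ g) :
    ∃ C : ℝ, 0 ≤ C ∧ ∀ (δ : ℝ) (L G : ℕ), 0 < δ → δ ≤ 1 →
      ((gradedTree 𝒯₀ (GradedCond (s : Set (EuclideanSpace ℝ (Fin d))) H F a δ L) G).card : ℝ) ≤
        C * ((δ ^ d)⁻¹ + L) := by
  classical
  have hd0 : 0 < d := by omega
  have hb := ratio_pos d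
  have hb1 := ratio_lt_one hd0
  obtain ⟨C, hC, hnear⟩ := exists_card_near_le hd h hD
  set θ := (ratio d ^ (1 / a - 1)) ^ d with hθ
  have hθ0 : 0 ≤ θ := by positivity
  have hθ1 : θ < 1 := by
    refine pow_lt_one₀ (by positivity) (Real.rpow_lt_one hb.le hb1 ?_) hd0.ne'
    rw [sub_pos, lt_div_iff₀ ha]; linarith
  set B := F + D with hB
  set n := (𝒯₀.card : ℝ) with hn
  refine ⟨n * (1 + 2 * H ^ d) + s.card * C * (2 ^ d * (H ^ d * (1 - θ)⁻¹ + B ^ d)), by positivity,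
    fun δ L G hδ hδ1 => ?_⟩
  set X := (δ ^ d)⁻¹ with hX
  have hX1 : 1 ≤ X := (one_le_inv₀ (by positivity)).2 (pow_le_one₀ hδ.le hδ1)
  have hex : ∃ g, H * ratio d ^ g ≤ δ := by
    obtain ⟨g, hg⟩ := exists_pow_lt_of_lt_one (div_pos hδ hH) hb1
    exact ⟨g, by rw [lt_div_iff₀ hH] at hg; linarith⟩
  set g₀ := Nat.find hex with hg₀
  have hg₀s : H * ratio d ^ g₀ ≤ δ := Nat.find_spec hex
  have hlayer : ∀ k, H * ratio d ^ (g₀ + k) ≤ δ * ratio d ^ k := fun k => by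
    rw [pow_add, ← mul_assoc]; exact mul_le_mul_of_nonneg_right hg₀s (by positivity)
  set Q := GradedCond (s : Set (EuclideanSpace ℝ (Fin d))) H F a δ L with hQ
  let N : ℕ → Mesh d := fun g => (uniform 𝒯₀ g).filter fun T => ∃ v ∈ s,
    dist T.newVertex v ≤ (H * ratio d ^ g / δ) ^ (1 / a) + F * ratio d ^ g
  have hsub : gradedTree 𝒯₀ Q G ⊆ (Finset.range g₀).biUnion (uniform 𝒯₀) ∪
      (Finset.range L).biUnion fun k => N (g₀ + k) := by
    intro T hT
    obtain ⟨g, -, hTg, hq⟩ := mem_gradedTree.1 hT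
    rw [Finset.mem_union, Finset.mem_biUnion, Finset.mem_biUnion]
    by_cases hg : g < g₀
    · exact Or.inl ⟨g, Finset.mem_range.2 hg, hTg⟩
    · obtain ⟨k, rfl⟩ := Nat.exists_eq_add_of_le (not_lt.1 hg)
      have hle := hlayer k
      have hle1 : δ * ratio d ^ k ≤ δ :=
        mul_le_of_le_one_right hδ.le (pow_le_one₀ hb.le hb1.le)
      rcases hq with hq | ⟨hq, hv⟩
      · linarith
      · refine Or.inr ⟨k, Finset.mem_range.2 ?_, Finset.mem_filter.2 ⟨hTg, hv⟩⟩
        -- From layer `L` on the size bound is below the floor `δ b^{aL}`, since `b^k ≤ b^L ≤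
        -- b^{aL}`.
        by_contra hk
        have h1 : ratio d ^ k ≤ ratio d ^ (a * L) := by
          rw [← Real.rpow_natCast]
          refine Real.rpow_le_rpow_of_exponent_ge hb hb1.le ?_
          have : (L : ℝ) ≤ k := by exact_mod_cast not_lt.1 hk
          nlinarith [Nat.cast_nonneg (α := ℝ) L]
        have := mul_le_mul_of_nonneg_left h1 hδ.le
        linarith
  have hcoarse : (((Finset.range g₀).biUnion (uniform 𝒯₀)).card : ℝ) ≤ n * (1 + 2 * H ^ d) * X := by
    have h1 : (((Finset.range g₀).biUnion (uniform 𝒯₀)).card : ℝ) ≤ 2 ^ g₀ * n := by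
      have h2 : ((Finset.range g₀).biUnion (uniform 𝒯₀)).card ≤ 2 ^ g₀ * 𝒯₀.card := by
        refine Finset.card_biUnion_le.trans ((Finset.sum_le_sum fun g _ =>
          card_uniform_le 𝒯₀ g).trans ?_)
        rw [← Finset.sum_mul]
        refine Nat.mul_le_mul_right _ ?_
        exact (Nat.geomSum_lt (le_refl 2) (by simp)).le
      rw [hn]
      exact_mod_cast h2
    have h3 : (2 : ℝ) ^ g₀ ≤ (1 + 2 * H ^ d) * X := by
      have hHX : 0 ≤ H ^ d * X := by positivity
      rcases Nat.eq_zero_or_pos g₀ with h0 | h0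
      · rw [h0, pow_zero]; nlinarith
      · obtain ⟨g, hg⟩ := Nat.exists_eq_succ_of_ne_zero h0.ne'
        have hlt : δ < H * ratio d ^ g :=
          not_le.1 (Nat.find_min hex (m := g) (by omega))
        have h4 : δ ^ d ≤ (H * ratio d ^ g) ^ d := pow_le_pow_left₀ hδ.le hlt.le d
        have h5 : (2 : ℝ) ^ g * δ ^ d ≤ H ^ d := by
          refine (mul_le_mul_of_nonneg_left h4 (by positivity)).trans (le_of_eq ?_)
          rw [mul_pow, mul_left_comm, two_pow_mul_ratio_pow hd0, mul_one]
        have h6 : (2 : ℝ) ^ g ≤ H ^ d * X := by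
          rw [hX, ← div_eq_mul_inv, le_div_iff₀ (by positivity)]; exact h5
        rw [hg, pow_succ]; nlinarith
    calc _ ≤ _ := h1
      _ ≤ ((1 + 2 * H ^ d) * X) * n := mul_le_mul_of_nonneg_right h3 (by positivity)
      _ = _ := by ring
  have hfine : ((((Finset.range L).biUnion fun k => N (g₀ + k)).card : ℕ) : ℝ) ≤
      s.card * C * (2 ^ d * (H ^ d * X * (1 - θ)⁻¹ + B ^ d * L)) := by
    have hone : ∀ k, ((N (g₀ + k)).card : ℝ) ≤
        s.card * C * (2 ^ d * (H ^ d * X * θ ^ k + B ^ d)) := by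
      intro k
      set R := (H * ratio d ^ (g₀ + k) / δ) ^ (1 / a) + F * ratio d ^ (g₀ + k) with hR
      have hN : N (g₀ + k) ⊆ s.biUnion fun v =>
          (uniform 𝒯₀ (g₀ + k)).filter fun T => dist T.newVertex v ≤ R := by
        intro T hT
        obtain ⟨hT, v, hv, hTv⟩ := Finset.mem_filter.1 hT
        exact Finset.mem_biUnion.2 ⟨v, hv, Finset.mem_filter.2 ⟨hT, hTv⟩⟩
      have h1 : ((N (g₀ + k)).card : ℝ) ≤ ∑ v ∈ s,
          (((uniform 𝒯₀ (g₀ + k)).filter fun T => dist T.newVertex v ≤ R).card : ℝ) := by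
        exact_mod_cast (Finset.card_le_card hN).trans Finset.card_biUnion_le
      refine h1.trans ((Finset.sum_le_sum fun v _ => hnear (g₀ + k) v R (by positivity)).trans ?_)
      have hRB : R + D * ratio d ^ (g₀ + k) =
          (H * ratio d ^ (g₀ + k) / δ) ^ (1 / a) + B * ratio d ^ (g₀ + k) := by
        rw [hR, hB]; ring
      rw [Finset.sum_const, nsmul_eq_mul, hRB]
      have hl := mul_le_mul_of_nonneg_left
        (layer_le hd0 hH ha ha1 hδ (B := B) (by positivity) (hlayer k))
        (by positivity : 0 ≤ s.card * C)
      exact le_of_eq_of_le (by ring) hl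
    have h2 : ((((Finset.range L).biUnion fun k => N (g₀ + k)).card : ℕ) : ℝ) ≤
        ∑ k ∈ Finset.range L, ((N (g₀ + k)).card : ℝ) := by
      exact_mod_cast Finset.card_biUnion_le
    refine h2.trans ((Finset.sum_le_sum fun k _ => hone k).trans ?_)
    rw [← Finset.mul_sum, ← Finset.mul_sum, Finset.sum_add_distrib, ← Finset.mul_sum,
      Finset.sum_const, Finset.card_range, nsmul_eq_mul, mul_comm (L : ℝ)]
    have hgeom : ∑ k ∈ Finset.range L, θ ^ k ≤ (1 - θ)⁻¹ := by
      rw [← tsum_geometric_of_lt_one hθ0 hθ1]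
      exact (summable_geometric_of_lt_one hθ0 hθ1).sum_le_tsum _ fun k _ => by positivity
    gcongr
  have hcard : ((gradedTree 𝒯₀ Q G).card : ℝ) ≤ n * (1 + 2 * H ^ d) * X +
      s.card * C * (2 ^ d * (H ^ d * X * (1 - θ)⁻¹ + B ^ d * L)) := by
    refine le_trans ?_ (add_le_add hcoarse hfine)
    exact_mod_cast (Finset.card_le_card hsub).trans (Finset.card_union_le _ _)
  refine hcard.trans ?_
  have hθi : 0 ≤ (1 - θ)⁻¹ := inv_nonneg.2 (by linarith)
  have hL : (0 : ℝ) ≤ L := Nat.cast_nonneg L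
  have e1 : 0 ≤ n * (1 + 2 * H ^ d) * L := by positivity
  have e2 : 0 ≤ s.card * C * (2 ^ d * (H ^ d * (1 - θ)⁻¹ * L + B ^ d * X)) := by positivity
  linarith

end Bisection

namespace Bisection

open TaggedSimplex

variable {d : ℕ} {Ω : Set (EuclideanSpace ℝ (Fin d))} {𝒯₀ : Mesh d}

/-! ### Runs of the algorithm -/

/-- `𝒯` arises from `𝒯₀` by the bisection of members of `J` only. -/
def Below (𝒯₀ J 𝒯 : Mesh d) : Prop := ∃ I, IsTree 𝒯₀ I ∧ I ⊆ J ∧ 𝒯 = leaves 𝒯₀ I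

theorem exists_completion_of_marked (hd : d = 2 ∨ d = 3) (h : IsInitialTriangulation Ω 𝒯₀)
    {J 𝒯 ℳ : Mesh d} (hJ : IsTree 𝒯₀ J) (hJc : Conforming Ω (leaves 𝒯₀ J))
    (h𝒯 : Below 𝒯₀ J 𝒯) (hℳ : ℳ ⊆ 𝒯) (hℳJ : ℳ ⊆ J) :
    ∃ 𝒯', IsCompletion Ω (refine 𝒯 ℳ) 𝒯' := by
  classical
  obtain ⟨I, hI, hIJ, rfl⟩ := h𝒯
  rw [refine_leaves hd h hI hℳ]
  exact exists_isCompletion hd h (hI.union hd h fun T hT => (mem_leaves.1 (hℳ hT)).1) hJ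
    (Finset.union_subset hIJ hℳJ) hJc

/-- Marked simplices are leaves, hence new to the tree; the resulting inequality of cardinalities is
what makes the first loop terminate. -/
theorem exists_isTree_of_isCompletion (hd : d = 2 ∨ d = 3) (h : IsInitialTriangulation Ω 𝒯₀)
    {J I ℳ 𝒯' : Mesh d} (hJ : IsTree 𝒯₀ J) (hJc : Conforming Ω (leaves 𝒯₀ J))
    (hI : IsTree 𝒯₀ I) (hIJ : I ⊆ J) (hℳ : ℳ ⊆ leaves 𝒯₀ I) (hℳJ : ℳ ⊆ J)
    (hc : IsCompletion Ω (refine (leaves 𝒯₀ I) ℳ) 𝒯') :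
    ∃ K, IsTree 𝒯₀ K ∧ K ⊆ J ∧ 𝒯' = leaves 𝒯₀ K ∧ I.card + ℳ.card ≤ K.card := by
  classical
  rw [refine_leaves hd h hI hℳ] at hc
  obtain ⟨K, hK, hIK, hKJ, he⟩ := hc.exists_isTree hd h
    (hI.union hd h fun T hT => (mem_leaves.1 (hℳ hT)).1) hJ (Finset.union_subset hIJ hℳJ) hJc
  refine ⟨K, hK, hKJ, he, ?_⟩
  rw [← Finset.card_union_of_disjoint]
  · exact Finset.card_le_card hIK
  · exact Finset.disjoint_right.2 fun T hT => (mem_leaves.1 (hℳ hT)).2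

theorem Below.of_isCompletion (hd : d = 2 ∨ d = 3) (h : IsInitialTriangulation Ω 𝒯₀)
    {J 𝒯 ℳ 𝒯' : Mesh d} (hJ : IsTree 𝒯₀ J) (hJc : Conforming Ω (leaves 𝒯₀ J))
    (h𝒯 : Below 𝒯₀ J 𝒯) (hℳ : ℳ ⊆ 𝒯) (hℳJ : ℳ ⊆ J)
    (hc : IsCompletion Ω (refine 𝒯 ℳ) 𝒯') : Below 𝒯₀ J 𝒯' := by
  obtain ⟨I, hI, hIJ, rfl⟩ := h𝒯
  obtain ⟨K, hK, hKJ, he, -⟩ := exists_isTree_of_isCompletion hd h hJ hJc hI hIJ hℳ hℳJ hc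
  exact ⟨K, hK, hKJ, he⟩

theorem below_initial {J : Mesh d} : Below 𝒯₀ J 𝒯₀ :=
  ⟨∅, isTree_empty 𝒯₀, Finset.empty_subset _, (leaves_empty 𝒯₀).symm⟩

open scoped Classical in
/-- A completion of `refine 𝒯 ℳ`, if there is one. -/
noncomputable def nextMesh (Ω : Set (EuclideanSpace ℝ (Fin d))) (𝒯 ℳ : Mesh d) : Mesh d :=
  -- The default `𝒯` never matters: for meshes below `J`, `exists_completion_of_marked` applies.
  if h : ∃ 𝒯', IsCompletion Ω (refine 𝒯 ℳ) 𝒯' then h.choose else 𝒯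

theorem isCompletion_nextMesh {𝒯 ℳ : Mesh d} (h : ∃ 𝒯', IsCompletion Ω (refine 𝒯 ℳ) 𝒯') :
    IsCompletion Ω (refine 𝒯 ℳ) (nextMesh Ω 𝒯 ℳ) := by
  rw [nextMesh, dif_pos h]; exact h.choose_spec

theorem firstMarked_subset (δ : ℝ) (𝒯 : Mesh d) : firstMarked δ 𝒯 ⊆ 𝒯 := by
  classical
  exact Finset.filter_subset _ _

theorem secondMarked_subset {N : ℕ} (x : Fin N → EuclideanSpace ℝ (Fin d)) (γ : ℝ) (p : ℕ)
    (δ : ℝ) (ℓ : ℕ) (𝒯 : Mesh d) : secondMarked x γ p δ ℓ 𝒯 ⊆ 𝒯 := by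
  classical
  exact Finset.filter_subset _ _

section

variable {N : ℕ} {x : Fin N → EuclideanSpace ℝ (Fin d)} {γ δ : ℝ} {p K : ℕ} {J : Mesh d}

theorem nonempty_run (hd : d = 2 ∨ d = 3) (h : IsInitialTriangulation Ω 𝒯₀) (hJ : IsTree 𝒯₀ J)
    (hJc : Conforming Ω (leaves 𝒯₀ J)) (h1 : ∀ 𝒯, Below 𝒯₀ J 𝒯 → firstMarked δ 𝒯 ⊆ J)
    (h2 : ∀ 𝒯 ℓ, Below 𝒯₀ J 𝒯 → ℓ < d * (K + 1) → secondMarked x γ p δ ℓ 𝒯 ⊆ J) :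
    Nonempty (Run Ω 𝒯₀ x γ p δ K) := by
  classical
  let first : ℕ → Mesh d := fun n => n.rec 𝒯₀ fun _ 𝒯 => nextMesh Ω 𝒯 (firstMarked δ 𝒯)
  have hcomp1 : ∀ 𝒯, Below 𝒯₀ J 𝒯 →
      IsCompletion Ω (refine 𝒯 (firstMarked δ 𝒯)) (nextMesh Ω 𝒯 (firstMarked δ 𝒯)) :=
    fun 𝒯 h𝒯 => isCompletion_nextMesh
      (exists_completion_of_marked hd h hJ hJc h𝒯 (firstMarked_subset δ 𝒯) (h1 𝒯 h𝒯))
  have hfirst : ∀ n, Below 𝒯₀ J (first n) := by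
    intro n
    induction n with
    | zero => exact below_initial
    | succ n ih =>
      exact ih.of_isCompletion hd h hJ hJc (firstMarked_subset δ _) (h1 _ ih) (hcomp1 _ ih)
  -- Each pass with a nonempty marking strictly enlarges a tree inside `J`, so there are at most
  -- `J.card` of them.
  have hnone : ∃ n, firstMarked δ (first n) = ∅ := by
    by_contra! hne
    have hgrow : ∀ n, ∃ I, IsTree 𝒯₀ I ∧ I ⊆ J ∧ first n = leaves 𝒯₀ I ∧ n ≤ I.card := by
      intro n
      induction n with
      | zero => exact ⟨∅, isTree_empty 𝒯₀, Finset.empty_subset _, (leaves_empty 𝒯₀).symm, le_rfl⟩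
      | succ n ih =>
        obtain ⟨I, hI, hIJ, he, hn⟩ := ih
        have hc := hcomp1 _ (hfirst n)
        have hs := firstMarked_subset δ (first n)
        have hsJ := h1 _ (hfirst n)
        have hpos := (Finset.nonempty_iff_ne_empty.2 (hne n).ne_empty).card_pos
        change IsCompletion Ω _ (first (n + 1)) at hc
        rw [he] at hc hs hsJ hpos
        obtain ⟨K, hK, hKJ, heK, hcard⟩ :=
          exists_isTree_of_isCompletion hd h hJ hJc hI hIJ hs hsJ hc
        exact ⟨K, hK, hKJ, heK, by omega⟩
    obtain ⟨I, -, hIJ, -, hn⟩ := hgrow (J.card + 1)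
    have := Finset.card_le_card hIJ
    omega
  -- This recursion starts at `0` but the loop at `ℓ = 1`; hence `n + 1` in the marking and `ℓ - 1`
  -- in the run.
  let second : ℕ → Mesh d := fun n => n.rec (first (Nat.find hnone + 1))
    fun n 𝒯 => nextMesh Ω 𝒯 (secondMarked x γ p δ (n + 1) 𝒯)
  have hcomp2 : ∀ ℓ 𝒯, Below 𝒯₀ J 𝒯 → ℓ < d * (K + 1) →
      IsCompletion Ω (refine 𝒯 (secondMarked x γ p δ ℓ 𝒯))
        (nextMesh Ω 𝒯 (secondMarked x γ p δ ℓ 𝒯)) :=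
    fun ℓ 𝒯 h𝒯 hℓ => isCompletion_nextMesh (exists_completion_of_marked hd h hJ hJc h𝒯
      (secondMarked_subset x γ p δ ℓ 𝒯) (h2 𝒯 ℓ h𝒯 hℓ))
  have hsecond : ∀ n, n < d * (K + 1) → Below 𝒯₀ J (second n) := by
    intro n
    induction n with
    | zero => exact fun _ => hfirst (Nat.find hnone + 1)
    | succ n ih =>
      intro hn
      have ih := ih (by omega)
      exact ih.of_isCompletion hd h hJ hJc (secondMarked_subset x γ p δ _ _) (h2 _ _ ih hn)
        (hcomp2 _ _ ih hn)
  refine ⟨{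
    first := first
    lastStep := Nat.find hnone
    second := fun ℓ => second (ℓ - 1)
    first_zero := rfl
    first_step := fun j _ => hcomp1 _ (hfirst j)
    first_continue := fun j hj => Nat.find_min hnone hj
    first_stop := Nat.find_spec hnone
    second_one := rfl
    second_step := fun ℓ hℓ hlt => ?_ }⟩
  obtain ⟨n, rfl⟩ := Nat.exists_eq_add_of_le' hℓ
  exact hcomp2 _ _ (hsecond n (by omega)) hlt

theorem Run.below_output (hd : d = 2 ∨ d = 3) (h : IsInitialTriangulation Ω 𝒯₀)
    (hJ : IsTree 𝒯₀ J) (hJc : Conforming Ω (leaves 𝒯₀ J))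
    (h1 : ∀ 𝒯, Below 𝒯₀ J 𝒯 → firstMarked δ 𝒯 ⊆ J)
    (h2 : ∀ 𝒯 ℓ, Below 𝒯₀ J 𝒯 → ℓ < d * (K + 1) → secondMarked x γ p δ ℓ 𝒯 ⊆ J)
    (R : Run Ω 𝒯₀ x γ p δ K) : Below 𝒯₀ J R.output := by
  have hfirst : ∀ n, n ≤ R.lastStep + 1 → Below 𝒯₀ J (R.first n) := by
    intro n
    induction n with
    | zero => intro _; rw [R.first_zero]; exact below_initial
    | succ n ih =>
      intro hn
      have ih := ih (by omega)
      exact ih.of_isCompletion hd h hJ hJc (firstMarked_subset δ _) (h1 _ ih)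
        (R.first_step n (by omega))
  have hsecond : ∀ n, n + 1 ≤ d * (K + 1) → Below 𝒯₀ J (R.second (n + 1)) := by
    intro n
    induction n with
    | zero => intro _; rw [R.second_one]; exact hfirst _ le_rfl
    | succ n ih =>
      intro hn
      have ih := ih (by omega)
      exact ih.of_isCompletion hd h hJ hJc (secondMarked_subset x γ p δ _ _)
        (h2 _ _ ih (by omega)) (R.second_step _ (by omega) (by omega))
  have hpos : 0 < d * (K + 1) := Nat.mul_pos (by omega) (by omega)
  obtain ⟨n, hn⟩ := Nat.exists_eq_succ_of_ne_zero hpos.ne'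
  rw [Run.output, hn]
  exact hsecond n hn.ge

/-- A simplex inside the near region is itself near. -/
theorem distTo_le_of_subset_nearRegion (hd : d = 2 ∨ d = 3) (h : IsInitialTriangulation Ω 𝒯₀)
    {I : Mesh d} (hI : IsTree 𝒯₀ I) {T : TaggedSimplex d} (hT : T ∈ leaves 𝒯₀ I) {ℓ : ℕ}
    (hsub : T.body ⊆ nearRegion x ℓ (leaves 𝒯₀ I)) :
    T.distTo x ≤ (2 : ℝ) ^ (-(ℓ : ℝ) / d) := by
  by_contra hlt
  have hn := ((mem_leaves.1 hT).1.isNode hI).nondeg hd h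
  -- If `T` were not near, it would be covered by its overlaps with other leaves, which are finitely
  -- many null sets.
  refine ((nondeg_iff_volume_pos T).1 hn).ne' ?_
  have hcov : T.body ⊆ ⋃ S ∈ {S | S ∈ leaves 𝒯₀ I ∧ S.distTo x ≤ (2 : ℝ) ^ (-(ℓ : ℝ) / d)},
      T.body ∩ S.body := fun y hy => by
    have := hsub hy
    simp only [nearRegion, mem_iUnion] at this ⊢
    obtain ⟨S, hS, hyS⟩ := this
    exact ⟨S, hS, hy, hyS⟩
  refine measure_mono_null hcov ((measure_biUnion_null_iff
    ((leaves 𝒯₀ I).finite_toSet.subset fun S hS => hS.1).countable).2 fun S hS => ?_)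
  exact null_inter_leaves hd h hI hT hS.1 (by rintro rfl; exact hlt hS.2)

theorem exists_dist_le_of_distTo_le (hN : 0 < N) {T : TaggedSimplex d} {r : ℝ}
    (hr : T.distTo x ≤ r) : ∃ i, ∃ y ∈ T.body, dist y (x i) ≤ r := by
  have : Nonempty (Fin N) := ⟨⟨0, hN⟩⟩
  obtain ⟨i, hi⟩ := exists_eq_ciInf_of_finite (f := fun i => Metric.infDist (x i) T.body)
  have hne : T.body.Nonempty := ⟨_, T.verts_subset_body (T.vtx_mem_verts 0)⟩
  obtain ⟨y, hy, hd⟩ := T.isCompact_body.exists_infDist_eq_dist hne (x i)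
  refine ⟨i, y, hy, ?_⟩
  rw [dist_comm, ← hd, hi]
  exact hr

end

/-! ### Marked simplices satisfy the grading condition -/

theorem ratio_rpow (d : ℕ) (t : ℝ) : ratio d ^ t = (2 : ℝ) ^ (-(t / d)) := by
  rw [ratio, ← Real.rpow_mul two_pos.le]; congr 1; ring

/-- The grading exponent of the algorithm, kept away from `0`. -/
noncomputable def gradingExponent (d : ℕ) (γ : ℝ) (p : ℕ) : ℝ :=
  -- For `γ ≥ p + 1` the algorithm's own exponent is not positive and `1 / a` would be useless.
  -- Raising the exponent only lowers the size threshold, so no marked simplex is lost.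
  max (1 / 2) (2 * (p + 1 - γ) / (2 * p + d))

theorem gradingExponent_pos (d : ℕ) (γ : ℝ) (p : ℕ) : 0 < gradingExponent d γ p :=
  lt_max_of_lt_left (by norm_num)

/-- For the algorithm's own exponent this is `2γ + d - 2 > 0`. -/
theorem gradingExponent_lt_one (hd : 2 ≤ d) {γ : ℝ} (hγ : 0 < γ) (p : ℕ) :
    gradingExponent d γ p < 1 := by
  have : (2 : ℝ) ≤ d := by exact_mod_cast hd
  have hp : (0 : ℝ) ≤ p := Nat.cast_nonneg p
  refine max_lt (by norm_num) ?_
  rw [div_lt_one (by positivity)]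
  linarith

theorem threshold_ge (hd : 2 ≤ d) (γ : ℝ) (p ℓ : ℕ) :
    ratio d ^ (gradingExponent d γ p * ℓ) ≤
      (2 : ℝ) ^ (2 * ℓ * (γ - p - 1) / (d * (2 * p + d))) := by
  have hd' : (0 : ℝ) < d := by exact_mod_cast (by omega : 0 < d)
  have hp : (0 : ℝ) ≤ p := Nat.cast_nonneg p
  have hq : (0 : ℝ) < 2 * p + d := by positivity
  rw [ratio_rpow]
  refine Real.rpow_le_rpow_of_exponent_le one_le_two ?_
  have h1 : 2 * (p + 1 - γ) / (2 * p + d) ≤ gradingExponent d γ p := le_max_right _ _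
  have h2 : 2 * (p + 1 - γ) / (2 * p + d) * (ℓ / d) ≤ gradingExponent d γ p * (ℓ / d) :=
    mul_le_mul_of_nonneg_right h1 (by positivity)
  have h3 : 2 * (ℓ : ℝ) * (γ - p - 1) / (d * (2 * p + d)) =
      -(2 * (p + 1 - γ) / (2 * p + d) * (ℓ / d)) := by
    field_simp; ring
  rw [h3, mul_div_assoc]
  linarith

/-- Everything that the second loop marks belongs to the graded mesh. -/
theorem gradedCond_of_mem_secondMarked (hd : d = 2 ∨ d = 3) (h : IsInitialTriangulation Ω 𝒯₀)
    {N : ℕ} {x : Fin N → EuclideanSpace ℝ (Fin d)} {γ δ H D F : ℝ} {p ℓ L g : ℕ} (hN : 0 < N)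
    {s : Set (EuclideanSpace ℝ (Fin d))} (hx : ∀ i, x i ∈ s) (hδ : 0 < δ) (hDF : D ≤ F)
    (hH : ∀ g, ∀ T ∈ uniform 𝒯₀ g, T.size ≤ H * ratio d ^ g)
    (hD : ∀ g, ∀ T ∈ uniform 𝒯₀ g, ∀ x ∈ T.body, ∀ y ∈ T.body, dist x y ≤ D * ratio d ^ g)
    {I : Mesh d} (hI : IsTree 𝒯₀ I) (hℓ : ℓ < L) {T : TaggedSimplex d}
    (hT : T ∈ secondMarked x γ p δ ℓ (leaves 𝒯₀ I)) (hg : T ∈ uniform 𝒯₀ g) :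
    GradedCond s H F (gradingExponent d γ p) δ L g T.newVertex := by
  classical
  have hd2 : 2 ≤ d := by omega
  have hb := ratio_pos d
  have hb1 := ratio_lt_one (d := d) (by omega)
  set a := gradingExponent d γ p with ha
  have ha0 : 0 < a := gradingExponent_pos d γ p
  obtain ⟨hTl, hsub, hsize⟩ := Finset.mem_filter.1 hT
  have hlt : δ * ratio d ^ (a * ℓ) < H * ratio d ^ g :=
    (mul_le_mul_of_nonneg_left (threshold_ge hd2 γ p ℓ) hδ.le).trans_lt
      (hsize.trans_le (hH g T hg))
  have hL : ratio d ^ (a * L) ≤ ratio d ^ (a * ℓ) := by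
    refine Real.rpow_le_rpow_of_exponent_ge hb hb1.le ?_
    have : (ℓ : ℝ) ≤ L := by exact_mod_cast hℓ.le
    exact mul_le_mul_of_nonneg_left this ha0.le
  refine Or.inr ⟨(mul_le_mul_of_nonneg_left hL hδ.le).trans_lt hlt, ?_⟩
  obtain ⟨i, y, hy, hyi⟩ := exists_dist_le_of_distTo_le hN
    (distTo_le_of_subset_nearRegion hd h hI hTl hsub)
  refine ⟨x i, hx i, ?_⟩
  -- Here `ℓ` is eliminated: `δ b^{aℓ} < H b^g` bounds the radius `b^ℓ` in terms of `g` alone.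
  have h1 : (2 : ℝ) ^ (-(ℓ : ℝ) / d) ≤ (H * ratio d ^ g / δ) ^ (1 / a) := by
    have h2 : ratio d ^ (a * ℓ) ≤ H * ratio d ^ g / δ := by
      rw [le_div_iff₀ hδ, mul_comm]; exact hlt.le
    have h3 := Real.rpow_le_rpow (Real.rpow_nonneg hb.le _) h2 (one_div_nonneg.2 ha0.le)
    rw [← Real.rpow_mul hb.le, show a * (ℓ : ℝ) * (1 / a) = ℓ by field_simp, ratio_rpow] at h3
    rwa [neg_div]
  have h4 := hD g T hg _ T.newVertex_mem_body y hy
  have h5 : D * ratio d ^ g ≤ F * ratio d ^ g := mul_le_mul_of_nonneg_right hDF (by positivity)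
  have := dist_triangle T.newVertex y (x i)
  linarith

/-- The number of passes of the second loop is controlled by `δ`. -/
theorem steps_le (hd : 2 ≤ d) {γ δ : ℝ} (hγ : 0 < γ) (p K : ℕ) (hδ : 0 < δ) (hδ1 : δ ≤ 1)
    (hK : δ < (2 : ℝ) ^ (-(K * (2 * γ + d - 2) / (2 * p + d)))) :
    (K : ℝ) ≤ 2 / ((2 * γ + d - 2) / (2 * p + d)) * (δ ^ d)⁻¹ := by
  have hd' : (2 : ℝ) ≤ d := by exact_mod_cast hd
  have hp : (0 : ℝ) ≤ p := Nat.cast_nonneg p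
  set κ := (2 * γ + d - 2) / (2 * p + d) with hκ
  have hκ0 : 0 < κ := div_pos (by linarith) (by positivity)
  rw [mul_div_assoc, ← hκ, Real.rpow_neg two_pos.le, lt_inv_comm₀ hδ (by positivity)] at hK
  have h1 : δ⁻¹ ≤ (δ ^ d)⁻¹ :=
    inv_anti₀ (by positivity) (pow_le_of_le_one hδ.le hδ1 (by omega))
  -- An exponential dominates its linearisation, and `log 2 ≥ 1/2`; thus `K` grows at most like
  -- `δ⁻¹`.
  have h2 : 1 + K * κ / 2 ≤ (2 : ℝ) ^ (K * κ) := by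
    rw [Real.rpow_def_of_pos two_pos]
    have h3 := Real.add_one_le_exp (Real.log 2 * (K * κ))
    have h4 : (1 / 2 : ℝ) ≤ Real.log 2 := by linarith [Real.log_two_gt_d9]
    have h5 := mul_le_mul_of_nonneg_right h4 (by positivity : 0 ≤ K * κ)
    linarith
  have h6 : (K : ℝ) * κ ≤ 2 * (δ ^ d)⁻¹ := by linarith
  rw [div_mul_eq_mul_div, le_div_iff₀ hκ0]
  exact h6

end Bisection

/-! ### The complexity bound -/

theorem mainTheorem5 (d : ℕ) (hd : d = 2 ∨ d = 3)
    (Ω : Set (EuclideanSpace ℝ (Fin d))) (𝒯₀ : Bisection.Mesh d)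
    (h𝒯₀ : Bisection.IsInitialTriangulation Ω 𝒯₀)
    (p : ℕ) (hp : 1 ≤ p) (γ : ℝ) (hγ : 0 < γ) :
    ∃ C₃ : ℝ, ∀ (N : ℕ) (x : Fin N → EuclideanSpace ℝ (Fin d)) (γs : Fin N → ℝ),
      (∀ i, ∃ T ∈ 𝒯₀, x i ∈ T.verts) → (∀ i, 0 < γs i) → IsLeast (Set.range γs) (2 * γ) →
      ∀ (δ : ℝ) (K : ℕ), 0 < δ → (𝒯₀.card : ℝ) ≤ δ ^ (-(d : ℤ)) →
        (2 : ℝ) ^ (-((K + 1) * (2 * γ + d - 2) / (2 * p + d))) ≤ δ →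
        δ < (2 : ℝ) ^ (-(K * (2 * γ + d - 2) / (2 * p + d))) →
        Nonempty (Bisection.Run Ω 𝒯₀ x γ p δ K) ∧
        ∀ R : Bisection.Run Ω 𝒯₀ x γ p δ K,
          (R.output.card : ℝ) - 𝒯₀.card ≤ C₃ * δ ^ (-(d : ℤ)) := by
  open Bisection Bisection.TaggedSimplex in
  classical
  have hd2 : 2 ≤ d := by omega
  obtain ⟨D, hD0, hD⟩ := exists_diam_le hd h𝒯₀
  obtain ⟨H, hH0, hH⟩ := exists_size_le hd h𝒯₀
  have hb := ratio_pos d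
  have hb1 := ratio_lt_one (d := d) (by omega)
  set a := gradingExponent d γ p with ha
  have ha0 : 0 < a := gradingExponent_pos d γ p
  have ha1 : a < 1 := gradingExponent_lt_one hd2 hγ p
  obtain ⟨F, hF0, hF, hDF⟩ : ∃ F : ℝ, 0 ≤ F ∧ D ≤ F * (1 - ratio d) ∧ D ≤ F := by
    have h1 : 0 < 1 - ratio d := by linarith
    refine ⟨D / (1 - ratio d), by positivity, by rw [div_mul_cancel₀ _ h1.ne'], ?_⟩
    rw [le_div_iff₀ h1]
    nlinarith
  -- Taking every vertex of `𝒯₀` as a possible singular point keeps the constant independent of `N`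
  -- and `x`.
  let s : Finset (EuclideanSpace ℝ (Fin d)) := 𝒯₀.biUnion fun T => Finset.univ.image T.vtx
  obtain ⟨C, hC0, hC⟩ := exists_card_gradedTree_le hd h𝒯₀ s hH0 ha0 ha1 hF0 hD0.le hD
  set κ := (2 * γ + d - 2) / (2 * p + d) with hκ
  -- The factor `2` counts the children of a bisected simplex; the rest is `δ^{-d} + L` with `L = d
  -- (K + 1) ≤ d (2/κ + 1) δ^{-d}`.
  refine ⟨2 * (C * (1 + d * (2 / κ + 1))), fun N x γs hx _ hleast δ K hδ hcard _ hK => ?_⟩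
  have hN : 0 < N := by
    obtain ⟨i, -⟩ := hleast.1
    exact i.pos
  have hxs : ∀ i, x i ∈ (s : Set (EuclideanSpace ℝ (Fin d))) := by
    intro i
    obtain ⟨T, hT, j, hj⟩ := hx i
    exact Finset.mem_coe.2 (Finset.mem_biUnion.2
      ⟨T, hT, Finset.mem_image.2 ⟨j, Finset.mem_univ _, hj⟩⟩)
  have hX : δ ^ (-(d : ℤ)) = (δ ^ d)⁻¹ := by rw [zpow_neg, zpow_natCast]
  rw [hX] at hcard ⊢
  have hcard1 : (1 : ℝ) ≤ 𝒯₀.card := by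
    obtain ⟨i, -⟩ := hleast.1
    obtain ⟨T, hT, -⟩ := hx i
    exact_mod_cast Finset.card_pos.2 ⟨T, hT⟩
  have hX1 : 1 ≤ (δ ^ d)⁻¹ := hcard1.trans hcard
  have hδ1 : δ ≤ 1 := by
    by_contra hlt
    have h1 := one_lt_pow₀ (not_le.1 hlt) (by omega : d ≠ 0)
    exact absurd hX1 (not_le.2 (inv_lt_one_of_one_lt₀ h1))
  obtain ⟨G, hG⟩ := exists_forall_gradedCond_lt (d := d)
    (s := (s : Set (EuclideanSpace ℝ (Fin d)))) (F := F) (L := d * (K + 1)) (by omega) hH0 ha0 hδ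
  set Q := GradedCond (s : Set (EuclideanSpace ℝ (Fin d))) H F a δ (d * (K + 1)) with hQ
  have hQc := GradedCond.of_mem_body (L := d * (K + 1)) (by omega)
    (s := (s : Set (EuclideanSpace ℝ (Fin d)))) hH0 ha0 hδ hF0 hF hD
  have hJ := isTree_gradedTree hd h𝒯₀ (G := G) hQc
  have hJc := conforming_gradedTree hd h𝒯₀ (G := G) hQc
  have h1 : ∀ 𝒯, Below 𝒯₀ (gradedTree 𝒯₀ Q G) 𝒯 → firstMarked δ 𝒯 ⊆ gradedTree 𝒯₀ Q G := by
    rintro 𝒯 ⟨I, hI, -, rfl⟩ T hT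
    obtain ⟨hTl, hsize⟩ := Finset.mem_filter.1 hT
    obtain ⟨g, hg⟩ := (mem_leaves.1 hTl).1.isNode hI
    have hq : Q g T.newVertex := Or.inl (hsize.trans_le (hH g T hg))
    exact mem_gradedTree.2 ⟨g, hG g _ hq, hg, hq⟩
  have h2 : ∀ 𝒯 ℓ, Below 𝒯₀ (gradedTree 𝒯₀ Q G) 𝒯 → ℓ < d * (K + 1) →
      secondMarked x γ p δ ℓ 𝒯 ⊆ gradedTree 𝒯₀ Q G := by
    rintro 𝒯 ℓ ⟨I, hI, -, rfl⟩ hℓ T hT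
    obtain ⟨g, hg⟩ := (mem_leaves.1 (secondMarked_subset x γ p δ ℓ _ hT)).1.isNode hI
    have hq : Q g T.newVertex :=
      gradedCond_of_mem_secondMarked hd h𝒯₀ hN hxs hδ hDF hH hD hI hℓ hT hg
    exact mem_gradedTree.2 ⟨g, hG g _ hq, hg, hq⟩
  -- Both loops mark only members of the graded tree, so existence of a run and the bound for every
  -- run follow from the same comparison.
  refine ⟨nonempty_run hd h𝒯₀ hJ hJc h1 h2, fun R => ?_⟩
  obtain ⟨I, -, hIJ, he⟩ := R.below_output hd h𝒯₀ hJ hJc h1 h2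
  have hout : (R.output.card : ℝ) ≤ 𝒯₀.card + 2 * I.card := by
    rw [he]; exact_mod_cast card_leaves_le 𝒯₀ I
  have hIJ' : (I.card : ℝ) ≤ (gradedTree 𝒯₀ Q G).card := by
    exact_mod_cast Finset.card_le_card hIJ
  have hJcard := hC δ (d * (K + 1)) G hδ hδ1
  have hKle := steps_le hd2 hγ p K hδ hδ1 hK
  rw [← hκ] at hKle
  have hLle : ((d * (K + 1) : ℕ) : ℝ) ≤ d * (2 / κ + 1) * (δ ^ d)⁻¹ := by
    push_cast
    rw [mul_assoc]
    refine mul_le_mul_of_nonneg_left ?_ (Nat.cast_nonneg d)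
    rw [add_mul]; linarith
  have hsum := mul_le_mul_of_nonneg_left (add_le_add_right hLle (δ ^ d)⁻¹) hC0
  have : C * ((δ ^ d)⁻¹ + d * (2 / κ + 1) * (δ ^ d)⁻¹) =
      C * (1 + d * (2 / κ + 1)) * (δ ^ d)⁻¹ := by ring
  linarith
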